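/- **Conventions (scale calculus of Hofer–Wysocki–Zehnder).** A sc-Banach space $\mathbb E=(E_m)_{m\ge 0}$ is a nested sequence of real Banach spaces with compact inclusions $E_{m+1}\hookrightarrow E_m$ such that $E_\infty=\bigcap_m E_m$ is dense in every $E_m$; $\mathbb R^k$ carries the constant structure, and $\mathbb E^1=(E_{m+1})_m$. A sc-operator is a linear map that is bounded $E_m\to F_m$ for all $m$; a sc-isomorphism is a bijective sc-operator whose inverse is a sc-operator. For $U$ relatively open in a partial quadrant of $\mathbb E$ (a set corresponding to $[0,\infty)^n\oplus W$ under a sc-isomorphism $\mathbb E\cong\mathbb R^n\oplus\mathbb W$), a map $f:U\to\mathbb F$ is $sc^0$ if it restricts to continuous maps $U\cap E_m\to F_m$ for all $m$. It is $sc^{k+1}$ if it is $sc^0$, if for all $m$ the map $f:U\cap E_{m+1}\to F_m$ is differentiable with differential extending to bounded operators ${\rm d}f(x):E_m\to F_m$, and if ${\rm T}f(x,X)=(f(x),{\rm d}f(x)X)$ is $sc^k$ on ${\rm T}U=(U\cap E_{m+1}\oplus E_m)_m$. It is sc-smooth if it is $sc^k$ for all $k$. A strong bundle map $U\triangleleft\mathbb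 F\to U'\triangleleft\mathbb F'$ is a map $(e,h)\mapsto(\psi(e),\Psi_e h)$, linear in $h$, with $\psi$ sc-smooth, $(e,h)\mapsto \Psi_e h$ sc-smooth $U\oplus\mathbb F\to\mathbb F'$ and restricting to a sc-smooth map $U\oplus\mathbb F^1\to\mathbb F'^1$. A strong bundle isomorphism is one with an inverse of the same kind. A sc$^+$-section over $U$ is given by a sc-smooth map $U\to\mathbb F^1$. *Basic germs.* A basic germ is a sc-smooth map $f:V\to\mathbb R^N\times\mathbb W$ of the form $(c,w)\mapsto(a(c,w),w-B(c,w))$, with $V$ a neighbourhood of $0$ in $\mathbb R^k\times\mathbb W$ (or, in the case with boundary and corners, relatively open in $[0,\infty)^d\times\mathbb R^{k-d}\times\mathbb W$) and with $B:V\to\mathbb W$ sc-smooth such that for all $i\ge0$, $\epsilon>0$ there is $\delta>0$ with $\|B(c,w_1)-B(c,w_2)\|_i\le\epsilon\|w_1-w_2\|_i$ whenever $(c,w_1),(c,w_2)\in V$, $w_1,w_2\in W_i$ and $|c|,\|w_1\|_i,\|w_2\|_i<\delta$. A sc-smooth map $g$ is *conjugate to a basic germ at $e_0$* if there are a neighbourhood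 $U'$ of $e_0$ in the domain of $g$, a sc$^+$-section $s_0$ over $U'$ with $s_0(e_0)=g(e_0)$, and a strong bundle isomorphism $(\psi,\Psi):U'\triangleleft\mathbb F\to V\triangleleft(\mathbb R^N\times\mathbb W)$ with $\psi(e_0)=0$ such that $v\mapsto\Psi_{\psi^{-1}(v)}\big((g-s_0)(\psi^{-1}(v))\big)$ is a basic germ. A sc-smooth map $s:\mathbb E\to\mathbb F$ is *sc-Fredholm at $e_0\in E_\infty$* if it is regularizing ($s^{-1}(F_i)\subset E_i$ for all $i$) and conjugate to a basic germ at $e_0$ (without boundary, $d=0$). *Strong bundles.* A local strong bundle $K\to O$ is the image of a strong bundle retraction $R(e,h)=(r(e),\Gamma_e h)$, $R\circ R=R$, of $U\triangleleft\mathbb F$, where $U$ is relatively open in a partial quadrant $C$ of $\mathbb E$ and $O=r(U)$. Its fibres are $K_e=\{h:\Gamma_e h=h\}$, and ${\rm T}_eO={\rm im}\,{\rm d}r(e)$. It is tame if $r$ preserves the number of vanishing quadrant coordinates and if at every smooth $e\in O$ the space ${\rm T}_eO$ has a sc-complement inside the tangent space of the face of $C$ through $e$. A strong bundle $P:\mathcal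 Y\to\mathcal X$ over an M-polyfold $\mathcal X$ (paracompact Hausdorff) is given by local trivializations $P^{-1}(\mathcal U)\simeq K$, i.e. homeomorphisms, linear on fibres, covering homeomorphisms $\mathcal U\simeq O$, whose transition maps (composed with the retractions) are strong bundle maps. The levels $\mathcal X_m$, with their topologies, and $\mathcal X_\infty=\bigcap_m\mathcal X_m$ are induced by these charts. A section $\sigma$ is *sc-Fredholm* if it is sc-smooth, regularizing ($x\in\mathcal X_m$ and $\sigma(x)$ of fibre level $m+1$ imply $x\in\mathcal X_{m+1}$), and if every smooth point $x$ has a tame local trivialization around it, with $x$ corresponding to $e_0$ and $\sigma$ to $\hat\sigma$, and a filling $g$ of $\hat\sigma$ that is conjugate to a basic germ at $e_0$. Here a filling is a sc-smooth $g:U\to\mathbb F$ with $g=\hat\sigma$ on $O$; with $y\in O$ whenever $\Gamma_{r(y)}g(y)=g(y)$; and such that the linearization at $e_0$ of $y\mapsto({\rm id}-\Gamma_{r(y)})g(y)$ restricts to an isomorphism $\ker{\rm d}r(e_0)\to\ker\Gamma_{e_0}$. In a local trivialization over $\mathcal U$, in which $x\in\mathcal U_\infty$ corresponds to $e$, the linearization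 is ${\rm D}\sigma(x)=\Gamma_e\,{\rm d}(\hat\sigma\circ r)(e)|_{{\rm T}_eO}:{\rm T}_x\mathcal X={\rm T}_eO\to\mathcal Y_x=K_e$. **Corollary 3.3.** (a) Let $s:\mathbb E\to\mathbb F$ be sc-Fredholm at every $e_0\in E_\infty$. Then for every integer $i\ge1$ the following subsets of $E_\infty$ are open with respect to the $E_{i+1}$-topology: $$\{e\in E_\infty\mid {\rm d}s(e)(E_i)=F_i\},\qquad \{e\in E_\infty\mid {\rm d}s(e):E_i\to F_i\text{ is an isomorphism}\},\qquad \{e\in E_\infty\mid{\rm d}s(e):\mathbb E\to\mathbb F\text{ is a sc-isomorphism}\}.$$ (b) Let $\sigma:\mathcal X\to\mathcal Y$ be a sc-Fredholm section of a strong bundle $P:\mathcal Y\to\mathcal X$, and fix any local trivialization $P^{-1}(\mathcal U)\simeq K$ over an open subset $\mathcal U\subset\mathcal X$. Then for every integer $i\ge1$ the following subsets of $\mathcal U_\infty=\mathcal U\cap\mathcal X_\infty$ are open with respect to the $\mathcal X_{i+1}$-topology: $$\{x\in\mathcal U_\infty\mid{\rm D}\sigma(x)({\rm T}_x\mathcal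 X_i)=(\mathcal Y_x)_i\},\qquad \{x\in\mathcal U_\infty\mid{\rm D}\sigma(x):{\rm T}_x\mathcal X_i\to(\mathcal Y_x)_i\text{ is an isomorphism}\},$$ $$\{x\in\mathcal U_\infty\mid{\rm D}\sigma(x):{\rm T}_x\mathcal X\to\mathcal Y_x\text{ is a sc-isomorphism}\}.$$ -/

import Mathlib

open Set Topology

universe u v w

/-! ### Scale Banach spaces -/

/-- A scale Banach space: Banach spaces `L 0 ⊇ L 1 ⊇ L 2 ⊇ …` with compact inclusions `incl m`, such that
the intersection of all levels is dense in every level. -/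
structure ScSpace : Type (u + 1) where
  L : ℕ → Type u
  [normed : ∀ m, NormedAddCommGroup (L m)]
  [space : ∀ m, NormedSpace ℝ (L m)]
  [complete : ∀ m, CompleteSpace (L m)]
  incl : ∀ m, L (m + 1) →L[ℝ] L m
  incl_injective : ∀ m, Function.Injective (incl m)
  incl_compact : ∀ m, IsCompactOperator (incl m)
  dense : ∀ m, DenseRange
    (fun e : {x : ∀ j, L j // ∀ j, incl j (x (j + 1)) = x j} => e.1 m)

namespace ScSpace

attribute [instance] ScSpace.normed ScSpace.space ScSpace.complete

/-- The intersection `E_∞` of all levels: a point together with its representatives on all levels. -/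
abbrev Smooth (E : ScSpace.{u}) : Type u :=
  {x : ∀ j, E.L j // ∀ j, E.incl j (x (j + 1)) = x j}

/-- The inclusion of level `m` into level `0`. -/
def down (E : ScSpace.{u}) : ∀ m, E.L m →L[ℝ] E.L 0
  | 0 => ContinuousLinearMap.id ℝ (E.L 0)
  | m + 1 => (E.down m).comp (E.incl m)

/-- The `m`-th level `U ∩ E_m` of a subset `U` of `E_0`, as a subset of the Banach space `E_m`. -/
def lev (E : ScSpace.{u}) (U : Set (E.L 0)) (m : ℕ) : Set (E.L m) := {x | E.down m x ∈ U}

/-- The shifted scale `E¹ = (E_{m+1})_m`. -/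
abbrev shift (E : ScSpace.{u}) : ScSpace.{u} where
  L m := E.L (m + 1)
  incl m := E.incl (m + 1)
  incl_injective m := E.incl_injective (m + 1)
  incl_compact m := E.incl_compact (m + 1)
  dense m := by
    refine (E.dense (m + 1)).mono ?_
    rintro _ ⟨e, rfl⟩
    exact ⟨⟨fun j => e.1 (j + 1), fun j => e.2 (j + 1)⟩, rfl⟩

theorem compact_prodMap {A B A' B' : Type u} [NormedAddCommGroup A] [NormedSpace ℝ A]
    [NormedAddCommGroup B] [NormedSpace ℝ B] [NormedAddCommGroup A'] [NormedSpace ℝ A']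
    [NormedAddCommGroup B'] [NormedSpace ℝ B'] (f : A →L[ℝ] A') (g : B →L[ℝ] B')
    (hf : IsCompactOperator f) (hg : IsCompactOperator g) :
    IsCompactOperator (f.prodMap g) := by
  obtain ⟨K, hK, hK'⟩ := hf
  obtain ⟨K₂, hK₂, hK₂'⟩ := hg
  refine ⟨K ×ˢ K₂, hK.prod hK₂, ?_⟩
  have := prod_mem_nhds hK' hK₂'
  exact this

/-- The product scale `E ⊕ F`. -/
noncomputable abbrev prod (E F : ScSpace.{u}) : ScSpace.{u} where
  L m := E.L m × F.L m
  incl m := (E.incl m).prodMap (F.incl m)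
  incl_injective m := Function.Injective.prodMap (E.incl_injective m) (F.incl_injective m)
  incl_compact m := compact_prodMap _ _ (E.incl_compact m) (F.incl_compact m)
  dense m := by
    refine ((E.dense m).prodMap (F.dense m)).mono ?_
    rintro _ ⟨⟨e, f⟩, rfl⟩
    exact ⟨⟨fun j => (e.1 j, f.1 j), fun j => Prod.ext (e.2 j) (f.2 j)⟩, rfl⟩

/-- The scale `ℝⁿ ⊕ W`, where `ℝⁿ` carries the constant scale structure. -/
noncomputable abbrev addFin (W : ScSpace.{u}) (n : ℕ) : ScSpace.{u} where
  L m := EuclideanSpace ℝ (Fin n) × W.L m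
  incl m := (ContinuousLinearMap.id ℝ (EuclideanSpace ℝ (Fin n))).prodMap (W.incl m)
  incl_injective m := Function.Injective.prodMap Function.injective_id (W.incl_injective m)
  incl_compact m := by
    obtain ⟨K, hK, hK'⟩ := W.incl_compact m
    refine ⟨Metric.closedBall 0 1 ×ˢ K, (isCompact_closedBall _ _).prod hK, ?_⟩
    exact prod_mem_nhds (Metric.closedBall_mem_nhds 0 one_pos) hK'
  dense m := by
    refine ((denseRange_id (X := EuclideanSpace ℝ (Fin n))).prodMap (W.dense m)).mono ?_
    rintro _ ⟨⟨c, e⟩, rfl⟩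
    exact ⟨⟨fun j => (c, e.1 j), fun j => Prod.ext rfl (e.2 j)⟩, rfl⟩

/-- The tangent scale `TE = (E_{m+1} ⊕ E_m)_m`. -/
noncomputable abbrev tangent (E : ScSpace.{u}) : ScSpace.{u} := E.shift.prod E

end ScSpace

/-! ### Linear sc-operators -/

/-- A sc-operator: a linear map `E_0 → F_0` inducing bounded operators `E_m → F_m` on all levels. -/
structure ScOp (E F : ScSpace.{u}) where
  map : ∀ m, E.L m →L[ℝ] F.L m
  comm : ∀ m x, F.incl m (map (m + 1) x) = map m (E.incl m x)

/-- A sc-isomorphism `E → F`, with its inverse. -/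
structure ScIso (E F : ScSpace.{u}) where
  fwd : ScOp E F
  bwd : ScOp F E
  left_inv : ∀ m x, bwd.map m (fwd.map m x) = x
  right_inv : ∀ m y, fwd.map m (bwd.map m y) = y

/-- The sc-operator `D` is a sc-isomorphism. -/
def ScOp.IsScIso {E F : ScSpace.{u}} (D : ScOp E F) : Prop :=
  ∃ Ψ : ScIso E F, Ψ.fwd = D

/-- On level `i` the sc-operator `D` is an isomorphism of Banach spaces `E_i → F_i`. -/
def ScOp.IsIsoOnLevel {E F : ScSpace.{u}} (D : ScOp E F) (i : ℕ) : Prop :=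
  ∃ A : E.L i ≃L[ℝ] F.L i, (A : E.L i →L[ℝ] F.L i) = D.map i

/-! ### Sc-smooth maps

A map between (subsets of) scale Banach spaces that preserves levels is recorded by the family of its
restrictions to the levels; values outside the domain under consideration are irrelevant. -/

abbrev ScFam (E F : ScSpace.{u}) : Type u := ∀ m, E.L m → F.L m

/-- `f` is sc-continuous on `U`: it is a map on `U` that restricts to continuous maps `U ∩ E_m → F_m`. -/
def IsScContinuous {E F : ScSpace.{u}} (U : Set (E.L 0)) (f : ScFam E F) : Prop :=
  (∀ m, ContinuousOn (f m) (E.lev U m)) ∧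
    ∀ m, ∀ x ∈ E.lev U (m + 1), F.incl m (f (m + 1) x) = f m (E.incl m x)

/-- The tangent map `Tf (x, X) = (f x, D x X)`, given the differential `D`. -/
def scTangentMap {E F : ScSpace.{u}} (f : ScFam E F)
    (D : ∀ m, E.L (m + 1) → (E.L m →L[ℝ] F.L m)) : ScFam E.tangent F.tangent :=
  fun m p => (f (m + 1) p.1, D m p.1 p.2)

/-- The domain `TU = {(x, X) ∈ E_1 ⊕ E_0 | x ∈ U}` of the tangent map. -/
def scTangentDom {E : ScSpace.{u}} (U : Set (E.L 0)) : Set (E.tangent.L 0) :=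
  {p | E.incl 0 p.1 ∈ U}

/-- `f` is of class `sc^k` on `U`. For `k + 1`: on each level `f : E_{m+1} → F_m` is differentiable at the
points of `U ∩ E_{m+1}`, the differential extends to a bounded operator `E_m → F_m`, and the tangent map
`Tf : TU → TF` is of class `sc^k` (in particular `(x, X) ↦ Df(x) X` is continuous
`E_{m+1} ⊕ E_m → F_m`). -/
def IsScC : ℕ → ∀ {E F : ScSpace.{u}}, Set (E.L 0) → ScFam E F → Prop
  | 0, _, _, U, f => IsScContinuous U f
  | k + 1, E, F, U, f => IsScContinuous U f ∧
      ∃ D : ∀ m, E.L (m + 1) → (E.L m →L[ℝ] F.L m),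
        (∀ m, ∀ x ∈ E.lev U (m + 1),
          HasFDerivWithinAt (fun y => F.incl m (f (m + 1) y)) ((D m x).comp (E.incl m))
            (E.lev U (m + 1)) x) ∧
        IsScC k (scTangentDom U) (scTangentMap f D)

/-- `f` is sc-smooth on `U`. -/
def IsScSmooth {E F : ScSpace.{u}} (U : Set (E.L 0)) (f : ScFam E F) : Prop :=
  ∀ k, IsScC k U f

/-- `D` is the sc-differential of `f : U → F` at the smooth point `e`. -/
def HasScDeriv {E F : ScSpace.{u}} (f : ScFam E F) (U : Set (E.L 0)) (e : E.Smooth)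
    (D : ScOp E F) : Prop :=
  ∀ m, HasFDerivWithinAt (fun y => F.incl m (f (m + 1) y)) ((D.map m).comp (E.incl m))
    (E.lev U (m + 1)) (e.1 (m + 1))

/-- `U` is relatively open in `C`. -/
def IsRelOpen {A : Type*} [TopologicalSpace A] (C U : Set A) : Prop :=
  ∃ O, IsOpen O ∧ U = C ∩ O

/-! ### Strong bundle maps, basic germs and sc-Fredholm maps -/

/-- `G` is the fibre part of a strong bundle map `U ◁ F → E' ◁ F'`, `(x, h) ↦ (g x, G (x, h))`: it is
linear in `h`, sc-smooth `U ⊕ F → F'`, and restricts to a sc-smooth map `U ⊕ F¹ → F'¹`. -/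
def IsStrongMap {E F F' : ScSpace.{u}} (U : Set (E.L 0)) (G : ScFam (E.prod F) F') : Prop :=
  IsScSmooth (E := E.prod F) (U ×ˢ univ) G ∧
  (∀ x ∈ U, IsLinearMap ℝ (fun h : F.L 0 => G 0 (x, h))) ∧
  ∃ G₁ : ScFam (E.prod F.shift) F'.shift,
    IsScSmooth (E := E.prod F.shift) (U ×ˢ univ) G₁ ∧
    ∀ x ∈ U, ∀ h : F.L 1, F'.incl 0 (G₁ 0 (x, h)) = G 0 (x, F.incl 0 h)

/-- `(x, h) ↦ (ψ x, Ψ (x, h))` is a strong bundle isomorphism `U ◁ F → V ◁ F'` with inverse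
`(y, h) ↦ (ψ' y, Ψ' (y, h))`; in particular `ψ : U → V` is a sc-diffeomorphism. -/
structure IsStrongIso {E F E' F' : ScSpace.{u}} (U : Set (E.L 0)) (V : Set (E'.L 0))
    (ψ : ScFam E E') (ψ' : ScFam E' E) (Ψ : ScFam (E.prod F) F') (Ψ' : ScFam (E'.prod F') F) :
    Prop where
  smooth : IsScSmooth U ψ
  smooth' : IsScSmooth V ψ'
  mapsTo : MapsTo (ψ 0) U V
  mapsTo' : MapsTo (ψ' 0) V U
  left_inv : ∀ x ∈ U, ψ' 0 (ψ 0 x) = x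
  right_inv : ∀ y ∈ V, ψ 0 (ψ' 0 y) = y
  strong : IsStrongMap U Ψ
  strong' : IsStrongMap V Ψ'
  fibre_left_inv : ∀ x ∈ U, ∀ h, Ψ' 0 (ψ 0 x, Ψ 0 (x, h)) = h
  fibre_right_inv : ∀ y ∈ V, ∀ h, Ψ 0 (ψ' 0 y, Ψ' 0 (y, h)) = h

/-- The standard partial quadrant `[0,∞)^d ⊕ ℝ^{k-d} ⊕ W` in `ℝ^k ⊕ W`. -/
def stdQuadrant (W : ScSpace.{u}) (k d : ℕ) : Set ((W.addFin k).L 0) :=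
  {p | ∀ j : Fin k, j.val < d → 0 ≤ p.1 j}

/-- `f : V → ℝ^N ⊕ W`, with `V ⊆ ℝ^k ⊕ W`, is a basic germ at `0`: it is sc-smooth and of the form
`(c, w) ↦ (a (c, w), w - B (c, w))` with `B` sc-smooth and a contraction near `0` on every level. -/
def IsBasicGerm {W : ScSpace.{u}} {k N : ℕ} (V : Set ((W.addFin k).L 0))
    (f : ScFam (W.addFin k) (W.addFin N)) : Prop :=
  IsScSmooth V f ∧
  ∃ B : ScFam (W.addFin k) W, IsScSmooth V B ∧
    (∀ p ∈ V, (f 0 p).2 = p.2 - B 0 p) ∧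
    ∀ i : ℕ, ∀ ε : ℝ, 0 < ε → ∃ δ : ℝ, 0 < δ ∧
      ∀ (c : EuclideanSpace ℝ (Fin k)) (w₁ w₂ : W.L i),
        (c, w₁) ∈ (W.addFin k).lev V i → (c, w₂) ∈ (W.addFin k).lev V i →
        ‖c‖ < δ → ‖w₁‖ < δ → ‖w₂‖ < δ →
        ‖B i (c, w₁) - B i (c, w₂)‖ ≤ ε * ‖w₁ - w₂‖

/-- After subtracting a sc⁺-section `s₀` with `s₀ e₀ = g e₀`, and after a strong bundle isomorphism that
moves `e₀` to `0`, the map `g : U → F` becomes, near `e₀`, a basic germ defined on a relatively open subset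
of `[0,∞)^d ⊕ ℝ^{k-d} ⊕ W`. -/
def ConjToBasicGerm {E F : ScSpace.{u}} (U : Set (E.L 0)) (d : ℕ) (g : ScFam E F)
    (e₀ : E.Smooth) : Prop :=
  ∃ (W : ScSpace.{u}) (k N : ℕ) (U' : Set (E.L 0)) (V : Set ((W.addFin k).L 0))
    (s₀ : ScFam E F.shift)
    (ψ : ScFam E (W.addFin k)) (ψ' : ScFam (W.addFin k) E)
    (Ψ : ScFam (E.prod F) (W.addFin N)) (Ψ' : ScFam ((W.addFin k).prod (W.addFin N)) F)
    (f : ScFam (W.addFin k) (W.addFin N)),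
    e₀.1 0 ∈ U' ∧ IsRelOpen U U' ∧ IsRelOpen (stdQuadrant W k d) V ∧
    IsScSmooth U' s₀ ∧ F.incl 0 (s₀ 0 (e₀.1 0)) = g 0 (e₀.1 0) ∧
    IsStrongIso U' V ψ ψ' Ψ Ψ' ∧ ψ 0 (e₀.1 0) = 0 ∧
    (∀ v ∈ V, f 0 v = Ψ 0 (ψ' 0 v, g 0 (ψ' 0 v) - F.incl 0 (s₀ 0 (ψ' 0 v)))) ∧
    IsBasicGerm V f

/-- The sc-smooth map `s : E → F` is sc-Fredholm at the smooth point `e₀`: it is regularizing, and an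
admissible change of coordinates brings it into the form of a basic germ. -/
def IsScFredholmAt {E F : ScSpace.{u}} (s : ScFam E F) (e₀ : E.Smooth) : Prop :=
  IsScSmooth univ s ∧
  (∀ i, ∀ x : E.L 0, s 0 x ∈ range (F.down i) → x ∈ range (E.down i)) ∧
  ConjToBasicGerm univ 0 s e₀

/-! ### Partial quadrants, retracts and local strong bundle models -/

/-- A partial quadrant in `E`: a sc-isomorphism `E ≅ ℝⁿ ⊕ W`, the quadrant being the preimage of
`[0,∞)ⁿ ⊕ W`. -/
structure PartialQuadrant (E : ScSpace.{u}) where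
  n : ℕ
  W : ScSpace.{u}
  iso : ScIso E (W.addFin n)

namespace PartialQuadrant

variable {E : ScSpace.{u}} (C : PartialQuadrant E)

/-- The `j`-th coordinate in `ℝⁿ`. -/
noncomputable def coord (j : Fin C.n) (x : E.L 0) : ℝ := (C.iso.fwd.map 0 x).1 j

/-- The partial quadrant as a subset of `E_0`. -/
def carrier : Set (E.L 0) := {x | ∀ j, 0 ≤ C.coord j x}

/-- The degeneracy index of a point: the number of its vanishing coordinates. -/
noncomputable def degeneracy (x : E.L 0) : ℕ := {j | C.coord j x = 0}.ncard

end PartialQuadrant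

/-- A strong bundle retraction `R (x, h) = (r x, Γ (x, h))` of `U ◁ F`, where `U` is relatively open in a
partial quadrant. It defines the retract `O = r U` and the local strong bundle `K = R (U ◁ F) → O`. -/
structure StrongModel : Type (u + 1) where
  E : ScSpace.{u}
  F : ScSpace.{u}
  C : PartialQuadrant E
  U : Set (E.L 0)
  relOpen : IsRelOpen C.carrier U
  r : ScFam E E
  r_smooth : IsScSmooth U r
  r_mapsTo : MapsTo (r 0) U U
  r_idem : ∀ x ∈ U, r 0 (r 0 x) = r 0 x
  Γ : ScFam (E.prod F) F
  Γ_strong : IsStrongMap U Γ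
  Γ_idem : ∀ x ∈ U, ∀ h, Γ 0 (r 0 x, Γ 0 (x, h)) = Γ 0 (x, h)

namespace StrongModel

variable (M : StrongModel.{u})

/-- The retract `O = r U`, the base of the local strong bundle. -/
def O : Set (M.E.L 0) := M.r 0 '' M.U

/-- The model is tame: `r` preserves the degeneracy index, and at every smooth point `e ∈ O` the tangent
space `T_e O = im Dr(e)` has a sc-complement (the kernel of the sc-projection `π`) which is contained in
the tangent space of the face of the quadrant through `e`. -/
def IsTame : Prop :=
  (∀ x ∈ M.U, M.C.degeneracy (M.r 0 x) = M.C.degeneracy x) ∧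
  ∀ e : M.E.Smooth, e.1 0 ∈ M.O → ∃ P π : ScOp M.E M.E,
    HasScDeriv M.r M.U e P ∧
    (∀ m X, π.map m (π.map m X) = π.map m X) ∧
    (∀ m, range (π.map m) = range (P.map m)) ∧
    ∀ X, π.map 0 X = 0 → ∀ j, M.C.coord j (e.1 0) = 0 → M.C.coord j X = 0

/-- `g : U → F` is a filling at the smooth point `e₀ ∈ O` of the section `e ↦ (e, τ e)` of `K → O`:
`g` is sc-smooth and agrees with `τ` on `O`; if `g y` lies in the fibre over `r y` then `y ∈ O`; and the
linearization at `e₀` of `y ↦ g y - Γ (r y, g y)` restricts to an isomorphism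
`ker Dr(e₀) → ker Γ(e₀, ·)`. (A bounded bijection of Banach spaces is a topological isomorphism.) -/
def IsFilling (τ : M.E.L 0 → M.F.L 0) (g : ScFam M.E M.F) (e₀ : M.E.Smooth) : Prop :=
  IsScSmooth M.U g ∧
  (∀ e ∈ M.O, g 0 e = τ e) ∧
  (∀ y ∈ M.U, M.Γ 0 (M.r 0 y, g 0 y) = g 0 y → y ∈ M.O) ∧
  ∃ (P : ScOp M.E M.E) (H : ScOp M.E M.F),
    HasScDeriv M.r M.U e₀ P ∧
    HasScDeriv (fun m y => g m y - M.Γ m (M.r m y, g m y)) M.U e₀ H ∧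
    BijOn (H.map 0) {X | P.map 0 X = 0} {h | M.Γ 0 (e₀.1 0, h) = 0}

end StrongModel

/-! ### Strong bundles over M-polyfolds

`X` is the base, `Y x` is the fibre over `x`, and `Bundle.TotalSpace Unit Y` is the total space, with
projection `Bundle.TotalSpace.proj`. -/

section Bundles

variable (X : Type v) [TopologicalSpace X] (Y : X → Type w) [∀ x, AddCommGroup (Y x)]
  [∀ x, Module ℝ (Y x)] [TopologicalSpace (Bundle.TotalSpace Unit Y)]

/-- A topological local trivialization `P⁻¹(dom) ≃ K` over an open set `dom ⊆ X`, where `K → O` is a local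
strong bundle: a homeomorphism onto `K`, linear on the fibres, covering a homeomorphism `φ : dom → O`. -/
structure StrongChart where
  M : StrongModel.{u}
  dom : Set X
  dom_open : IsOpen dom
  φ : X → M.E.L 0
  φ_embedding : IsEmbedding (fun x : dom => φ x)
  φ_image : φ '' dom = M.O
  Φ : ∀ x, Y x →ₗ[ℝ] M.F.L 0
  Φ_injective : ∀ x ∈ dom, Function.Injective (Φ x)
  Φ_range : ∀ x ∈ dom, range (Φ x) = {h | M.Γ 0 (φ x, h) = h}
  Φ_embedding : IsEmbedding
    (fun p : {p : Bundle.TotalSpace Unit Y // p.proj ∈ dom} =>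
      ((φ p.1.proj, Φ p.1.proj p.1.snd) : M.E.L 0 × M.F.L 0))

variable {X Y}

namespace StrongChart

/-- The transition map from the trivialization `c` to `c'` is a strong bundle map: precomposed with the
retractions, it is given by a sc-smooth map on the base and by the fibre part of a strong bundle map. -/
def Transition (c c' : StrongChart.{u} X Y) : Prop :=
  ∃ (t : ScFam c.M.E c'.M.E) (G : ScFam (c.M.E.prod c.M.F) c'.M.F),
    IsScSmooth {y ∈ c.M.U | c.M.r 0 y ∈ c.φ '' (c.dom ∩ c'.dom)} t ∧
    IsStrongMap {y ∈ c.M.U | c.M.r 0 y ∈ c.φ '' (c.dom ∩ c'.dom)} G ∧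
    ∀ y ∈ c.M.U, ∀ x ∈ c.dom ∩ c'.dom, c.φ x = c.M.r 0 y →
      t 0 y = c'.φ x ∧
      ∀ (h : c.M.F.L 0) (η : Y x), c.Φ x η = c.M.Γ 0 (y, h) → G 0 (y, h) = c'.Φ x η

/-- `f` is the principal part, precomposed with the retraction `r`, of the section `σ` in the
trivialization `c`, and it is sc-smooth. -/
def IsLocalRep (c : StrongChart.{u} X Y) (σ : ∀ x, Y x) (f : ScFam c.M.E c.M.F) : Prop :=
  IsScSmooth c.M.U f ∧
  ∀ y ∈ c.M.U, ∀ x ∈ c.dom, c.φ x = c.M.r 0 y → f 0 y = c.Φ x (σ x)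

/-- The linearization of the section `σ` in the trivialization `c` at the point `e ∈ O ∩ E_∞`: here
`P = Dr(e)` is the projection onto the tangent space `T_e O`, `Q = Γ(e, ·)` is the projection onto the
fibre `K_e`, and `D : E → F` restricts on `T_e O = im P` to the differential of the principal part of `σ`,
followed by `Q`; this restriction is the linearization `Dσ : T_e O → K_e`. -/
def IsLinearization (c : StrongChart.{u} X Y) (σ : ∀ x, Y x) (e : c.M.E.Smooth)
    (P : ScOp c.M.E c.M.E) (Q : ScOp c.M.F c.M.F) (D : ScOp c.M.E c.M.F) : Prop :=
  HasScDeriv c.M.r c.M.U e P ∧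
  (∀ m h, Q.map m h = c.M.Γ m (e.1 m, h)) ∧
  ∃ (f : ScFam c.M.E c.M.F) (D' : ScOp c.M.E c.M.F),
    c.IsLocalRep σ f ∧ HasScDeriv f c.M.U e D' ∧ ∀ m X, D.map m X = Q.map m (D'.map m X)

end StrongChart

/-- `D` maps the `i`-th level of `im P` onto the `i`-th level of `im Q`, for sc-projections `P`, `Q`. -/
def MapsLevelOnto {E F : ScSpace.{u}} (P : ScOp E E) (Q : ScOp F F) (D : ScOp E F) (i : ℕ) : Prop :=
  D.map i '' range (P.map i) = range (Q.map i)

/-- `D` restricts to an isomorphism of Banach spaces from the `i`-th level of `im P` onto the `i`-th level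
of `im Q`, for sc-projections `P`, `Q`; the inverse is written as a bounded operator on `F_i`. -/
def IsIsoOnLevelBetween {E F : ScSpace.{u}} (P : ScOp E E) (Q : ScOp F F) (D : ScOp E F) (i : ℕ) :
    Prop :=
  ∃ A : F.L i →L[ℝ] E.L i,
    (∀ X ∈ range (P.map i), D.map i X ∈ range (Q.map i) ∧ A (D.map i X) = X) ∧
    ∀ h ∈ range (Q.map i), A h ∈ range (P.map i) ∧ D.map i (A h) = h

/-- `D` restricts to a sc-isomorphism from `im P` onto `im Q`, for sc-projections `P`, `Q`; the inverse is
written as a sc-operator on `F`. -/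
def IsScIsoBetween {E F : ScSpace.{u}} (P : ScOp E E) (Q : ScOp F F) (D : ScOp E F) : Prop :=
  ∃ A : ScOp F E, ∀ m,
    (∀ X ∈ range (P.map m), D.map m X ∈ range (Q.map m) ∧ A.map m (D.map m X) = X) ∧
    ∀ h ∈ range (Q.map m), A.map m h ∈ range (P.map m) ∧ D.map m (A.map m h) = h

variable (X Y)

/-- A strong bundle `Y → X` over an M-polyfold `X`, given by an atlas of local trivializations; the maps
`φ` of these trivializations form the atlas of the M-polyfold `X`. -/
structure StrongBundle where
  atlas : Set (StrongChart.{u} X Y)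
  cover : ∀ x, ∃ c ∈ atlas, x ∈ c.dom
  compat : ∀ c ∈ atlas, ∀ c' ∈ atlas, c.Transition c'

variable {X Y}

namespace StrongBundle

variable (S : StrongBundle.{u} X Y)

/-- `c` is a local trivialization of the strong bundle: it is compatible with the atlas. -/
def IsTrivialization (c : StrongChart.{u} X Y) : Prop :=
  ∀ c' ∈ S.atlas, c.Transition c' ∧ c'.Transition c

/-- The `m`-th level `X_m` of the base. -/
def Level (m : ℕ) : Type v := {x : X // ∃ c ∈ S.atlas, x ∈ c.dom ∧ c.φ x ∈ range (c.M.E.down m)}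

/-- The topology of `X_m`, for which the charts are homeomorphisms from the level `m` of their domains onto
`O ∩ E_m` with the topology of `E_m`. -/
abbrev levelTopology (m : ℕ) : TopologicalSpace (S.Level m) :=
  TopologicalSpace.generateFrom
    {A | ∃ c ∈ S.atlas, ∃ B : Set (c.M.E.L m), IsOpen B ∧
      A = {x : S.Level m | x.1 ∈ c.dom ∧ ∃ y ∈ B, c.M.E.down m y = c.φ x.1}}

/-- The set `X_∞ = ⋂ X_m` of smooth points. -/
def SmoothPt : Type v :=
  {x : X // ∀ m, ∃ c ∈ S.atlas, x ∈ c.dom ∧ c.φ x ∈ range (c.M.E.down m)}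

/-- The topology on `X_∞` induced by the inclusion into `X_m`. -/
abbrev smoothTopology (m : ℕ) : TopologicalSpace S.SmoothPt :=
  TopologicalSpace.induced (fun x => (⟨x.1, x.2 m⟩ : S.Level m)) (S.levelTopology m)

/-- `σ` is sc-Fredholm at `x`: in some tame local trivialization around `x` it has a filling which an
admissible change of coordinates brings into the form of a basic germ. -/
def IsFredholmAt (σ : ∀ x, Y x) (x : X) : Prop :=
  ∃ c : StrongChart.{u} X Y, S.IsTrivialization c ∧ c.M.IsTame ∧ x ∈ c.dom ∧
    ∃ (e₀ : c.M.E.Smooth) (τ : c.M.E.L 0 → c.M.F.L 0) (g : ScFam c.M.E c.M.F) (d : ℕ),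
      e₀.1 0 = c.φ x ∧ (∀ z ∈ c.dom, τ (c.φ z) = c.Φ z (σ z)) ∧
      c.M.IsFilling τ g e₀ ∧ ConjToBasicGerm c.M.U d g e₀

/-- `σ` is a sc-Fredholm section: sc-smooth, regularizing, and sc-Fredholm at every smooth point. -/
structure IsScFredholmSection (σ : ∀ x, Y x) : Prop where
  smooth : ∀ c ∈ S.atlas, ∃ f, c.IsLocalRep σ f
  regularizing : ∀ c ∈ S.atlas, ∀ x ∈ c.dom, ∀ m, c.φ x ∈ range (c.M.E.down m) →
    c.Φ x (σ x) ∈ range (c.M.F.down (m + 1)) → c.φ x ∈ range (c.M.E.down (m + 1))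
  fredholm : ∀ x : S.SmoothPt, S.IsFredholmAt σ x.1

end StrongBundle

end Bundles

/-! Differentials of sc-smooth maps depend only strongly continuously on the base point, so openness
is not automatic; it comes from the basic germ form. In germ coordinates the map is `(0, w - B)`
plus a part `S` that gains a level. For two points close to `0` on level `n + 2`, its increment
differs from that of the linearization at `0` by at most `ε` times the increment, measured on level
`n + 1` (`Germ.strict_F`). Indeed `S` is strictly differentiable because the inclusions are compact,
`B` contracts in `w` with arbitrarily small constant, and in the finite-dimensional directions,
where the norms of all levels agree, the loss of a level in the differentiability of `B` is
harmless. Hence the linearizations converge in operator norm on level `n + 1`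
(`Germ.linearization_near`), and surjectivity and bijectivity survive by a Neumann series
(`surjective_of_near`). Moreover the linearization at `0` is `(0, w)` plus an operator gaining a
level, so it is regularizing with finite-dimensional kernel and closed range
(`ScOp.IsFredholm.of_smoothing`); injectivity and surjectivity then do not depend on the level,
which settles the sets of sc-isomorphisms.

A bundle isomorphism conjugates linearizations only at zeros. Therefore the map `g` is treated
together with the family `g - q (·, h)`, `q` linear in the smooth parameter `h`; in part (a) this is
`s - h`. Each point concerned is a zero of the member with the right `h`, and there the
linearizations correspond (`GermChart.hasDerivWithinAt_F`). The term `q (·, h)` is harmless in the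
estimates because its derivative in the base is small for small `h`.

In part (b) the filling condition on the linearization is given at the centre only. At nearby points
one knows just the set-theoretic condition that `y` lies in the retract when `g y` lies in the fibre
over `r y`, and the transversality has to be recovered from it: a vector `X` that the linearization
maps into the fibre must be tangent to the retract. For strictly inward `X`, a Newton iteration
(`Germ.exists_zeros`) produces solutions of equations `g y = q (y, h)` at distance at most `C ρ t`
from a ray in a direction close to `X`, with `ρ` as small as desired. These solutions lie in the
retract, so `id - r` vanishes at them and its derivative annihilates `X` (`Germ.deriv_eq_zero`).
Tameness provides strictly inward vectors tangent to the retract, which removes the restriction on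
`X`. Linear algebra (`Transfer`) then passes between the filled linearization and that of the
section.

The calculus uses `Sc1` instead of sc-differentiability: along curves of smooth points the chain
rule is immediate, and differentials are compared by testing on rays that stay in the domain. -/

namespace ScSpace

/-! ### Smooth points, levels and sc-operators -/

variable (E : ScSpace.{u})

/-- The smooth points of a scale Banach space form a linear subspace of the product of the levels. -/
def smoothSubmodule : Submodule ℝ (∀ j, E.L j) where
  carrier := {x | ∀ j, E.incl j (x (j + 1)) = x j}
  add_mem' hx hy j := by simp [hx j, hy j]
  zero_mem' j := by simp
  smul_mem' c x hx j := by simp [hx j]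

noncomputable instance : AddCommGroup E.Smooth := inferInstanceAs (AddCommGroup E.smoothSubmodule)

noncomputable instance : Module ℝ E.Smooth := inferInstanceAs (Module ℝ E.smoothSubmodule)

variable {E}

@[simp] theorem Smooth.add_val (x y : E.Smooth) (j : ℕ) : (x + y).1 j = x.1 j + y.1 j := rfl
@[simp] theorem Smooth.sub_val (x y : E.Smooth) (j : ℕ) : (x - y).1 j = x.1 j - y.1 j := rfl
@[simp] theorem Smooth.smul_val (c : ℝ) (x : E.Smooth) (j : ℕ) : (c • x).1 j = c • x.1 j := rfl
@[simp] theorem Smooth.zero_val (j : ℕ) : (0 : E.Smooth).1 j = 0 := rfl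

theorem down_succ (m : ℕ) (x : E.L (m + 1)) : E.down (m + 1) x = E.down m (E.incl m x) := rfl

theorem down_injective (m : ℕ) : Function.Injective (E.down m) := by
  induction m with
  | zero => exact Function.injective_id
  | succ m ih => exact ih.comp (E.incl_injective m)

@[simp] theorem down_smooth (e : E.Smooth) (m : ℕ) : E.down m (e.1 m) = e.1 0 := by
  induction m with
  | zero => rfl
  | succ m ih => rw [down_succ, e.2, ih]

@[simp] theorem mem_lev {U : Set (E.L 0)} {m : ℕ} {x : E.L m} : x ∈ E.lev U m ↔ E.down m x ∈ U :=
  Iff.rfl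

theorem mem_lev_succ {U : Set (E.L 0)} {m : ℕ} {x : E.L (m + 1)} :
    x ∈ E.lev U (m + 1) ↔ E.incl m x ∈ E.lev U m := Iff.rfl

theorem smooth_mem_lev {U : Set (E.L 0)} {e : E.Smooth} {m : ℕ} : e.1 m ∈ E.lev U m ↔ e.1 0 ∈ U := by
  simp

theorem Smooth.ext_zero {x y : E.Smooth} (h : x.1 0 = y.1 0) : x = y := by
  ext m
  apply down_injective m
  simpa using h

theorem shift_down (m : ℕ) (x : E.L (m + 1)) : E.incl 0 (E.shift.down m x) = E.down (m + 1) x := by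
  induction m with
  | zero => rfl
  | succ m ih => exact ih (E.incl (m + 1) x)

theorem prod_down (F : ScSpace.{u}) (m : ℕ) (p : E.L m × F.L m) :
    (E.prod F).down m p = (E.down m p.1, F.down m p.2) := by
  induction m with
  | zero => rfl
  | succ m ih => exact ih ((E.incl m p.1, F.incl m p.2))

theorem addFin_down (n : ℕ) (m : ℕ) (p : EuclideanSpace ℝ (Fin n) × E.L m) :
    (E.addFin n).down m p = (p.1, E.down m p.2) := by
  induction m with
  | zero => rfl
  | succ m ih => exact ih ((p.1, E.incl m p.2))

theorem mem_lev_tangent {U : Set (E.L 0)} {m : ℕ} {p : E.L (m + 1) × E.L m} :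
    p ∈ E.tangent.lev (scTangentDom U) m ↔ p.1 ∈ E.lev U (m + 1) := by
  show E.tangent.down m p ∈ scTangentDom U ↔ _
  rw [prod_down]
  show E.incl 0 (E.shift.down m p.1) ∈ U ↔ _
  rw [shift_down]; rfl

theorem mem_lev_prod {F : ScSpace.{u}} {U : Set (E.L 0)} {U' : Set (F.L 0)} {m : ℕ}
    {p : E.L m × F.L m} :
    p ∈ (E.prod F).lev (U ×ˢ U') m ↔ p.1 ∈ E.lev U m ∧ p.2 ∈ F.lev U' m := by
  show (E.prod F).down m p ∈ U ×ˢ U' ↔ _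
  rw [prod_down]; rfl

/-- A point of level `0` that lies in all levels is a smooth point. -/
theorem exists_smooth (x : E.L 0) (h : ∀ m, x ∈ range (E.down m)) : ∃ e : E.Smooth, e.1 0 = x := by
  choose y hy using h
  refine ⟨⟨y, fun j => ?_⟩, hy 0⟩
  apply down_injective j
  rw [← down_succ, hy, hy]

theorem dense_smooth (m : ℕ) (x : E.L m) {ε : ℝ} (hε : 0 < ε) : ∃ e : E.Smooth, ‖e.1 m - x‖ < ε := by
  obtain ⟨y, h, ⟨e, rfl⟩⟩ := Metric.dense_iff.1 (E.dense m) x ε hε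
  exact ⟨e, by simpa [dist_eq_norm] using h⟩

theorem isCompact_incl (E : ScSpace.{u}) (m : ℕ) (r : ℝ) :
    ∃ K, IsCompact K ∧ ∀ x : E.L (m + 1), ‖x‖ ≤ r → E.incl m x ∈ K := by
  obtain ⟨K, hK, h⟩ := IsCompactOperator.image_closedBall_subset_compact
    (f := (E.incl m : E.L (m + 1) →ₗ[ℝ] E.L m)) (E.incl_compact m) r
  exact ⟨K, hK, fun x hx => h ⟨x, by simpa using hx, rfl⟩⟩

end ScSpace

open ScSpace

/-- Two continuous linear maps on a level which agree at the smooth points are equal. -/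
theorem clm_ext_smooth {E : ScSpace.{u}} {m : ℕ} {Y : Type*} [NormedAddCommGroup Y] [NormedSpace ℝ Y]
    {A B : E.L m →L[ℝ] Y} (h : ∀ X : E.Smooth, A (X.1 m) = B (X.1 m)) : A = B := by
  have : (A : E.L m → Y) = B := (E.dense m).equalizer A.continuous B.continuous (funext h)
  exact DFunLike.coe_injective this

theorem clm_bound_smooth {E : ScSpace.{u}} {m : ℕ} {Y : Type*} [NormedAddCommGroup Y]
    [NormedSpace ℝ Y] {A : E.L m →L[ℝ] Y} {C : ℝ} (h : ∀ X : E.Smooth, ‖A (X.1 m)‖ ≤ C * ‖X.1 m‖)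
    (x : E.L m) : ‖A x‖ ≤ C * ‖x‖ := by
  have hc : IsClosed {x : E.L m | ‖A x‖ ≤ C * ‖x‖} := isClosed_le (by fun_prop) (by fun_prop)
  exact (E.dense m).induction_on x hc h

namespace ScOp

variable {E F G : ScSpace.{u}}

/-- The value of a sc-operator at a smooth point. -/
def app (T : ScOp E F) (X : E.Smooth) : F.Smooth :=
  ⟨fun m => T.map m (X.1 m), fun m => by rw [T.comm, X.2]⟩

@[simp] theorem app_val (T : ScOp E F) (X : E.Smooth) (m : ℕ) : (T.app X).1 m = T.map m (X.1 m) := rfl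

@[ext] theorem ext' {T S : ScOp E F} (h : ∀ m x, T.map m x = S.map m x) : T = S := by
  cases T; cases S; congr; ext m x; exact h m x

theorem down_map (T : ScOp E F) (m : ℕ) (x : E.L m) : F.down m (T.map m x) = T.map 0 (E.down m x) := by
  induction m with
  | zero => rfl
  | succ m ih => rw [down_succ, T.comm, ih, down_succ]

theorem ext_smooth {T S : ScOp E F} (h : ∀ X : E.Smooth, T.map 0 (X.1 0) = S.map 0 (X.1 0)) :
    T = S := by
  ext m x
  have : T.map m = S.map m := clm_ext_smooth fun X => by
    apply down_injective m
    simpa [down_map] using h X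
  rw [this]

theorem ext_level {T S : ScOp E F} (n : ℕ) (h : ∀ X : E.Smooth, T.map n (X.1 n) = S.map n (X.1 n)) :
    T = S := by
  refine ext_smooth fun X => ?_
  have := congrArg (F.down n) (h X)
  simpa [down_map] using this

/-- Composition of sc-operators. -/
def comp (T : ScOp F G) (S : ScOp E F) : ScOp E G where
  map m := (T.map m).comp (S.map m)
  comm m x := by simp [T.comm, S.comm]

@[simp] theorem comp_map (T : ScOp F G) (S : ScOp E F) (m : ℕ) (x : E.L m) :
    (T.comp S).map m x = T.map m (S.map m x) := rfl

end ScOp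

/-! ### Maps that are `sc¹` along curves -/

/-- `f` is sc-continuous on `U` together with the tangent map given by `D`, and it maps curves of smooth
points in `U` that are differentiable on all levels to such curves, with derivative given by `D`. This
notion is implied by `sc¹` and closed under composition. -/
structure Sc1 {E F : ScSpace.{u}} (U : Set (E.L 0)) (f : ScFam E F)
    (D : ∀ m, E.L (m + 1) → (E.L m →L[ℝ] F.L m)) : Prop where
  cont : IsScContinuous U f
  tcont : IsScContinuous (scTangentDom U) (scTangentMap f D)
  curve : ∀ (γ : ℝ → E.Smooth) (X : E.Smooth) (S : Set ℝ) (s : ℝ), s ∈ S →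
    (∀ r ∈ S, (γ r).1 0 ∈ U) → (∀ m, HasDerivWithinAt (fun r => (γ r).1 m) (X.1 m) S s) →
    ∀ m, HasDerivWithinAt (fun r => f m ((γ r).1 m)) (D m ((γ s).1 (m + 1)) (X.1 m)) S s

section

variable {E F G H : ScSpace.{u}} {U : Set (E.L 0)}

theorem IsScContinuous.down {f : ScFam E F} (hf : IsScContinuous U f) {m : ℕ} {x : E.L m}
    (hx : x ∈ E.lev U m) : F.down m (f m x) = f 0 (E.down m x) := by
  induction m with
  | zero => rfl
  | succ m ih =>
    rw [down_succ, hf.2 m x hx, down_succ]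
    exact ih hx

theorem IsScContinuous.mapsTo {f : ScFam E F} (hf : IsScContinuous U f) {V : Set (F.L 0)}
    (h : MapsTo (f 0) U V) (m : ℕ) : MapsTo (f m) (E.lev U m) (F.lev V m) := by
  intro x hx
  rw [mem_lev, hf.down hx]
  exact h hx

theorem IsScContinuous.eq_of_eq_zero {f g : ScFam E F} (hf : IsScContinuous U f)
    (hg : IsScContinuous U g) (h : ∀ x ∈ U, f 0 x = g 0 x) {m : ℕ} {x : E.L m} (hx : x ∈ E.lev U m) :
    f m x = g m x := by
  apply down_injective m
  rw [hf.down hx, hg.down hx, h _ hx]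

open Classical in
/-- The image of a smooth point under a sc-continuous map (and `0` outside the domain). -/
noncomputable def IsScContinuous.app {f : ScFam E F} (hf : IsScContinuous U f) (e : E.Smooth) : F.Smooth :=
  if h : e.1 0 ∈ U then ⟨fun m => f m (e.1 m), fun m => by
    rw [hf.2 m _ (smooth_mem_lev.2 h), e.2]⟩ else 0

theorem IsScContinuous.app_val {f : ScFam E F} (hf : IsScContinuous U f) {e : E.Smooth}
    (he : e.1 0 ∈ U) (m : ℕ) : (hf.app e).1 m = f m (e.1 m) := by
  rw [IsScContinuous.app, dif_pos he]

theorem IsScContinuous.comp {f : ScFam E F} {V : Set (F.L 0)} {g : ScFam F G}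
    (hg : IsScContinuous V g) (hf : IsScContinuous U f) (h : MapsTo (f 0) U V) :
    IsScContinuous U (fun m x => g m (f m x)) := by
  refine ⟨fun m => (hg.1 m).comp (hf.1 m) (hf.mapsTo h m), fun m x hx => ?_⟩
  rw [hg.2 m _ (hf.mapsTo h (m + 1) hx), hf.2 m x hx]

theorem IsScContinuous.mono {f : ScFam E F} (hf : IsScContinuous U f) {V : Set (E.L 0)} (h : V ⊆ U) :
    IsScContinuous V f :=
  ⟨fun m => (hf.1 m).mono (preimage_mono h), fun m x hx => hf.2 m x (h hx)⟩

namespace Sc1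

variable {f : ScFam E F} {D : ∀ m, E.L (m + 1) → (E.L m →L[ℝ] F.L m)}

/-- The differential at a smooth point is a sc-operator. -/
theorem comm (hf : Sc1 U f D) {m : ℕ} {x : E.L (m + 2)} (hx : x ∈ E.lev U (m + 2)) (X : E.L (m + 1)) :
    F.incl m (D (m + 1) x X) = D m (E.incl (m + 1) x) (E.incl m X) :=
  congrArg Prod.snd (hf.tcont.2 m (x, X) (mem_lev_tangent.2 hx))

/-- The differential at a smooth point, as a sc-operator. -/
def op (hf : Sc1 U f D) (e : E.Smooth) (he : e.1 0 ∈ U) : ScOp E F where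
  map m := D m (e.1 (m + 1))
  comm m x := by rw [hf.comm (smooth_mem_lev.2 he), e.2]

/-- The differential is strongly continuous. -/
theorem tendsto (hf : Sc1 U f D) (m : ℕ) :
    ContinuousOn (fun p : E.L (m + 1) × E.L m => D m p.1 p.2) (E.lev U (m + 1) ×ˢ univ) := by
  have := hf.tcont.1 m
  refine (continuous_snd.comp_continuousOn this).mono ?_
  rintro p ⟨hp, -⟩
  exact mem_lev_tangent.2 hp

theorem mono (hf : Sc1 U f D) {V : Set (E.L 0)} (h : V ⊆ U) : Sc1 V f D :=
  ⟨hf.cont.mono h, hf.tcont.mono (preimage_mono h), fun γ X S s hs hγ hd =>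
    hf.curve γ X S s hs (fun r hr => h (hγ r hr)) hd⟩

theorem comp {V : Set (F.L 0)} {g : ScFam F G} {D' : ∀ m, F.L (m + 1) → (F.L m →L[ℝ] G.L m)}
    (hg : Sc1 V g D') (hf : Sc1 U f D) (h : MapsTo (f 0) U V) :
    Sc1 U (fun m x => g m (f m x)) (fun m x => (D' m (f (m + 1) x)).comp (D m x)) := by
  refine ⟨hg.cont.comp hf.cont h, hg.tcont.comp hf.tcont ?_, ?_⟩
  · rintro ⟨x, X⟩ hx
    have := hf.cont.mapsTo h 1 (mem_lev_tangent (m := 0).1 hx)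
    exact this
  · intro γ X S s hs hγ hd m
    have h1 := hf.curve γ X S s hs hγ hd
    -- The image of a curve of smooth points is again such a curve, and its velocity is smooth
    -- because the differential at a smooth point is a sc-operator; so the curve property of `g`
    -- applies to it.
    have h2 := hg.curve (fun r => hf.cont.app (γ r)) ((hf.op (γ s) (hγ s hs)).app X) S s hs
      (fun r hr => by
        rw [hf.cont.app_val (hγ r hr)]; exact h (hγ r hr))
      (fun m => (h1 m).congr (fun r hr => hf.cont.app_val (hγ r hr) m)
        (hf.cont.app_val (hγ s hs) m)) m
    rw [hf.cont.app_val (hγ s hs)] at h2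
    exact h2.congr (fun r hr => by rw [hf.cont.app_val (hγ r hr)]) (by rw [hf.cont.app_val (hγ s hs)])

theorem prodMk (hf : Sc1 U f D) {g : ScFam E G} {D' : ∀ m, E.L (m + 1) → (E.L m →L[ℝ] G.L m)}
    (hg : Sc1 U g D') :
    Sc1 (F := F.prod G) U (fun m x => (f m x, g m x)) (fun m x => (D m x).prod (D' m x)) := by
  refine ⟨⟨fun m => (hf.cont.1 m).prodMk (hg.cont.1 m), fun m x hx =>
    Prod.ext (hf.cont.2 m x hx) (hg.cont.2 m x hx)⟩, ⟨fun m => ?_, ?_⟩, ?_⟩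
  · have h1 := hf.tcont.1 m
    have h2 := hg.tcont.1 m
    exact ((continuous_fst.comp_continuousOn h1).prodMk (continuous_fst.comp_continuousOn h2)).prodMk
      ((continuous_snd.comp_continuousOn h1).prodMk (continuous_snd.comp_continuousOn h2))
  · intro m x hx
    have h1 := hf.tcont.2 m x hx
    have h2 := hg.tcont.2 m x hx
    have e1 := congrArg Prod.fst h1
    have e2 := congrArg Prod.fst h2
    have e3 := congrArg Prod.snd h1
    have e4 := congrArg Prod.snd h2
    exact Prod.ext (Prod.ext e1 e2) (Prod.ext e3 e4)
  · intro γ X S s hs hγ hd m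
    exact (hf.curve γ X S s hs hγ hd m).prodMk (hg.curve γ X S s hs hγ hd m)

/-- Sc-operators are `sc¹`. -/
theorem ofOp (T : ScOp E F) (U : Set (E.L 0)) :
    Sc1 U (fun m => T.map m) (fun m _ => T.map m) := by
  refine ⟨⟨fun m => (T.map m).continuous.continuousOn, fun m x _ => T.comm m x⟩,
    ⟨fun m => ?_, fun m x _ => Prod.ext (T.comm _ _) (T.comm _ _)⟩, ?_⟩
  · exact (((T.map (m + 1)).continuous.comp continuous_fst).prodMk
      ((T.map m).continuous.comp continuous_snd)).continuousOn
  · intro γ X S s _ _ hd m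
    exact (T.map m).hasFDerivAt.comp_hasDerivWithinAt s (hd m)

/-- Constant maps with smooth value are `sc¹`. -/
theorem const (h : F.Smooth) (U : Set (E.L 0)) : Sc1 U (fun m _ => h.1 m) (fun _ _ => 0) := by
  refine ⟨⟨fun m => continuousOn_const, fun m x _ => h.2 m⟩,
    ⟨fun m => continuousOn_const (c := ((h.1 (m + 1), 0) : F.L (m + 1) × F.L m)),
      fun m x _ => Prod.ext (h.2 _) (map_zero (F.incl m))⟩, ?_⟩
  intro γ X S s _ _ hd m
  exact hasDerivWithinAt_const _ _ _

theorem sub (hf : Sc1 U f D) {g : ScFam E F} {D' : ∀ m, E.L (m + 1) → (E.L m →L[ℝ] F.L m)}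
    (hg : Sc1 U g D') : Sc1 U (fun m x => f m x - g m x) (fun m x => D m x - D' m x) := by
  refine ⟨⟨fun m => (hf.cont.1 m).sub (hg.cont.1 m), fun m x hx => by
    rw [map_sub, hf.cont.2 m x hx, hg.cont.2 m x hx]⟩, ⟨fun m => ?_, fun m x hx => ?_⟩, ?_⟩
  · exact (hf.tcont.1 m).sub (hg.tcont.1 m)
  · have h1 := hf.tcont.2 m x hx
    have h2 := hg.tcont.2 m x hx
    have : F.tangent.incl m (scTangentMap f D (m + 1) x - scTangentMap g D' (m + 1) x) =
      scTangentMap f D m (E.tangent.incl m x) - scTangentMap g D' m (E.tangent.incl m x) := by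
      rw [map_sub, h1, h2]
    exact this
  · intro γ X S s hs hγ hd m
    exact (hf.curve γ X S s hs hγ hd m).sub (hg.curve γ X S s hs hγ hd m)

theorem add (hf : Sc1 U f D) {g : ScFam E F} {D' : ∀ m, E.L (m + 1) → (E.L m →L[ℝ] F.L m)}
    (hg : Sc1 U g D') : Sc1 U (fun m x => f m x + g m x) (fun m x => D m x + D' m x) := by
  refine ⟨⟨fun m => (hf.cont.1 m).add (hg.cont.1 m), fun m x hx => by
    rw [map_add, hf.cont.2 m x hx, hg.cont.2 m x hx]⟩, ⟨fun m => ?_, fun m x hx => ?_⟩, ?_⟩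
  · exact (hf.tcont.1 m).add (hg.tcont.1 m)
  · have h1 := hf.tcont.2 m x hx
    have h2 := hg.tcont.2 m x hx
    have : F.tangent.incl m (scTangentMap f D (m + 1) x + scTangentMap g D' (m + 1) x) =
      scTangentMap f D m (E.tangent.incl m x) + scTangentMap g D' m (E.tangent.incl m x) := by
      rw [map_add, h1, h2]
    exact this
  · intro γ X S s hs hγ hd m
    exact (hf.curve γ X S s hs hγ hd m).add (hg.curve γ X S s hs hγ hd m)

end Sc1

/-- A sc-smooth map is `sc¹` along curves, with the sc-differential. -/
theorem IsScSmooth.exists_sc1 {f : ScFam E F} (hf : IsScSmooth U f) :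
    ∃ D, Sc1 U f D ∧ ∀ m, ∀ x ∈ E.lev U (m + 1),
        HasFDerivWithinAt (fun y => F.incl m (f (m + 1) y)) ((D m x).comp (E.incl m))
          (E.lev U (m + 1)) x := by
  obtain ⟨h0, D, hD, h1⟩ := hf 1
  refine ⟨D, ⟨h0, h1, ?_⟩, hD⟩
  intro γ X S s hs hγ hd m
  -- Differentiating `f` costs a level, but `γ` is differentiable on level `m + 1` as well; along
  -- curves of smooth points nothing is lost.
  have := (hD m _ (smooth_mem_lev.2 (hγ s hs))).comp_hasDerivWithinAt s (hd (m + 1))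
    (fun r hr => smooth_mem_lev.2 (hγ r hr))
  simp only [Function.comp_def, ContinuousLinearMap.comp_apply, X.2] at this
  refine this.congr (fun r hr => ?_) ?_
  · rw [h0.2 m _ (smooth_mem_lev.2 (hγ r hr)), (γ r).2]
  · rw [h0.2 m _ (smooth_mem_lev.2 (hγ s hs)), (γ s).2]

end

/-! ### Directions, and uniqueness of differentials -/

section Directions

variable {E F G H : ScSpace.{u}} {U : Set (E.L 0)}

/-- Starting from `e`, the direction `X` stays in `U` for a short time. -/
def IsDir (U : Set (E.L 0)) (e X : E.Smooth) : Prop :=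
  ∀ᶠ t in 𝓝[>] (0 : ℝ), (e + t • X).1 0 ∈ U

/-- `ν` points strictly into `U` at `e`: so does every small perturbation by a smooth vector. -/
def Inward (U : Set (E.L 0)) (e ν : E.Smooth) : Prop :=
  ∀ Y : E.Smooth, ∃ s : ℝ, 0 < s ∧ IsDir U e (ν + s • Y)

/-- At every smooth point of `U` there is a vector pointing strictly into `U`. -/
def Fat (U : Set (E.L 0)) : Prop := ∀ e : E.Smooth, e.1 0 ∈ U → ∃ ν, Inward U e ν

theorem Inward.isDir {e ν : E.Smooth} (h : Inward U e ν) : IsDir U e ν := by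
  obtain ⟨s, -, hs⟩ := h 0
  simpa using hs

/-- Every smooth `X` is a combination of two directions that stay in `U`, namely `ν` and `ν + s • X`
for some `s > 0`, and smooth vectors are dense in the level. -/
theorem Inward.clm_ext {e ν : E.Smooth} (h : Inward U e ν) {m : ℕ} {Y : Type*}
    [NormedAddCommGroup Y] [NormedSpace ℝ Y] {A B : E.L m →L[ℝ] Y}
    (hAB : ∀ X : E.Smooth, IsDir U e X → A (X.1 m) = B (X.1 m)) : A = B := by
  refine clm_ext_smooth fun X => ?_
  obtain ⟨s, hs, hX⟩ := h X
  have h1 := hAB _ hX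
  have h2 := hAB _ h.isDir
  simp only [Smooth.add_val, Smooth.smul_val, map_add, map_smul, h2, add_right_inj] at h1
  exact smul_right_injective _ hs.ne' h1

/-- A scaling argument for functions that are only homogeneous, such as a level norm on the space of
smooth points. The factor `2` arises because vectors are rescaled to `n x = δ / 2`, strictly inside
the region where the bound is known. -/
theorem bound_of_homogeneous {A : Type*} [AddCommGroup A] [Module ℝ A] {n N : A → ℝ} {δ K : ℝ}
    (hδ : 0 < δ) (hn : ∀ (c : ℝ) x, n (c • x) = |c| * n x) (hN : ∀ (c : ℝ) x, N (c • x) = |c| * N x)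
    (hn0 : ∀ x, 0 ≤ n x) (h : ∀ x, n x < δ → N x ≤ K) (x : A) : N x ≤ 2 / δ * K * n x := by
  by_contra! hlt
  have hK : 0 ≤ K := by
    have h0 := h (0 : A) (by have := hn 0 (0 : A); simp at this; rwa [this])
    have h1 := hN 0 (0 : A)
    simp at h1
    linarith
  rcases (hn0 x).eq_or_lt with h0 | h0
  -- If `n x = 0`, all multiples of `x` satisfy the hypothesis, so a positive `N x` could be scaled
  -- beyond `K`.
  · rw [← h0, mul_zero] at hlt
    have := h (((K + 1) / N x) • x) (by rw [hn, ← h0, mul_zero]; exact hδ)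
    rw [hN, abs_of_pos (by positivity), div_mul_cancel₀ _ hlt.ne'] at this
    linarith
  · have hc : 0 < δ / 2 / n x := by positivity
    have := h ((δ / 2 / n x) • x) (by
      rw [hn, abs_of_pos hc, div_mul_cancel₀ _ h0.ne']; linarith)
    rw [hN, abs_of_pos hc] at this
    have h2 := mul_lt_mul_of_pos_left hlt hc
    have h3 : δ / 2 / n x * (2 / δ * K * n x) = K := by field_simp
    linarith

theorem Sc1.hasDerivWithinAt_dir {f : ScFam E F} {D} (hf : Sc1 U f D) {e X : E.Smooth}
    (he : e.1 0 ∈ U) (hX : IsDir U e X) (m : ℕ) :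
    HasDerivWithinAt (fun t : ℝ => f m ((e + t • X).1 m)) (D m (e.1 (m + 1)) (X.1 m)) (Ici 0) 0 := by
  -- The curve property requires a time set on which the ray stays in `U`; since `X` is a direction,
  -- this one is a neighbourhood of `0` within `[0, ∞)`.
  set S : Set ℝ := {t | 0 ≤ t ∧ (e + t • X).1 0 ∈ U} with hS
  have h0 : (0 : ℝ) ∈ S := ⟨le_rfl, by simpa using he⟩
  have h := hf.curve (fun t => e + t • X) X S 0 h0 (fun r hr => hr.2) (fun m => by
    have : HasDerivAt (fun t : ℝ => e.1 m + t • X.1 m) ((1 : ℝ) • X.1 m) 0 :=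
      ((hasDerivAt_id (0 : ℝ)).smul_const (X.1 m)).const_add _
    rw [one_smul] at this
    exact this.hasDerivWithinAt) m
  simp only [zero_smul, add_zero] at h
  refine h.mono_of_mem_nhdsWithin ?_
  rw [← Ioi_insert, nhdsWithin_insert, Filter.mem_sup]
  refine ⟨Filter.mem_pure.2 h0, ?_⟩
  filter_upwards [hX, self_mem_nhdsWithin] with t ht ht'
  exact ⟨le_of_lt ht', ht⟩

theorem uniq_Ici {Y : Type*} [NormedAddCommGroup Y] [NormedSpace ℝ Y] {f g : ℝ → Y} {a b : Y}
    (hf : HasDerivWithinAt f a (Ici 0) 0) (hg : HasDerivWithinAt g b (Ici 0) 0)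
    (h : ∀ᶠ t in 𝓝[>] (0 : ℝ), f t = g t) (h0 : f 0 = g 0) : a = b := by
  refine (uniqueDiffWithinAt_Ici (0 : ℝ)).eq_deriv _ hf (hg.congr_of_eventuallyEq ?_ h0)
  rw [← Ioi_insert, nhdsWithin_insert]
  exact Filter.eventually_sup.2 ⟨Filter.eventually_pure.2 h0, h⟩

/-- Uniqueness of the differential. -/
theorem Sc1.unique {f g : ScFam E F} {D D'} (hf : Sc1 U f D) (hg : Sc1 U g D')
    (h : ∀ x ∈ U, f 0 x = g 0 x) (hU : Fat U) {e : E.Smooth} (he : e.1 0 ∈ U) (m : ℕ) :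
    D m (e.1 (m + 1)) = D' m (e.1 (m + 1)) := by
  obtain ⟨ν, hν⟩ := hU e he
  refine hν.clm_ext fun X hX => ?_
  refine uniq_Ici (hf.hasDerivWithinAt_dir he hX m) (hg.hasDerivWithinAt_dir he hX m) ?_ ?_
  · filter_upwards [hX] with t ht
    exact hf.cont.eq_of_eq_zero hg.cont h (smooth_mem_lev.2 ht)
  · exact hf.cont.eq_of_eq_zero hg.cont h (smooth_mem_lev.2 (by simpa using he))

/-- Both operators compute the derivative along the rays that stay in `U`, and these determine a
bounded operator by `Inward.clm_ext`. Differentials given merely by their existence can thus be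
replaced by chosen ones. -/
theorem HasScDeriv.eq {f : ScFam E F} {D} (hf : Sc1 U f D) (hU : Fat U) {e : E.Smooth}
    (he : e.1 0 ∈ U) {T : ScOp E F} (hT : HasScDeriv f U e T) (m : ℕ) :
    T.map m = D m (e.1 (m + 1)) := by
  obtain ⟨ν, hν⟩ := hU e he
  refine hν.clm_ext fun X hX => ?_
  refine uniq_Ici (f := fun t => f m ((e + t • X).1 m)) ?_ (hf.hasDerivWithinAt_dir he hX m)
    (Filter.Eventually.of_forall fun _ => rfl) rfl
  set S : Set ℝ := {t | 0 ≤ t ∧ (e + t • X).1 0 ∈ U} with hS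
  have h0 : (0 : ℝ) ∈ S := ⟨le_rfl, by simpa using he⟩
  have h1 : HasDerivAt (fun t : ℝ => e.1 (m + 1) + t • X.1 (m + 1)) ((1 : ℝ) • X.1 (m + 1)) 0 :=
      ((hasDerivAt_id (0 : ℝ)).smul_const (X.1 (m + 1))).const_add _
  rw [one_smul] at h1
  have h2 := hT m
  have e0 : e.1 (m + 1) = e.1 (m + 1) + (0 : ℝ) • X.1 (m + 1) := by simp
  rw [e0] at h2
  have h3 := h2.comp_hasDerivWithinAt 0 (h1.hasDerivWithinAt (s := S)) (fun t ht =>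
    smooth_mem_lev (e := e + t • X).2 ht.2)
  simp only [Function.comp_def, ContinuousLinearMap.comp_apply, X.2] at h3
  have h4 : HasDerivWithinAt (fun t : ℝ => f m ((e + t • X).1 m)) (T.map m (X.1 m)) S 0 := by
    refine h3.congr (fun t ht => ?_) ?_
    · have := hf.cont.2 m ((e + t • X).1 (m + 1)) (smooth_mem_lev.2 ht.2)
      rw [(e + t • X).2] at this
      exact this.symm
    · have := hf.cont.2 m ((e + (0 : ℝ) • X).1 (m + 1)) (smooth_mem_lev.2 h0.2)
      rw [(e + (0 : ℝ) • X).2] at this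
      exact this.symm
  refine h4.mono_of_mem_nhdsWithin ?_
  rw [← Ioi_insert, nhdsWithin_insert, Filter.mem_sup]
  refine ⟨Filter.mem_pure.2 h0, ?_⟩
  filter_upwards [hX, self_mem_nhdsWithin] with t ht ht'
  exact ⟨le_of_lt ht', ht⟩

/-- The identity as a sc-operator. -/
def ScOp.id (E : ScSpace.{u}) : ScOp E E where
  map m := ContinuousLinearMap.id ℝ (E.L m)
  comm _ _ := rfl

/-- Multiplication by a scalar as a sc-operator. -/
def ScOp.homothety (E : ScSpace.{u}) (c : ℝ) : ScOp E E where
  map m := c • ContinuousLinearMap.id ℝ (E.L m)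
  comm m x := by simp

/-! ### Maps that are linear in the fibre -/

variable {q : ScFam (E.prod H) F} {Dq : ∀ m, (E.prod H).L (m + 1) → ((E.prod H).L m →L[ℝ] F.L m)}

theorem fibre_isLinear (hq : IsScContinuous (E := E.prod H) (U ×ˢ univ) q)
    (hl : ∀ x ∈ U, IsLinearMap ℝ (fun h : H.L 0 => q 0 (x, h))) {m : ℕ} {x : E.L m}
    (hx : x ∈ E.lev U m) : IsLinearMap ℝ (fun h : H.L m => q m (x, h)) := by
  have key : ∀ h : H.L m, F.down m (q m (x, h)) = q 0 (E.down m x, H.down m h) := fun h => by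
    rw [hq.down (x := (x, h)) (mem_lev_prod.2 ⟨hx, mem_univ _⟩), prod_down]
  have hl' := hl _ hx
  constructor
  · intro a b
    apply down_injective m
    simp only [map_add, key, hl'.map_add]
  · intro c a
    apply down_injective m
    simp only [map_smul, key, hl'.map_smul]

/-- The operator on the fibre over a smooth point. -/
def fibreOp (hq : IsScContinuous (E := E.prod H) (U ×ˢ univ) q)
    (hl : ∀ x ∈ U, IsLinearMap ℝ (fun h : H.L 0 => q 0 (x, h))) (e : E.Smooth) (he : e.1 0 ∈ U) :
    ScOp H F where
  map m :=
    { toLinearMap := (fibre_isLinear hq hl (m := m) (x := e.1 m) (smooth_mem_lev.2 he)).mk'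
      cont := by
        have h := hq.1 m
        rw [← continuousOn_univ]
        exact h.comp (f := fun h : H.L m => (e.1 m, h)) (by fun_prop) fun h _ =>
          mem_lev_prod.2 ⟨smooth_mem_lev.2 he, mem_univ _⟩ }
  comm m h := by
    have := hq.2 m (e.1 (m + 1), h) (mem_lev_prod.2 ⟨smooth_mem_lev.2 he, mem_univ _⟩)
    refine this.trans ?_
    show q m (E.incl m (e.1 (m + 1)), _) = _
    rw [e.2]; rfl

@[simp] theorem fibreOp_map (hq : IsScContinuous (E := E.prod H) (U ×ˢ univ) q)
    (hl : ∀ x ∈ U, IsLinearMap ℝ (fun h : H.L 0 => q 0 (x, h))) (e : E.Smooth) (he : e.1 0 ∈ U)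
    (m : ℕ) (h : H.L m) : (fibreOp hq hl e he).map m h = q m (e.1 m, h) := rfl

theorem Sc1.pair {f : ScFam G E} {Df} {V : Set (G.L 0)} (hf : Sc1 V f Df) (hm : MapsTo (f 0) V U)
    {s : ScFam G H} {Ds} (hs : Sc1 V s Ds) (hq : Sc1 (E := E.prod H) (U ×ˢ univ) q Dq) :
    Sc1 V (fun m x => q m (f m x, s m x))
      (fun m x => (Dq m (f (m + 1) x, s (m + 1) x)).comp ((Df m x).prod (Ds m x))) :=
  hq.comp (hf.prodMk hs) fun _ hx => ⟨hm hx, mem_univ _⟩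

theorem Sc1.slice (hq : Sc1 (E := E.prod H) (U ×ˢ univ) q Dq) (h : H.Smooth) :
    Sc1 U (fun m x => q m (x, h.1 m))
      (fun m x => (Dq m (x, h.1 (m + 1))).comp ((ContinuousLinearMap.id ℝ _).prod 0)) :=
  (Sc1.ofOp (ScOp.id E) U).pair (fun _ hx => hx) (Sc1.const h U) hq

/-- Since `q` vanishes on the zero section, its derivative in the base vanishes there; in the fibre
`q` is linear and is its own derivative. This is why bundle maps act on linearizations at zeros
through the fibre operator alone. -/
theorem Sc1.fibre_zero (hq : Sc1 (E := E.prod H) (U ×ˢ univ) q Dq)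
    (hl : ∀ x ∈ U, IsLinearMap ℝ (fun h : H.L 0 => q 0 (x, h))) (hU : Fat U) {e : E.Smooth}
    (he : e.1 0 ∈ U) (m : ℕ) (X : E.L m) (Y : H.L m) :
    Dq m (e.1 (m + 1), 0) (X, Y) = q m (e.1 m, Y) := by
  have h1 : Dq m (e.1 (m + 1), 0) (X, 0) = 0 := by
    have := (hq.slice 0).unique (Sc1.const (0 : F.Smooth) U)
      (fun x hx => (hl x hx).map_zero) hU he m
    exact congrArg (fun A => A X) this
  have h2 : ((Dq m (e.1 (m + 1), 0)).comp (ContinuousLinearMap.inr ℝ (E.L m) (H.L m))) =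
      (fibreOp hq.cont hl e he).map m := by
    refine clm_ext_smooth fun Y => ?_
    have h3 := hq.curve (fun t => ⟨fun j => (e.1 j, t • Y.1 j), fun j =>
        Prod.ext (e.2 j) ((t • Y).2 j)⟩) (⟨fun j => (0, Y.1 j), fun j => Prod.ext (map_zero (E.incl j))
        (Y.2 j)⟩) univ 0 (mem_univ _) (fun r _ => ⟨he, mem_univ _⟩) (fun j => by
          have : HasDerivAt (fun t : ℝ => t • Y.1 j) ((1 : ℝ) • Y.1 j) 0 :=
            (hasDerivAt_id (0 : ℝ)).smul_const (Y.1 j)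
          rw [one_smul] at this
          exact ((hasDerivAt_const (0 : ℝ) (e.1 j)).prodMk this).hasDerivWithinAt) m
    rw [hasDerivWithinAt_univ] at h3
    have h4 : HasDerivAt (fun t : ℝ => t • q m (e.1 m, Y.1 m)) ((1 : ℝ) • q m (e.1 m, Y.1 m)) 0 :=
            (hasDerivAt_id (0 : ℝ)).smul_const _
    have h5 : (fun t : ℝ => q m (e.1 m, t • Y.1 m)) = (fun t : ℝ => t • q m (e.1 m, Y.1 m)) := by
      ext t
      exact (fibre_isLinear hq.cont hl (m := m) (smooth_mem_lev.2 he)).map_smul t _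
    simp only [zero_smul] at h3
    rw [h5] at h3
    have := h3.unique h4
    rw [one_smul] at this
    exact this
  have h3 := congrArg (fun A => A Y) h2
  have : ((X, Y) : E.L m × H.L m) = (X, 0) + (0, Y) := by simp
  rw [this]
  have h6 := map_add (Dq m (e.1 (m + 1), 0)) (X, 0) (0, Y)
  rw [h1, zero_add] at h6
  exact h6.trans h3

/-- Uniqueness of the differential, applied to the two sides of `q (x, c • h) = c • q (x, h)`. -/
theorem Sc1.fibre_smul (hq : Sc1 (E := E.prod H) (U ×ˢ univ) q Dq)
    (hl : ∀ x ∈ U, IsLinearMap ℝ (fun h : H.L 0 => q 0 (x, h))) (hU : Fat U) {e : E.Smooth}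
    (he : e.1 0 ∈ U) (m : ℕ) (c : ℝ) (h : H.Smooth) (X : E.L m) :
    Dq m (e.1 (m + 1), c • h.1 (m + 1)) (X, 0) = c • Dq m (e.1 (m + 1), h.1 (m + 1)) (X, 0) := by
  have := (hq.slice (c • h)).unique ((Sc1.ofOp (ScOp.homothety F c) univ).comp (hq.slice h)
    (fun _ _ => mem_univ _)) (fun x hx => (hl x hx).map_smul c _) hU he m
  exact congrArg (fun A => A X) this

/-- A locally uniform bound for the base part of the differential of a fibrewise linear map. -/
theorem Sc1.fibre_bound (hq : Sc1 (E := E.prod H) (U ×ˢ univ) q Dq)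
    (hl : ∀ x ∈ U, IsLinearMap ℝ (fun h : H.L 0 => q 0 (x, h))) (hU : Fat U) {e₀ : E.Smooth}
    (he₀ : e₀.1 0 ∈ U) (m : ℕ) : ∃ C δ : ℝ, 0 < C ∧ 0 < δ ∧ ∀ e h : _, ∀ _ : (e : E.Smooth).1 0 ∈ U,
      ‖e.1 (m + 1) - e₀.1 (m + 1)‖ < δ → ∀ X : E.L m,
      ‖Dq m (e.1 (m + 1), (h : H.Smooth).1 (m + 1)) (X, 0)‖ ≤ C * ‖h.1 (m + 1)‖ * ‖X‖ := by
  have hc : ContinuousOn (fun p : (E.L (m + 1) × H.L (m + 1)) × E.L m => Dq m p.1 (p.2, 0))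
      ((E.lev U (m + 1) ×ˢ univ) ×ˢ univ) := by
    refine (hq.tendsto m).comp (f := fun p : (E.L (m + 1) × H.L (m + 1)) × E.L m =>
      ((p.1, (p.2, 0)) : (E.L (m + 1) × H.L (m + 1)) × (E.L m × H.L m))) (by fun_prop) ?_
    rintro ⟨⟨x, h⟩, X⟩ ⟨⟨hx, -⟩, -⟩
    exact ⟨mem_lev_prod.2 ⟨hx, mem_univ _⟩, mem_univ _⟩
  -- Joint continuity at `h = 0`, `X = 0`, where the derivative vanishes, bounds it by `1` on a
  -- product of small balls.
  have h0 := Metric.continuousOn_iff.1 hc ((e₀.1 (m + 1), 0), 0)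
    ⟨⟨smooth_mem_lev.2 he₀, mem_univ _⟩, mem_univ _⟩ 1 one_pos
  obtain ⟨δ, hδ, h0⟩ := h0
  have h1 : ∀ e h : _, ∀ _ : (e : E.Smooth).1 0 ∈ U, ‖e.1 (m + 1) - e₀.1 (m + 1)‖ < δ →
      ‖(h : H.Smooth).1 (m + 1)‖ < δ → ∀ X : E.L m, ‖X‖ < δ →
      ‖Dq m (e.1 (m + 1), h.1 (m + 1)) (X, 0)‖ ≤ 1 := by
    intro e h he hd hh X hX
    have := h0 ((e.1 (m + 1), h.1 (m + 1)), X) ⟨⟨smooth_mem_lev.2 he, mem_univ _⟩, mem_univ _⟩ (by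
      simp only [dist_eq_norm, Prod.norm_def, Prod.fst_sub, Prod.snd_sub, sub_zero]
      simp [hd, hh, hX])
    have h00 : Dq m (e₀.1 (m + 1), 0) (0, 0) = 0 := map_zero (Dq m (e₀.1 (m + 1), 0))
    simp only [h00, dist_zero_right] at this
    exact this.le
  -- One factor `2 / δ` comes from homogeneity in `X`, the other from homogeneity in `h`.
  refine ⟨(2 / δ) * (2 / δ), δ, by positivity, hδ, fun e h he hd X => ?_⟩
  have h2 : ∀ h : H.Smooth, ‖h.1 (m + 1)‖ < δ → ∀ X : E.L m,
      ‖Dq m (e.1 (m + 1), h.1 (m + 1)) (X, 0)‖ ≤ 2 / δ * ‖X‖ := by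
    intro h hh X
    have := bound_of_homogeneous (A := E.L m) (n := fun X => ‖X‖)
      (N := fun X => ‖Dq m (e.1 (m + 1), h.1 (m + 1)) (X, 0)‖) (K := 1) hδ
      (fun c X => norm_smul c X) (fun c X => by
        have : ((c • X, 0) : E.L m × H.L m) = c • (X, 0) := by simp
        rw [this]
        have h5 := map_smul (Dq m (e.1 (m + 1), h.1 (m + 1))) c (X, 0)
        rw [h5, norm_smul]; rfl) (fun X => norm_nonneg X)
      (h1 e h he hd hh) X
    simpa using this
  have := bound_of_homogeneous (A := H.Smooth) (n := fun h => ‖h.1 (m + 1)‖)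
      (N := fun h => ‖Dq m (e.1 (m + 1), h.1 (m + 1)) (X, 0)‖) (K := 2 / δ * ‖X‖) hδ
      (fun c h => norm_smul c _) (fun c h => by
        have h5 := hq.fibre_smul hl hU he m c h X
        show ‖Dq m (e.1 (m + 1), c • h.1 (m + 1)) (X, 0)‖ = _
        rw [h5, norm_smul]; rfl) (fun X => norm_nonneg _)
      (fun h hh => h2 h hh X) h
  calc _ ≤ _ := this
    _ = _ := by ring

end Directions

/-! ### Continuity of differentials in operator norm, and the mean value inequality -/

section StrictDifferentiability

variable {E F : ScSpace.{u}} {U : Set (E.L 0)}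

/-- By compactness of the inclusions, the differential is continuous in the operator norm after
restriction to the next level. -/
theorem Sc1.norm_continuous {f : ScFam E F} {D} (hf : Sc1 U f D) {m : ℕ} {x₀ : E.L (m + 1)}
    (hx₀ : x₀ ∈ E.lev U (m + 1)) {ε : ℝ} (hε : 0 < ε) : ∃ δ > 0, ∀ x ∈ E.lev U (m + 1), ‖x - x₀‖ < δ →
    ∀ X : E.L (m + 1), ‖D m x (E.incl m X) - D m x₀ (E.incl m X)‖ ≤ ε * ‖X‖ := by
  obtain ⟨K, hK, hKX⟩ := E.isCompact_incl m 1
  have hc : Continuous (fun p : E.lev U (m + 1) × E.L m => ‖D m p.1 p.2 - D m x₀ p.2‖) := by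
    have h1 : Continuous (fun p : E.lev U (m + 1) × E.L m => D m p.1 p.2) :=
      (hf.tendsto m).comp_continuous (f := fun p : E.lev U (m + 1) × E.L m => ((p.1 : E.L (m + 1)), p.2))
        (by fun_prop) (fun p => ⟨p.1.2, mem_univ _⟩)
    exact (h1.sub ((D m x₀).continuous.comp continuous_snd)).norm
  -- Strong continuity holds for each `X` separately; it becomes uniform on the compact set `K`,
  -- which contains the image of the unit ball of the next level.
  have h := hK.eventually_forall_of_forall_eventually (x₀ := (⟨x₀, hx₀⟩ : E.lev U (m + 1)))
    (P := fun x X => ‖D m x X - D m x₀ X‖ < ε) (fun y _ => by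
      have := hc.tendsto (⟨x₀, hx₀⟩, y)
      exact this.eventually (gt_mem_nhds (by simpa using hε)))
  obtain ⟨δ, hδ, h⟩ := Metric.eventually_nhds_iff.1 h
  refine ⟨δ, hδ, fun x hx hd X => ?_⟩
  have hx := h (y := ⟨x, hx⟩) (by simpa [Subtype.dist_eq, dist_eq_norm] using hd)
  set A : E.L (m + 1) →L[ℝ] F.L m := (D m x - D m x₀).comp (E.incl m) with hA
  have h2 : ‖A‖ ≤ ε := A.opNorm_le_of_unit_norm hε.le fun X hX => (hx _ (hKX X hX.le)).le
  exact A.le_of_opNorm_le h2 X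

theorem IsRelOpen.ball {E : ScSpace.{u}} {C V : Set (E.L 0)} (hV : IsRelOpen C V) {m : ℕ} {v₀ : E.L m}
    (h₀ : v₀ ∈ E.lev V m) : ∃ δ > 0, ∀ v ∈ E.lev C m, ‖v - v₀‖ < δ → v ∈ E.lev V m := by
  obtain ⟨O, hO, rfl⟩ := hV
  obtain ⟨δ, hδ, h⟩ := Metric.isOpen_iff.1 (hO.preimage (E.down m).continuous) v₀ h₀.2
  exact ⟨δ, hδ, fun v hv hd => ⟨hv, h (by simpa [dist_eq_norm] using hd)⟩⟩

theorem IsRelOpen.subset {A : Type*} [TopologicalSpace A] {C V : Set A} (hV : IsRelOpen C V) : V ⊆ C := by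
  obtain ⟨O, -, rfl⟩ := hV
  exact inter_subset_left

/-- The smooth points of `U` are dense in all levels of `U`. -/
def SmoothDense (U : Set (E.L 0)) : Prop := ∀ ⦃m : ℕ⦄ ⦃v : E.L m⦄, v ∈ E.lev U m →
  ∃ u : ℕ → E.Smooth, (∀ n, (u n).1 0 ∈ U) ∧ Filter.Tendsto (fun n => (u n).1 m) Filter.atTop (𝓝 v)

/-- Mean value inequality along segments of smooth points, extended to a level by density. -/
theorem Sc1.mean_value {C V : Set (E.L 0)} (hC : Convex ℝ C) (hV : IsRelOpen C V)
    (hdense : SmoothDense V) {f : ScFam E F} {D}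
    (hf : Sc1 V f D) {v₀ : E.Smooth} {m : ℕ}
    {A : E.L m →L[ℝ] F.L m} {ε δ : ℝ} {n : E.L (m + 1) → ℝ} (hn : Continuous n)
    (hball : ∀ v ∈ E.lev C (m + 1), ‖v - v₀.1 (m + 1)‖ < δ →
      v ∈ E.lev V (m + 1))
    (hD : ∀ v : E.Smooth, v.1 0 ∈ V → ‖v.1 (m + 1) - v₀.1 (m + 1)‖ < δ →
      ∀ X : E.Smooth, ‖D m (v.1 (m + 1)) (X.1 m) - A (X.1 m)‖ ≤ ε * n (X.1 (m + 1)))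
    {v v' : E.L (m + 1)} (hv : v ∈ E.lev V (m + 1))
    (hv' : v' ∈ E.lev V (m + 1)) (hd : ‖v - v₀.1 (m + 1)‖ < δ)
    (hd' : ‖v' - v₀.1 (m + 1)‖ < δ) :
    ‖f m (E.incl m v) - f m (E.incl m v') - A (E.incl m (v - v'))‖ ≤
      ε * n (v - v') := by
  -- the case of smooth points
  have key : ∀ u u' : E.Smooth, u.1 0 ∈ V → u'.1 0 ∈ V → ‖u.1 (m + 1) - v₀.1 (m + 1)‖ < δ →
      ‖u'.1 (m + 1) - v₀.1 (m + 1)‖ < δ →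
      ‖f m (u.1 m) - f m (u'.1 m) - A (u.1 m - u'.1 m)‖ ≤ ε * n (u.1 (m + 1) - u'.1 (m + 1)) := by
    intro u u' hu hu' hud hud'
    -- A segment between smooth points consists of smooth points; it stays in the ball and in `C` by
    -- convexity, hence in `V`.
    have hseg : ∀ r ∈ Icc (0 : ℝ) 1, (u' + r • (u - u')).1 0 ∈ V ∧
        ‖(u' + r • (u - u')).1 (m + 1) - v₀.1 (m + 1)‖ < δ := by
      intro r hr
      have h1 : ‖(u' + r • (u - u')).1 (m + 1) - v₀.1 (m + 1)‖ < δ := by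
        have := (convex_ball (v₀.1 (m + 1)) δ).add_smul_sub_mem
          (x := u'.1 (m + 1)) (y := u.1 (m + 1))
          (by simpa [dist_eq_norm] using hud') (by simpa [dist_eq_norm] using hud) hr
        simpa [dist_eq_norm] using this
      refine ⟨?_, h1⟩
      rw [← smooth_mem_lev (m := m + 1)]
      refine hball _ ?_ h1
      exact smooth_mem_lev.2 (hC.add_smul_sub_mem (hV.subset hu') (hV.subset hu) hr)
    have hder : ∀ r ∈ Icc (0 : ℝ) 1, HasDerivWithinAt
        (fun r : ℝ => f m ((u' + r • (u - u')).1 m) - r • A (u.1 m - u'.1 m))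
        (D m ((u' + r • (u - u')).1 (m + 1)) ((u - u').1 m) - A ((u - u').1 m)) (Icc 0 1) r := by
      intro r hr
      refine (hf.curve (fun r => u' + r • (u - u')) (u - u') (Icc 0 1) r hr
        (fun r hr => (hseg r hr).1) (fun j => ?_) m).sub ?_
      · have : HasDerivAt (fun t : ℝ => u'.1 j + t • (u - u').1 j) ((1 : ℝ) • (u - u').1 j) r :=
          ((hasDerivAt_id r).smul_const ((u - u').1 j)).const_add _
        rw [one_smul] at this
        exact this.hasDerivWithinAt
      · have : HasDerivAt (fun t : ℝ => t • A ((u - u').1 m)) ((1 : ℝ) • A ((u - u').1 m)) r :=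
          (hasDerivAt_id r).smul_const _
        rw [one_smul] at this
        exact this.hasDerivWithinAt
    have h2 := norm_image_sub_le_of_norm_deriv_le_segment_01' hder
      (C := ε * n (u.1 (m + 1) - u'.1 (m + 1))) (fun r hr => by
        have hr' : r ∈ Icc (0 : ℝ) 1 := ⟨hr.1, hr.2.le⟩
        exact hD _ (hseg r hr').1 (hseg r hr').2 (u - u'))
    have e1 : (u' + (1 : ℝ) • (u - u')) = u := by simp
    have e0 : (u' + (0 : ℝ) • (u - u')) = u' := by simp
    rw [e1, e0, one_smul, zero_smul, sub_zero] at h2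
    refine le_trans (le_of_eq ?_) h2
    simp only [map_sub]
    congr 1
    abel
  -- the general case
  obtain ⟨u, hu, hul⟩ := hdense hv
  obtain ⟨u', hu', hul'⟩ := hdense hv'
  have e1 : ∀ᶠ j in Filter.atTop, ‖(u j).1 (m + 1) - v₀.1 (m + 1)‖ < δ :=
    ((hul.sub_const _).norm).eventually (gt_mem_nhds hd)
  have e2 : ∀ᶠ j in Filter.atTop, ‖(u' j).1 (m + 1) - v₀.1 (m + 1)‖ < δ :=
    ((hul'.sub_const _).norm).eventually (gt_mem_nhds hd')
  have hfl : ∀ {v : E.L (m + 1)} {u : ℕ → E.Smooth}, v ∈ E.lev V (m + 1) → (∀ j, (u j).1 0 ∈ V) →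
      Filter.Tendsto (fun j => (u j).1 (m + 1)) Filter.atTop (𝓝 v) →
      Filter.Tendsto (fun j => (u j).1 m) Filter.atTop (𝓝 (E.incl m v)) ∧
      Filter.Tendsto (fun j => f m ((u j).1 m)) Filter.atTop (𝓝 (f m (E.incl m v))) := by
    intro v u hv hu hul
    have h1 : Filter.Tendsto (fun j => (u j).1 m) Filter.atTop (𝓝 (E.incl m v)) := by
      have := ((E.incl m).continuous.tendsto v).comp hul
      refine this.congr fun j => ?_
      exact (u j).2 m
    refine ⟨h1, ?_⟩
    have h2 : ContinuousWithinAt (f m) (E.lev V m) (E.incl m v) := hf.cont.1 m _ (mem_lev_succ.1 hv)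
    exact h2.tendsto.comp (tendsto_nhdsWithin_iff.2
      ⟨h1, Filter.Eventually.of_forall fun j => smooth_mem_lev.2 (hu j)⟩)
  have l1 := hfl hv hu hul
  have l2 := hfl hv' hu' hul'
  refine le_of_tendsto_of_tendsto
    (((l1.2.sub l2.2).sub ((A.continuous.tendsto _).comp (l1.1.sub l2.1))).norm)
    (((hn.tendsto _).comp (hul.sub hul')).const_mul ε) ?_ |>.trans_eq' ?_
  · filter_upwards [e1, e2] with j h1 h2
    exact key _ _ (hu j) (hu' j) h1 h2
  · simp only [map_sub]

end StrictDifferentiability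

/-! ### Standard quadrants, partial quadrants and inward vectors -/

section StdQuadrant

variable {W : ScSpace.{u}} {k d : ℕ} {F : ScSpace.{u}}

/-- The smooth point `(c, w)` of `ℝᵏ ⊕ W`. -/
def mkFin (c : EuclideanSpace ℝ (Fin k)) (w : W.Smooth) : (W.addFin k).Smooth :=
  ⟨fun j => (c, w.1 j), fun j => Prod.ext rfl (w.2 j)⟩

@[simp] theorem mkFin_val (c : EuclideanSpace ℝ (Fin k)) (w : W.Smooth) (j : ℕ) :
    (mkFin c w).1 j = (c, w.1 j) := rfl

theorem smooth_fin_fst (v : (W.addFin k).Smooth) (j : ℕ) : (v.1 j).1 = (v.1 0).1 := by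
  induction j with
  | zero => rfl
  | succ j ih => rw [← ih, ← v.2 j]; rfl

theorem mem_lev_stdQuadrant {m : ℕ} {v : (W.addFin k).L m} :
    v ∈ (W.addFin k).lev (stdQuadrant W k d) m ↔ ∀ j : Fin k, j.val < d → 0 ≤ v.1 j := by
  show (W.addFin k).down m v ∈ stdQuadrant W k d ↔ _
  rw [addFin_down]; rfl

theorem convex_stdQuadrant : Convex ℝ (stdQuadrant W k d) := by
  intro x hx y hy a b ha hb _ j hj
  exact add_nonneg (mul_nonneg ha (hx j hj)) (mul_nonneg hb (hy j hj))

variable {V : Set ((W.addFin k).L 0)}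

/-- Smooth points are dense in the levels of relatively open subsets of a standard quadrant, without
moving the finite-dimensional coordinates. -/
theorem smoothDense_of_relOpen (hV : IsRelOpen (stdQuadrant W k d) V) : SmoothDense V := by
  intro m v hv
  obtain ⟨δ, hδ, hball⟩ := hV.ball hv
  have h1 : ∀ n : ℕ, ∃ w : W.Smooth, ‖w.1 m - v.2‖ < min δ (1 / (n + 1)) := fun n =>
    W.dense_smooth m v.2 (lt_min hδ (by positivity))
  choose w hw using h1
  refine ⟨fun n => mkFin v.1 (w n), fun n => ?_, ?_⟩
  · rw [← smooth_mem_lev (m := m)]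
    refine hball _ ?_ ?_
    · have h2 : v ∈ (W.addFin k).lev (stdQuadrant W k d) m := hV.subset hv
      rw [mem_lev_stdQuadrant] at h2 ⊢
      exact h2
    · have : ‖(mkFin v.1 (w n)).1 m - v‖ = ‖(w n).1 m - v.2‖ := by
        rw [Prod.norm_def]; simp
      rw [this]
      exact (hw n).trans_le (min_le_left _ _)
  · have h2 : Filter.Tendsto (fun n => (w n).1 m) Filter.atTop (𝓝 v.2) := by
      rw [tendsto_iff_norm_sub_tendsto_zero]
      exact squeeze_zero (fun n => norm_nonneg _) (fun n => ((hw n).le.trans (min_le_right _ _)))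
        tendsto_one_div_add_atTop_nhds_zero_nat
    exact (tendsto_const_nhds (x := v.1)).prodMk_nhds h2

/-- Maps that are `sc¹` along curves are strictly differentiable from each level to the previous one. -/
theorem Sc1.strict (hV : IsRelOpen (stdQuadrant W k d) V) {f : ScFam (W.addFin k) F} {D}
    (hf : Sc1 V f D) (v₀ : (W.addFin k).Smooth) (h₀ : v₀.1 0 ∈ V) (m : ℕ) {ε : ℝ} (hε : 0 < ε) :
    ∃ δ > 0, ∀ v ∈ (W.addFin k).lev V (m + 1), ∀ v' ∈ (W.addFin k).lev V (m + 1),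
      ‖v - v₀.1 (m + 1)‖ < δ → ‖v' - v₀.1 (m + 1)‖ < δ →
      ‖f m ((W.addFin k).incl m v) - f m ((W.addFin k).incl m v') -
        D m (v₀.1 (m + 1)) ((W.addFin k).incl m (v - v'))‖ ≤ ε * ‖v - v'‖ := by
  obtain ⟨δ₁, hδ₁, hball⟩ := hV.ball (m := m + 1) (v₀ := v₀.1 (m + 1)) (smooth_mem_lev.2 h₀)
  obtain ⟨δ₂, hδ₂, hD⟩ := hf.norm_continuous (m := m) (x₀ := v₀.1 (m + 1)) (smooth_mem_lev.2 h₀) hε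
  refine ⟨min δ₁ δ₂, lt_min hδ₁ hδ₂, fun v hv v' hv' hd hd' => ?_⟩
  refine hf.mean_value convex_stdQuadrant hV (smoothDense_of_relOpen hV) (n := fun x => ‖x‖)
    continuous_norm (δ := min δ₁ δ₂)
    (fun v hv h => hball v hv (h.trans_le (min_le_left _ _))) ?_ hv hv' hd hd'
  intro u hu hud X
  have := hD (u.1 (m + 1)) (smooth_mem_lev.2 hu) (hud.trans_le (min_le_right _ _)) (X.1 (m + 1))
  rwa [X.2] at this

/-- The vector `(1, …, 1; 0)`. -/
noncomputable def oneVec (W : ScSpace.{u}) (k : ℕ) : (W.addFin k).Smooth :=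
  mkFin (WithLp.toLp 2 fun _ => 1) 0

theorem isDir_of_relOpen {E : ScSpace.{u}} {C U : Set (E.L 0)} (hU : IsRelOpen C U) {e X : E.Smooth}
    (he : e.1 0 ∈ U) (h : IsDir C e X) : IsDir U e X := by
  obtain ⟨O, hO, rfl⟩ := hU
  refine Filter.Eventually.and h ?_
  have : Filter.Tendsto (fun t : ℝ => (e + t • X).1 0) (𝓝[>] 0) (𝓝 (e.1 0)) := by
    have : Continuous (fun t : ℝ => e.1 0 + t • X.1 0) := by fun_prop
    simpa using (this.tendsto 0).mono_left nhdsWithin_le_nhds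
  exact this.eventually (hO.mem_nhds he.2)

theorem Inward.of_relOpen {E : ScSpace.{u}} {C U : Set (E.L 0)} (hU : IsRelOpen C U) {e X : E.Smooth}
    (he : e.1 0 ∈ U) (h : Inward C e X) : Inward U e X := fun Y => by
  obtain ⟨s, hs, h⟩ := h Y
  exact ⟨s, hs, isDir_of_relOpen hU he h⟩

theorem Fat.of_relOpen {E : ScSpace.{u}} {C U : Set (E.L 0)} (hU : IsRelOpen C U) (h : Fat C) : Fat U :=
  fun e he => (h e (hU.subset he)).imp fun _ hν => hν.of_relOpen hU he

/-- A vector strictly increasing all vanishing coordinates among finitely many points strictly into the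
region where these coordinates are nonnegative. -/
theorem inward_of_coords {E : ScSpace.{u}} {n : ℕ} {P : Fin n → Prop} (φ : Fin n → E.L 0 →ₗ[ℝ] ℝ)
    {e ν : E.Smooth} (he : ∀ j, P j → 0 ≤ φ j (e.1 0))
    (hν : ∀ j, P j → φ j (e.1 0) = 0 → 0 < φ j (ν.1 0)) :
    Inward {x | ∀ j, P j → 0 ≤ φ j x} e ν := by
  intro Y
  have h1 : ∀ j, P j → φ j (e.1 0) = 0 → ∀ᶠ s in 𝓝[>] (0 : ℝ), 0 < φ j (ν.1 0) + s * φ j (Y.1 0) := by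
    intro j hj h0
    have : Continuous (fun s : ℝ => φ j (ν.1 0) + s * φ j (Y.1 0)) := by fun_prop
    exact ((this.tendsto 0).mono_left nhdsWithin_le_nhds).eventually
      (lt_mem_nhds (by simpa using hν j hj h0))
  have h2 : ∀ᶠ s in 𝓝[>] (0 : ℝ), 0 < s ∧ ∀ j, P j → φ j (e.1 0) = 0 →
      0 < φ j (ν.1 0) + s * φ j (Y.1 0) := by
    refine Filter.Eventually.and self_mem_nhdsWithin ?_
    simp only [Filter.eventually_all]
    exact h1
  obtain ⟨s, hs, h⟩ := h2.exists
  refine ⟨s, hs, ?_⟩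
  have h3 : ∀ j, P j → ∀ᶠ t in 𝓝[>] (0 : ℝ), 0 ≤ φ j ((e + t • (ν + s • Y)).1 0) := by
    intro j hj
    simp only [Smooth.add_val, Smooth.smul_val, map_add, map_smul, smul_eq_mul]
    rcases (he j hj).eq_or_lt with h0 | h0
    · filter_upwards [self_mem_nhdsWithin] with t ht
      rw [← h0, zero_add]
      exact mul_nonneg (le_of_lt ht) (h j hj h0.symm).le
    · have : Continuous (fun t : ℝ => φ j (e.1 0) + t * (φ j (ν.1 0) + s * φ j (Y.1 0))) := by fun_prop
      filter_upwards [((this.tendsto 0).mono_left nhdsWithin_le_nhds).eventually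
        (lt_mem_nhds (by simpa using h0))] with t ht
      exact ht.le
  have h4 : ∀ᶠ t in 𝓝[>] (0 : ℝ), ∀ j, P j → 0 ≤ φ j ((e + t • (ν + s • Y)).1 0) := by
    simp only [Filter.eventually_all]
    exact h3
  exact h4

/-- The finite-dimensional coordinates on `ℝᵏ ⊕ W`. -/
noncomputable def finCoord (W : ScSpace.{u}) (k : ℕ) (j : Fin k) : (W.addFin k).L 0 →ₗ[ℝ] ℝ :=
  (EuclideanSpace.proj j : EuclideanSpace ℝ (Fin k) →L[ℝ] ℝ).toLinearMap ∘ₗ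
    LinearMap.fst ℝ _ (W.L 0)

@[simp] theorem finCoord_apply (j : Fin k) (x : (W.addFin k).L 0) : finCoord W k j x = x.1 j := rfl

theorem inward_stdQuadrant {e ν : (W.addFin k).Smooth} (he : e.1 0 ∈ stdQuadrant W k d)
    (hν : ∀ j : Fin k, j.val < d → (e.1 0).1 j = 0 → 0 < (ν.1 0).1 j) :
    Inward (stdQuadrant W k d) e ν :=
  inward_of_coords (P := fun j : Fin k => j.val < d) (finCoord W k) he hν

theorem fat_stdQuadrant : Fat (stdQuadrant W k d) := fun _ he =>
  ⟨oneVec W k, inward_stdQuadrant he fun j _ _ => by simp [oneVec]⟩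

theorem fat_univ {E : ScSpace.{u}} : Fat (univ : Set (E.L 0)) := fun _ _ =>
  ⟨0, fun _ => ⟨1, one_pos, Filter.Eventually.of_forall fun _ => mem_univ _⟩⟩

namespace PartialQuadrant

variable {E : ScSpace.{u}} (C : PartialQuadrant E)

/-- The coordinates of a partial quadrant are linear. -/
noncomputable def coordₗ (j : Fin C.n) : E.L 0 →ₗ[ℝ] ℝ :=
  (EuclideanSpace.proj j : EuclideanSpace ℝ (Fin C.n) →L[ℝ] ℝ).toLinearMap ∘ₗ
      LinearMap.fst ℝ _ (C.W.L 0) ∘ₗ (C.iso.fwd.map 0).toLinearMap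

theorem coordₗ_apply (j : Fin C.n) (x : E.L 0) : C.coordₗ j x = C.coord j x := rfl

theorem inward {e ν : E.Smooth} (he : e.1 0 ∈ C.carrier)
    (hν : ∀ j, C.coord j (e.1 0) = 0 → 0 < C.coord j (ν.1 0)) : Inward C.carrier e ν := by
  have := inward_of_coords (P := fun _ => True) C.coordₗ (fun j _ => he j) (fun j _ => hν j)
  simpa [coordₗ_apply, carrier] using this

/-- A smooth vector all of whose coordinates are `1`. -/
noncomputable def oneVec : E.Smooth := C.iso.bwd.app (_root_.oneVec C.W C.n)

theorem coord_oneVec (j : Fin C.n) : C.coord j (C.oneVec.1 0) = 1 := by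
  show ((C.iso.fwd.map 0 (C.iso.bwd.map 0 _)).1 j : ℝ) = 1
  rw [C.iso.right_inv]
  show ((_root_.oneVec C.W C.n).1 0).1 j = 1
  simp [_root_.oneVec]

theorem fat : Fat C.carrier := fun _ he => ⟨C.oneVec, C.inward he fun j _ => by
  rw [C.coord_oneVec]; exact one_pos⟩

end PartialQuadrant

end StdQuadrant

/-! ### Compact perturbations -/

section Fredholm

open Filter

/-- Along a subsequence `C x` converges, and the estimate then bounds the differences of the `x` by
those of `T x` and `C x`. -/
theorem exists_subseq_of_compact_estimate {X Y Z : Type*} [NormedAddCommGroup X] [NormedSpace ℝ X]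
    [CompleteSpace X] [NormedAddCommGroup Y] [NormedSpace ℝ Y] [NormedAddCommGroup Z] [NormedSpace ℝ Z]
    {T : X →L[ℝ] Y} {C : X →L[ℝ] Z} (hC : IsCompactOperator C) {a : ℝ}
    (h : ∀ x, ‖x‖ ≤ a * (‖T x‖ + ‖C x‖)) {x : ℕ → X} (hx : ∀ n, ‖x n‖ ≤ 1)
    (hT : CauchySeq (fun n => T (x n))) :
    ∃ φ : ℕ → ℕ, StrictMono φ ∧ ∃ y, Tendsto (fun n => x (φ n)) atTop (𝓝 y) := by
  obtain ⟨K, hK, hKX⟩ := IsCompactOperator.image_closedBall_subset_compact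
    (f := (C : X →ₗ[ℝ] Z)) hC 1
  obtain ⟨z, -, φ, hφ, hz⟩ := hK.tendsto_subseq (x := fun n => C (x n))
    (fun n => hKX ⟨x n, by simpa using hx n, rfl⟩)
  refine ⟨φ, hφ, cauchySeq_tendsto_of_complete ?_⟩
  have h1 := (hT.comp_tendsto hφ.tendsto_atTop)
  have h2 := hz.cauchySeq
  rw [Metric.cauchySeq_iff] at h1 h2 ⊢
  intro ε hε
  have hpos : 0 < ε / 2 / (|a| + 1) := by positivity
  obtain ⟨N₁, hN₁⟩ := h1 _ hpos
  obtain ⟨N₂, hN₂⟩ := h2 _ hpos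
  refine ⟨max N₁ N₂, fun m hm n hn => ?_⟩
  have b1 := hN₁ m (le_of_max_le_left hm) n (le_of_max_le_left hn)
  have b2 := hN₂ m (le_of_max_le_right hm) n (le_of_max_le_right hn)
  simp only [Function.comp_apply, dist_eq_norm, ← map_sub] at b1 b2 ⊢
  calc ‖x (φ m) - x (φ n)‖ ≤ a * (‖T (x (φ m) - x (φ n))‖ + ‖C (x (φ m) - x (φ n))‖) := h _
    _ ≤ (|a| + 1) * (‖T (x (φ m) - x (φ n))‖ + ‖C (x (φ m) - x (φ n))‖) := by
        gcongr; linarith [le_abs_self a]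
    _ < (|a| + 1) * (ε / 2 / (|a| + 1) + ε / 2 / (|a| + 1)) := by gcongr
    _ = ε := by field_simp; ring

/-- The unit ball of the kernel is compact by the subsequence argument, so the kernel is
finite-dimensional. On a closed complement of the kernel the term `C x` can be dropped from the
estimate, and `T` is bounded below there. -/
theorem finite_ker_and_closed_range {X Y Z : Type*} [NormedAddCommGroup X] [NormedSpace ℝ X]
    [CompleteSpace X] [NormedAddCommGroup Y] [NormedSpace ℝ Y] [NormedAddCommGroup Z] [NormedSpace ℝ Z]
    (T : X →L[ℝ] Y) {C : X →L[ℝ] Z} (hC : IsCompactOperator C) {a : ℝ}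
    (h : ∀ x, ‖x‖ ≤ a * (‖T x‖ + ‖C x‖)) :
    FiniteDimensional ℝ T.ker ∧ IsClosed (range T) := by
  have hfin : FiniteDimensional ℝ T.ker := by
    refine FiniteDimensional.of_isCompact_closedBall₀ ℝ (r := 1) one_pos ?_
    refine IsSeqCompact.isCompact fun x hx => ?_
    obtain ⟨φ, hφ, y, hy⟩ := exists_subseq_of_compact_estimate hC h (x := fun n => (x n : X))
      (fun n => by simpa using hx n) (by
        have : (fun n => T (x n : X)) = fun _ => 0 := funext fun n => (x n).2
        rw [this]; exact cauchySeq_const 0)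
    have hyk : y ∈ T.ker := T.isClosed_ker.mem_of_tendsto hy (Eventually.of_forall fun n => (x (φ n)).2)
    have hy' : Tendsto (fun n => x (φ n)) atTop (𝓝 ⟨y, hyk⟩) := by
      rw [tendsto_subtype_rng]; exact hy
    exact ⟨⟨y, hyk⟩, Metric.isClosed_closedBall.mem_of_tendsto hy'
      (Eventually.of_forall fun n => hx _), φ, hφ, hy'⟩
  refine ⟨hfin, ?_⟩
  obtain ⟨p, hp⟩ := Submodule.ClosedComplemented.of_finiteDimensional (𝕜 := ℝ) T.ker
  have hbound : ∃ c : NNReal, ∀ x, p x = 0 → ‖x‖ ≤ c * ‖T x‖ := by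
    by_contra! hcon
    -- Otherwise there are unit vectors in the complement whose images tend to `0`; a limit of a
    -- subsequence is a unit vector both in the complement and in the kernel of `T`.
    have h1 : ∀ n : ℕ, ∃ x, p x = 0 ∧ ‖x‖ = 1 ∧ ‖T x‖ ≤ 1 / (n + 1) := by
      intro n
      obtain ⟨x, hx, hlt⟩ := hcon (n + 1)
      have hx0 : 0 < ‖x‖ := lt_of_le_of_lt (by positivity) hlt
      refine ⟨‖x‖⁻¹ • x, by simp [hx], ?_, ?_⟩
      · rw [norm_smul, norm_inv, norm_norm, inv_mul_cancel₀ hx0.ne']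
      · rw [map_smul, norm_smul, norm_inv, norm_norm, inv_mul_le_iff₀ hx0, mul_one_div,
          le_div_iff₀ (by positivity)]
        push_cast at hlt
        linarith
    choose x hx0 hx1 hxT using h1
    have hT0 : Tendsto (fun n => T (x n)) atTop (𝓝 0) :=
      squeeze_zero_norm hxT tendsto_one_div_add_atTop_nhds_zero_nat
    obtain ⟨φ, hφ, y, hy⟩ := exists_subseq_of_compact_estimate hC h (x := x) (fun n => (hx1 n).le)
      hT0.cauchySeq
    have hTy : T y = 0 := tendsto_nhds_unique ((T.continuous.tendsto y).comp hy)
      (hT0.comp hφ.tendsto_atTop)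
    have hpy : p y = 0 := tendsto_nhds_unique ((p.continuous.tendsto y).comp hy)
      (by simp [Function.comp_def, hx0])
    have hny : ‖y‖ = 1 := tendsto_nhds_unique hy.norm (by simp [hx1])
    have := hp ⟨y, hTy⟩
    rw [show p y = 0 from hpy] at this
    have h0 : y = 0 := (congrArg Subtype.val this).symm
    rw [h0, norm_zero] at hny
    exact zero_ne_one hny
  obtain ⟨c, hc⟩ := hbound
  have hanti : AntilipschitzWith c (T.comp p.ker.subtypeL) :=
    ContinuousLinearMap.antilipschitz_of_bound _ fun x => hc x x.2
  have : CompleteSpace p.ker := p.isClosed_ker.completeSpace_coe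
  have hcl := hanti.isClosed_range (T.comp p.ker.subtypeL).uniformContinuous
  convert hcl using 1
  ext y
  constructor
  · rintro ⟨x, rfl⟩
    refine ⟨⟨x - p x, ?_⟩, ?_⟩
    · show p (x - p x) = 0
      rw [map_sub, hp, sub_self]
    · show T (x - p x) = T x
      rw [map_sub, show T (p x) = 0 from (p x).2, sub_zero]
  · rintro ⟨x, rfl⟩
    exact ⟨x, rfl⟩

end Fredholm

/-! ### Linear sc-Fredholm operators -/

namespace ScOp

variable {E F G : ScSpace.{u}}

/-- The properties of linear sc-Fredholm operators needed here: regularization, finite-dimensional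
kernel, closed range. -/
structure IsFredholm (T : ScOp E F) : Prop where
  reg : ∀ m (x : E.L 0), T.map 0 x ∈ range (F.down m) → x ∈ range (E.down m)
  fin : FiniteDimensional ℝ (T.map 0).ker
  closed : IsClosed (range (T.map 0))

variable {T : ScOp E F}

/-- Modulo the finite-dimensional factors, `T` is the identity plus an operator gaining a level. The
gain makes the perturbation compact, which yields the estimate for `finite_ker_and_closed_range`,
and it raises the regularity of solutions one level at a time. -/
theorem IsFredholm.of_smoothing {W : ScSpace.{u}} {k N : ℕ} {T : ScOp (W.addFin k) (W.addFin N)}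
    (K : ScOp (W.addFin k) (W.addFin N).shift)
    (h : ∀ (x : (W.addFin k).L 0), T.map 0 x = (0, x.2) + (W.addFin N).incl 0 (K.map 0 x)) :
    T.IsFredholm := by
  have hm : ∀ m (x : (W.addFin k).L m), T.map m x = (0, x.2) + (W.addFin N).incl m (K.map m x) := by
    intro m x
    apply down_injective m
    rw [down_map, h, map_add, addFin_down, addFin_down, ← down_succ, ← shift_down, down_map K, addFin_down]

  have hest : ∀ x : (W.addFin k).L 0, ‖x‖ ≤ 1 * (‖T.map 0 x‖ +
      ‖((ContinuousLinearMap.fst ℝ (EuclideanSpace ℝ (Fin k)) (W.L 0)).prod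
        (((W.addFin N).incl 0).comp (K.map 0))) x‖) := by
    intro x
    have h1 := hm 0 x
    set y := (W.addFin N).incl 0 (K.map 0 x)
    have e1 : x.2 = (T.map 0 x).2 - y.2 := by rw [h1]; simp
    have hx : ‖x‖ = max ‖x.1‖ ‖x.2‖ := Prod.norm_def _
    have h3 : ‖(x.1, y)‖ = max ‖x.1‖ ‖y‖ := Prod.norm_def _
    show _ ≤ 1 * (‖T.map 0 x‖ + ‖(x.1, y)‖)
    rw [hx, h3, one_mul]
    refine max_le ((le_max_left _ _).trans (le_add_of_nonneg_left (norm_nonneg _))) ?_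
    calc ‖x.2‖ = ‖(T.map 0 x).2 - y.2‖ := congrArg _ e1
      _ ≤ ‖(T.map 0 x).2‖ + ‖y.2‖ := norm_sub_le _ _
      _ ≤ ‖T.map 0 x‖ + max ‖x.1‖ ‖y‖ := by
        gcongr
        · exact norm_snd_le _
        · exact (norm_snd_le _).trans (le_max_right _ _)
  have hC : IsCompactOperator ((ContinuousLinearMap.fst ℝ (EuclideanSpace ℝ (Fin k)) (W.L 0)).prod
        (((W.addFin N).incl 0).comp (K.map 0))) := by
    obtain ⟨K₁, hK₁, hK₁'⟩ : IsCompactOperator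
        (ContinuousLinearMap.fst ℝ (EuclideanSpace ℝ (Fin k)) (W.L 0)) :=
      (isCompactOperator_id (E := EuclideanSpace ℝ (Fin k))).comp_clm
        (ContinuousLinearMap.fst ℝ (EuclideanSpace ℝ (Fin k)) (W.L 0))
    obtain ⟨K₂, hK₂, hK₂'⟩ : IsCompactOperator (((W.addFin N).incl 0).comp (K.map 0)) :=
      ((W.addFin N).incl_compact 0).comp_clm (K.map 0)
    refine ⟨K₁ ×ˢ K₂, hK₁.prod hK₂, ?_⟩
    filter_upwards [hK₁', hK₂'] with x h1 h2
    exact ⟨h1, h2⟩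
  obtain ⟨h1, h2⟩ := finite_ker_and_closed_range (T.map 0) hC hest
  refine ⟨fun m x => ?_, h1, h2⟩
  induction m with
  | zero => exact fun _ => ⟨x, rfl⟩
  | succ m ih =>
    rintro ⟨z, hz⟩
    obtain ⟨y, rfl⟩ := ih ⟨_, hz⟩
    rw [← down_map, down_succ] at hz
    have hz := down_injective m hz
    rw [hm] at hz
    -- The equation `T y = z` expresses `y.2` by `z` and `K y`, both of level `m + 1`; the
    -- finite-dimensional part `y.1` lies on every level.
    refine ⟨(y.1, (z - K.map m y).2), ?_⟩
    rw [down_succ]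
    congr 1
    refine Prod.ext rfl ?_
    have := congrArg Prod.snd hz
    have h5 : ((W.addFin N).incl m z).2 = W.incl m z.2 := rfl
    have h6 : ((W.addFin N).incl m (K.map m y)).2 = W.incl m (K.map m y).2 := rfl
    rw [Prod.snd_add, h5, h6] at this
    show W.incl m (z.2 - (K.map m y).2) = y.2
    rw [map_sub, this, add_sub_cancel_right]

theorem IsFredholm.conj {E' F' : ScSpace.{u}} (hT : T.IsFredholm) (A : ScIso E' E) (B : ScIso F F') :
    (B.fwd.comp (T.comp A.fwd)).IsFredholm := by
  have hr : ∀ m y, B.fwd.map 0 y ∈ range (F'.down m) → y ∈ range (F.down m) := by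
    rintro m y ⟨z, hz⟩
    refine ⟨B.bwd.map m z, ?_⟩
    rw [down_map, hz, B.left_inv]
  refine ⟨fun m x hx => ?_, ?_, ?_⟩
  · obtain ⟨y, hy⟩ := hT.reg m _ (hr m _ hx)
    refine ⟨A.bwd.map m y, ?_⟩
    rw [down_map, hy]
    exact A.left_inv 0 x
  · have := hT.fin
    have hle : ((B.fwd.comp (T.comp A.fwd)).map 0).ker ≤ (T.map 0).ker.map (A.bwd.map 0).toLinearMap := by
      intro x hx
      refine ⟨A.fwd.map 0 x, ?_, A.left_inv 0 x⟩
      have h1 : B.fwd.map 0 (T.map 0 (A.fwd.map 0 x)) = 0 := hx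
      have h2 := congrArg (B.bwd.map 0) h1
      rw [B.left_inv, map_zero] at h2
      exact h2
    exact Submodule.finiteDimensional_of_le hle
  · have : range ((B.fwd.comp (T.comp A.fwd)).map 0) = B.bwd.map 0 ⁻¹' range (T.map 0) := by
      ext y
      constructor
      · rintro ⟨x, rfl⟩
        exact ⟨A.fwd.map 0 x, (B.left_inv 0 _).symm⟩
      · rintro ⟨x, hx⟩
        refine ⟨A.bwd.map 0 x, ?_⟩
        show B.fwd.map 0 (T.map 0 (A.fwd.map 0 (A.bwd.map 0 x))) = y
        rw [A.right_inv, hx, B.right_inv]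
    rw [this]
    exact hT.closed.preimage (B.bwd.map 0).continuous

theorem IsFredholm.surjective (hT : T.IsFredholm) (h : Function.Surjective (T.map 0)) (m : ℕ) :
    Function.Surjective (T.map m) := by
  intro y
  obtain ⟨x, hx⟩ := h (F.down m y)
  obtain ⟨z, rfl⟩ := hT.reg m x ⟨y, hx.symm⟩
  refine ⟨z, down_injective m ?_⟩
  rw [down_map, hx]

/-- The smooth points are dense and the range on level `0` is closed, so `T` is onto there;
regularization carries this to every level. -/
theorem IsFredholm.surjective_of_dense (hT : T.IsFredholm) {i : ℕ}
    (h : ∀ y : F.Smooth, y.1 0 ∈ closure (range (T.map 0))) : Function.Surjective (T.map i) := by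
  refine hT.surjective (fun y => ?_) i
  rw [hT.closed.closure_eq] at h
  have : y ∈ closure (range (T.map 0)) := (F.dense 0).mono (by rintro _ ⟨e, rfl⟩; exact h e) y
  rwa [hT.closed.closure_eq] at this

theorem IsFredholm.surjective_of_level (hT : T.IsFredholm) {i : ℕ} (h : Function.Surjective (T.map i))
    (m : ℕ) : Function.Surjective (T.map m) := by
  refine hT.surjective_of_dense fun y => subset_closure ?_
  obtain ⟨x, hx⟩ := h (y.1 i)
  exact ⟨E.down i x, by rw [← down_map, hx, down_smooth]⟩

/-- By regularization a kernel vector lies on every level, so all levels have the same kernel. -/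
theorem IsFredholm.injective_of_level (hT : T.IsFredholm) {i : ℕ} (h : Function.Injective (T.map i))
    (m : ℕ) : Function.Injective (T.map m) := by
  rw [injective_iff_map_eq_zero] at h ⊢
  intro x hx
  have h0 : T.map 0 (E.down m x) = 0 := by rw [← down_map, hx, map_zero]
  obtain ⟨z, hz⟩ := hT.reg i (E.down m x) ⟨0, by rw [h0, map_zero]⟩
  have hz0 : T.map i z = 0 := by
    apply down_injective i
    rw [down_map, hz, h0, map_zero]
  rw [h z hz0, map_zero] at hz
  apply down_injective m
  rw [← hz, map_zero]

/-- A surjective Fredholm sc-operator has a right inverse sc-operator. -/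
theorem IsFredholm.exists_rightInverse (hT : T.IsFredholm) (h : Function.Surjective (T.map 0)) :
    ∃ Q : ScOp F E, ∀ m y, T.map m (Q.map m y) = y := by
  have := hT.fin
  obtain ⟨p, hp⟩ := Submodule.ClosedComplemented.of_finiteDimensional (𝕜 := ℝ) (T.map 0).ker
  -- Adding a projection onto the kernel makes `T` bijective on every level, with the same
  -- finite-dimensional extra factor each time, since the kernel consists of vectors lying on all
  -- levels. The right inverse is `y ↦ A⁻¹ (y, 0)`.
  let A : ∀ m, E.L m →L[ℝ] F.L m × (T.map 0).ker := fun m => (T.map m).prod (p.comp (E.down m))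
  have hAi : ∀ m, Function.Injective (A m) := fun m => by
    rw [injective_iff_map_eq_zero]
    intro x hx
    have h1 : T.map m x = 0 := congrArg Prod.fst hx
    have h2 : p (E.down m x) = 0 := congrArg Prod.snd hx
    have h3 : T.map 0 (E.down m x) = 0 := by rw [← down_map, h1, map_zero]
    have h4 := hp ⟨_, h3⟩
    rw [show p (E.down m x) = 0 from h2] at h4
    apply down_injective m
    rw [map_zero]
    exact (congrArg Subtype.val h4).symm
  have hAs : ∀ m, Function.Surjective (A m) := by
    rintro m ⟨y, z⟩
    obtain ⟨x, rfl⟩ := hT.surjective h m y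
    have hk : T.map 0 ((z - p (E.down m x) : (T.map 0).ker) : E.L 0) = 0 := (z - p (E.down m x)).2
    obtain ⟨x', hx'⟩ := hT.reg m ((z - p (E.down m x) : (T.map 0).ker) : E.L 0)
      ⟨0, by rw [hk, map_zero]⟩
    refine ⟨x + x', Prod.ext ?_ ?_⟩
    · show T.map m (x + x') = T.map m x
      have : T.map m x' = 0 := by
        apply down_injective m
        rw [down_map, hx', hk, map_zero]
      rw [map_add, this, add_zero]
    · show p (E.down m (x + x')) = z
      rw [map_add, hx', map_add, hp]
      abel
  let e : ∀ m, E.L m ≃L[ℝ] F.L m × (T.map 0).ker := fun m =>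
    ContinuousLinearEquiv.ofBijective (A m) (LinearMap.ker_eq_bot.2 (hAi m))
      (LinearMap.range_eq_top.2 (hAs m))
  have he : ∀ m y, A m ((e m).symm y) = y := fun m y => (e m).apply_symm_apply y
  refine ⟨⟨fun m => ((e m).symm : F.L m × (T.map 0).ker →L[ℝ] E.L m).comp
    (ContinuousLinearMap.inl ℝ _ _), fun m y => ?_⟩, fun m y => ?_⟩
  · apply hAi m
    show A m (E.incl m ((e (m + 1)).symm (y, 0))) = A m ((e m).symm (F.incl m y, 0))
    rw [he]
    have h1 := he (m + 1) (y, 0)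
    have h2 := congrArg Prod.fst h1
    have h3 := congrArg Prod.snd h1
    refine Prod.ext ?_ h3
    show T.map m (E.incl m _) = F.incl m y
    rw [← T.comm]
    exact congrArg _ h2
  · exact congrArg Prod.fst (he m (y, 0))

end ScOp

/-! ### Operators near a right-invertible one, and one-sided difference quotients -/

/-- Operators close to an operator with a right inverse are surjective, and bijective if the right
inverse is a two-sided inverse. -/
theorem surjective_of_near {X Y : Type*} [NormedAddCommGroup X] [NormedSpace ℝ X] [CompleteSpace X]
    [NormedAddCommGroup Y] [NormedSpace ℝ Y] [CompleteSpace Y] {T : X →L[ℝ] Y} {Q : Y →L[ℝ] X}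
    (hQ : ∀ y, T (Q y) = y) : ∃ ε > 0, ∀ S : X →L[ℝ] Y, (∀ x, ‖S x - T x‖ ≤ ε * ‖x‖) →
      Function.Surjective S ∧ (Function.Injective T → Function.Injective S) := by
  -- This makes `‖S - T‖ * ‖Q‖ < 1`, so `S ∘ Q`, and `Q ∘ S` if `T` is injective, are perturbations
  -- of the identity of norm less than `1`.
  refine ⟨1 / (2 * (‖Q‖ + 1)), by positivity, fun S hS => ?_⟩
  have hST : ‖S - T‖ ≤ 1 / (2 * (‖Q‖ + 1)) := ContinuousLinearMap.opNorm_le_bound _ (by positivity) hS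
  have hlt : ‖S - T‖ * ‖Q‖ < 1 := by
    calc ‖S - T‖ * ‖Q‖ ≤ 1 / (2 * (‖Q‖ + 1)) * ‖Q‖ := by gcongr
      _ < 1 := by
        rw [one_div_mul_eq_div, div_lt_one (by positivity)]
        linarith [norm_nonneg Q]
  constructor
  · have hu : IsUnit (S.comp Q) := by
      have : S.comp Q = 1 - (T - S).comp Q := by
        ext y; simp [hQ]
      rw [this]
      refine isUnit_one_sub_of_norm_lt_one ?_
      calc ‖(T - S).comp Q‖ ≤ ‖T - S‖ * ‖Q‖ := ContinuousLinearMap.opNorm_comp_le _ _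
        _ < 1 := by rwa [norm_sub_rev]
    intro y
    obtain ⟨A, hA⟩ := hu.exists_right_inv
    exact ⟨Q (A y), congrArg (fun B => B y) hA⟩
  · intro hT
    have hQ' : ∀ x, Q (T x) = x := fun x => hT (hQ _)
    have hu : IsUnit (Q.comp S) := by
      have : Q.comp S = 1 - Q.comp (T - S) := by
        ext y; simp [hQ']
      rw [this]
      refine isUnit_one_sub_of_norm_lt_one ?_
      calc ‖Q.comp (T - S)‖ ≤ ‖Q‖ * ‖T - S‖ := ContinuousLinearMap.opNorm_comp_le _ _
        _ < 1 := by rwa [norm_sub_rev, mul_comm]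
    obtain ⟨A, hA⟩ := hu.exists_left_inv
    intro x y hxy
    have h1 : ∀ z, A (Q (S z)) = z := fun z => congrArg (fun B => B z) hA
    rw [← h1 x, hxy, h1]

theorem norm_sub_le_of_hasDerivWithinAt {Y : Type*} [NormedAddCommGroup Y] [NormedSpace ℝ Y]
    {φ : ℝ → Y} {a b : Y} {c : ℝ} (h : HasDerivWithinAt φ a (Ici 0) 0)
    (hφ : ∀ᶠ t in 𝓝[>] (0 : ℝ), ‖φ t - φ 0 - t • b‖ ≤ t * c) : ‖a - b‖ ≤ c := by
  have h1 := (hasDerivWithinAt_iff_tendsto_slope.1 h)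
  rw [Ici_sdiff_left] at h1
  refine le_of_tendsto ((h1.sub_const b).norm) ?_
  filter_upwards [hφ, self_mem_nhdsWithin] with t ht ht0
  have ht0 : 0 < t := ht0
  rw [slope_def_module, sub_zero]
  have : t⁻¹ • (φ t - φ 0) - b = t⁻¹ • (φ t - φ 0 - t • b) := by
    rw [smul_sub _ (φ t - φ 0), inv_smul_smul₀ ht0.ne']
  rw [this, norm_smul, norm_inv, Real.norm_of_nonneg ht0.le, inv_mul_le_iff₀ ht0]
  exact ht

theorem eventually_norm_le_of_hasDerivWithinAt {Y : Type*} [NormedAddCommGroup Y] [NormedSpace ℝ Y]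
    {φ : ℝ → Y} {a : Y} {c : ℝ} (h : HasDerivWithinAt φ a (Ici 0) 0) (h0 : φ 0 = 0) (hc : ‖a‖ < c) :
    ∀ᶠ t in 𝓝[>] (0 : ℝ), ‖φ t‖ ≤ c * t := by
  have h1 := (hasDerivWithinAt_iff_tendsto_slope.1 h)
  rw [Ici_sdiff_left] at h1
  filter_upwards [h1.norm.eventually (gt_mem_nhds hc), self_mem_nhdsWithin] with t ht ht0
  have ht0 : 0 < t := ht0
  rw [slope_def_module, sub_zero, h0, sub_zero, norm_smul, norm_inv, Real.norm_of_nonneg ht0.le,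
    inv_mul_lt_iff₀ ht0] at ht
  linarith

theorem ScSpace.exists_incl_small (E : ScSpace.{u}) (m : ℕ) {δ : ℝ} (hδ : 0 < δ) :
    ∃ δ' > 0, ∀ x : E.L (m + 1), ‖x‖ < δ' → ‖E.incl m x‖ < δ := by
  obtain ⟨δ', hδ', h⟩ := Metric.continuousAt_iff.1 ((E.incl m).continuous.continuousAt (x := 0)) δ hδ
  exact ⟨δ', hδ', fun x hx => by simpa using h (by simpa using hx)⟩

/-! ### Parametrized germs and their linearization at `0` -/

/-- A family of maps `v ↦ (0, w - B v) + S v - κ (v, h)` on a relatively open subset `V` of a standard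
quadrant, parametrized by `h`, where `B` is a contraction in `w` near `0` on every level, `S` gains one
level, and `κ` is linear in `h`. -/
structure Germ (W H : ScSpace.{u}) (k N d : ℕ) where
  V : Set ((W.addFin k).L 0)
  relOpen : IsRelOpen (stdQuadrant W k d) V
  zero_mem : (0 : (W.addFin k).L 0) ∈ V
  B : ScFam (W.addFin k) W
  DB : ∀ m, (W.addFin k).L (m + 1) → ((W.addFin k).L m →L[ℝ] W.L m)
  hB : Sc1 V B DB
  contr : ∀ i : ℕ, ∀ ε : ℝ, 0 < ε → ∃ δ : ℝ, 0 < δ ∧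
      ∀ (c : EuclideanSpace ℝ (Fin k)) (w₁ w₂ : W.L i),
        (c, w₁) ∈ (W.addFin k).lev V i → (c, w₂) ∈ (W.addFin k).lev V i →
        ‖c‖ < δ → ‖w₁‖ < δ → ‖w₂‖ < δ →
        ‖B i (c, w₁) - B i (c, w₂)‖ ≤ ε * ‖w₁ - w₂‖
  B_zero : B 0 0 = 0
  S : ScFam (W.addFin k) (W.addFin N).shift
  DS : ∀ m, (W.addFin k).L (m + 1) → ((W.addFin k).L m →L[ℝ] (W.addFin N).shift.L m)
  hS : Sc1 V S DS
  S_zero : S 0 0 = 0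
  κ : ScFam ((W.addFin k).prod H) (W.addFin N)
  Dκ : ∀ m, ((W.addFin k).prod H).L (m + 1) → (((W.addFin k).prod H).L m →L[ℝ] (W.addFin N).L m)
  hκ : Sc1 (E := (W.addFin k).prod H) (V ×ˢ univ) κ Dκ
  κ_lin : ∀ x ∈ V, IsLinearMap ℝ (fun h : H.L 0 => κ 0 (x, h))

namespace Germ

variable {W H : ScSpace.{u}} {k N d : ℕ} (G : Germ W H k N d)

/-- The parametrized family of maps given by the germ. -/
noncomputable def F (m : ℕ) (v : (W.addFin k).L m) (h : H.L m) : (W.addFin N).L m :=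
  ((0, v.2 - G.B m v) : (W.addFin N).L m) + (W.addFin N).incl m (G.S m v) - G.κ m (v, h)

theorem zero_mem_lev (m : ℕ) : (0 : (W.addFin k).L m) ∈ (W.addFin k).lev G.V m := by
  rw [mem_lev, map_zero]; exact G.zero_mem

theorem zero_mem' : ((0 : (W.addFin k).Smooth).1 0) ∈ G.V := G.zero_mem

theorem B_zero' (m : ℕ) : G.B m 0 = 0 := by
  apply down_injective m
  rw [G.hB.cont.down (G.zero_mem_lev m), map_zero, map_zero, G.B_zero]

theorem S_zero' (m : ℕ) : G.S m 0 = 0 := by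
  apply down_injective (E := (W.addFin N).shift) m
  rw [G.hS.cont.down (G.zero_mem_lev m), map_zero, map_zero, G.S_zero]

theorem incl_S (m : ℕ) {v : (W.addFin k).L (m + 1)} (hv : v ∈ (W.addFin k).lev G.V (m + 1)) :
    (W.addFin N).incl (m + 1) (G.S (m + 1) v) = G.S m ((W.addFin k).incl m v) := G.hS.cont.2 m v hv

theorem incl_F (m : ℕ) {v : (W.addFin k).L (m + 1)} (hv : v ∈ (W.addFin k).lev G.V (m + 1))
    (h : H.L (m + 1)) :
    (W.addFin N).incl m (G.F (m + 1) v h) = G.F m ((W.addFin k).incl m v) (H.incl m h) := by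
  have h1 : G.κ m ((W.addFin k).incl m v, H.incl m h) = (W.addFin N).incl m (G.κ (m + 1) (v, h)) :=
    (G.hκ.cont.2 m (v, h) (mem_lev_prod.2 ⟨hv, mem_univ _⟩)).symm
  have h2 := G.hB.cont.2 m v hv
  rw [F, F, h1, map_sub, map_add, G.incl_S m hv]
  congr 2
  refine Prod.ext rfl ?_
  show W.incl m (v.2 - G.B (m + 1) v) = W.incl m v.2 - G.B m ((W.addFin k).incl m v)
  rw [map_sub, h2]

theorem continuousOn_F (m : ℕ) (h : H.L m) :
    ContinuousOn (fun v => G.F m v h) ((W.addFin k).lev G.V m) := by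
  have h1 := G.hB.cont.1 m
  have h2 := G.hS.cont.1 m
  have h3 : ContinuousOn (fun v => G.κ m (v, h)) ((W.addFin k).lev G.V m) :=
    (G.hκ.cont.1 m).comp (f := fun v : (W.addFin k).L m => (v, h)) (by fun_prop)
      fun v hv => mem_lev_prod.2 ⟨hv, mem_univ _⟩
  have h4 : ContinuousOn (fun v : (W.addFin k).L m =>
      (((0 : EuclideanSpace ℝ (Fin N)), v.2 - G.B m v) : (W.addFin N).L m)) ((W.addFin k).lev G.V m) :=
    continuousOn_const.prodMk (continuous_snd.continuousOn.sub h1)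
  exact (h4.add (((W.addFin N).incl m).continuous.comp_continuousOn h2)).sub h3

/-- The part of the linearization at `0` that gains one level. -/
noncomputable def K : ScOp (W.addFin k) (W.addFin N).shift where
  map m := (0 : (W.addFin k).L m →L[ℝ] EuclideanSpace ℝ (Fin N)).prod
      -- The vector `(c, 0)` lies on every level, so the derivative of `B` can be taken one level
      -- up. The derivative of `B` in `w` is absent because the contraction constant at `0` is
      -- arbitrarily small, and `κ` does not contribute because it vanishes for `h = 0`.
      (-((G.hB.op 0 G.zero_mem').map (m + 1)).comp ((ContinuousLinearMap.inl ℝ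
        (EuclideanSpace ℝ (Fin k)) (W.L (m + 1))).comp (ContinuousLinearMap.fst ℝ _ (W.L m)))) +
      (G.hS.op 0 G.zero_mem').map m
  comm m X := by
    have h1 := (G.hB.op 0 G.zero_mem').comm (m + 1) (X.1, 0)
    have h2 := (G.hS.op 0 G.zero_mem').comm m X
    have h3 : (W.addFin k).incl (m + 1) (X.1, 0) = (X.1, 0) := Prod.ext rfl (map_zero (W.incl (m + 1)))
    rw [h3] at h1
    have key : (W.addFin N).incl (m + 1) ((((0 : EuclideanSpace ℝ (Fin N)),
        -(G.hB.op 0 G.zero_mem').map (m + 1 + 1) (X.1, 0)) : (W.addFin N).L (m + 1 + 1)) +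
        (G.hS.op 0 G.zero_mem').map (m + 1) X) =
        (((0 : EuclideanSpace ℝ (Fin N)), -(G.hB.op 0 G.zero_mem').map (m + 1) (X.1, 0)) :
          (W.addFin N).L (m + 1)) + (G.hS.op 0 G.zero_mem').map m ((W.addFin k).incl m X) := by
      rw [map_add]
      refine congrArg₂ (· + ·) (Prod.ext rfl ?_) h2
      show W.incl (m + 1) (-_) = -_
      rw [map_neg, h1]
    exact key

/-- The linearization at `0`. -/
noncomputable def T : ScOp (W.addFin k) (W.addFin N) where
  map m := (0 : (W.addFin k).L m →L[ℝ] EuclideanSpace ℝ (Fin N)).prod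
      (ContinuousLinearMap.snd ℝ (EuclideanSpace ℝ (Fin k)) (W.L m)) +
      ((W.addFin N).incl m).comp (G.K.map m)
  comm m X := by
    have h1 := G.K.comm m X
    have key : (W.addFin N).incl m ((((0 : EuclideanSpace ℝ (Fin N)), X.2) : (W.addFin N).L (m + 1)) +
        (W.addFin N).incl (m + 1) (G.K.map (m + 1) X)) =
        (((0 : EuclideanSpace ℝ (Fin N)), W.incl m X.2) : (W.addFin N).L m) +
        (W.addFin N).incl m (G.K.map m ((W.addFin k).incl m X)) := by
      rw [map_add, ← h1]
      rfl
    exact key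

theorem T_apply (m : ℕ) (X : (W.addFin k).L m) : G.T.map m X =
    ((0, X.2) : (W.addFin N).L m) + (W.addFin N).incl m (G.K.map m X) := rfl

/-- On a positive level the derivative of `S` is applied after the inclusion into the previous
level, as the gain of a level permits. This is the form that matches strict differentiability of
`S`. -/
theorem T_succ_apply (m : ℕ) (X : (W.addFin k).L (m + 1)) : G.T.map (m + 1) X =
    ((0, X.2 - G.DB (m + 1) 0 (X.1, 0)) : (W.addFin N).L (m + 1)) +
      G.DS m 0 ((W.addFin k).incl m X) := by
  rw [T_apply, G.K.comm]
  show ((0, X.2) : (W.addFin N).L (m + 1)) + (((0 : EuclideanSpace ℝ (Fin N)),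
    -G.DB (m + 1) 0 (X.1, 0)) + G.DS m 0 ((W.addFin k).incl m X)) = _
  rw [← add_assoc]
  congr 1
  exact Prod.ext (add_zero _) (sub_eq_add_neg _ _).symm

theorem isFredholm_T : G.T.IsFredholm := ScOp.IsFredholm.of_smoothing G.K fun _ => rfl

end Germ

/-! ### Quantitative differentiability of germs -/

namespace Germ

variable {W H : ScSpace.{u}} {k N d : ℕ} (G : Germ W H k N d)

/-- Strict differentiability of the germ at `0`, in the norm of a positive level, for points close to
`0` on the next level. -/
theorem strict_F (n : ℕ) {ε : ℝ} (hε : 0 < ε) : ∃ δ > 0, ∀ v ∈ (W.addFin k).lev G.V (n + 2),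
    ∀ v' ∈ (W.addFin k).lev G.V (n + 2), ‖v‖ < δ → ‖v'‖ < δ →
    ∀ h : H.Smooth, ‖h.1 (n + 2)‖ < δ →
    ‖G.F (n + 1) ((W.addFin k).incl (n + 1) v) (h.1 (n + 1)) -
      G.F (n + 1) ((W.addFin k).incl (n + 1) v') (h.1 (n + 1)) -
      G.T.map (n + 1) ((W.addFin k).incl (n + 1) (v - v'))‖ ≤
      ε * ‖(W.addFin k).incl (n + 1) (v - v')‖ := by
  have hε4 : 0 < ε / 4 := by positivity
  -- Strictness of `S` from level `n + 1` to level `n` of the shifted scale: the values there are on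
  -- level `n + 1` of the original scale, so the estimate has the same level on both sides.
  obtain ⟨δ₁, hδ₁, hS⟩ := G.hS.strict G.relOpen 0 G.zero_mem n hε4
  obtain ⟨δ₂, hδ₂, hB⟩ := G.hB.strict G.relOpen 0 G.zero_mem (n + 1) hε4
  obtain ⟨δ₃, hδ₃, hc⟩ := G.contr (n + 1) _ hε4
  obtain ⟨δ₄, hδ₄, hball⟩ := G.relOpen.ball (m := n + 2) (v₀ := 0) (G.zero_mem_lev (n + 2))
  obtain ⟨C, δ₅, hC, hδ₅, hκ⟩ := G.hκ.fibre_bound G.κ_lin (fat_stdQuadrant.of_relOpen G.relOpen)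
    (e₀ := 0) G.zero_mem' (n + 1)
  obtain ⟨δ₆, hδ₆, h₆⟩ := (W.addFin k).exists_incl_small (n + 1) (lt_min hδ₁ hδ₃)
  -- The bound `ε / 4 / C` on `h` makes the base derivative of `κ` at most `ε / 4`; the other three
  -- quarters of `ε` go to `S` and to the two increments of `B`.
  obtain ⟨δ, hδ, hle⟩ : ∃ δ > 0, δ ≤ δ₂ ∧ δ ≤ δ₄ ∧ δ ≤ δ₅ ∧ δ ≤ δ₆ ∧ δ ≤ ε / 4 / C :=
    ⟨min δ₂ (min δ₄ (min δ₅ (min δ₆ (ε / 4 / C)))), by positivity, by simp, by simp, by simp, by simp,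
      by simp⟩
  obtain ⟨l₂, l₄, l₅, l₆, l₇⟩ := hle
  refine ⟨δ, hδ, fun v hv v' hv' hvd hvd' h hh => ?_⟩
  have hi := h₆ v (hvd.trans_le l₆)
  have hi' := h₆ v' (hvd'.trans_le l₆)
  set y := (W.addFin k).incl (n + 1) v with hy
  set y' := (W.addFin k).incl (n + 1) v' with hy'
  have hyV : y ∈ (W.addFin k).lev G.V (n + 1) := hv
  have hyV' : y' ∈ (W.addFin k).lev G.V (n + 1) := hv'
  have hyy : (W.addFin k).incl (n + 1) (v - v') = y - y' := map_sub _ _ _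
  rw [hyy]
  -- the smoothing part
  have b1 := hS y hyV y' hyV' (by simpa using hi.trans_le (min_le_left _ _))
    (by simpa using hi'.trans_le (min_le_left _ _))
  rw [← G.incl_S n hyV, ← G.incl_S n hyV'] at b1
  -- the contraction
  have hmix : ((v.1, v'.2) : (W.addFin k).L (n + 2)) ∈ (W.addFin k).lev G.V (n + 2) := by
    refine hball _ ?_ ?_
    · have h2 : v ∈ (W.addFin k).lev (stdQuadrant W k d) (n + 2) := G.relOpen.subset hv
      rw [mem_lev_stdQuadrant] at h2 ⊢
      exact h2
    · rw [sub_zero, Prod.norm_def]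
      exact max_lt ((norm_fst_le v).trans_lt (hvd.trans_le l₄))
        ((norm_snd_le v').trans_lt (hvd'.trans_le l₄))
  have hmixn : ‖((v.1, v'.2) : (W.addFin k).L (n + 2))‖ < δ := by
    rw [Prod.norm_def]
    exact max_lt ((norm_fst_le v).trans_lt hvd) ((norm_snd_le v').trans_lt hvd')
  have b2 := hc y.1 y.2 y'.2 hyV (show (W.addFin k).incl (n + 1) (v.1, v'.2) ∈ _ from hmix)
    ((norm_fst_le y).trans_lt (hi.trans_le (min_le_right _ _)))
    ((norm_snd_le y).trans_lt (hi.trans_le (min_le_right _ _)))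
    ((norm_snd_le y').trans_lt (hi'.trans_le (min_le_right _ _)))
  have b3 := hB _ hmix v' hv' (by simpa using hmixn.trans_le l₂) (by simpa using hvd'.trans_le l₂)
  have e1 : ((v.1, v'.2) : (W.addFin k).L (n + 2)) - v' = (y.1 - y'.1, 0) :=
    Prod.ext rfl (sub_self _)
  rw [e1] at b3
  -- The remaining increment of `B` changes only the finite-dimensional coordinates, whose norm is
  -- the same on all levels; so the bound from level `n + 2` is one on level `n + 1`.
  have e2 : ‖((y.1 - y'.1, 0) : (W.addFin k).L (n + 2))‖ = ‖y.1 - y'.1‖ := by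
    rw [Prod.norm_def]; simp
  have e3 : (W.addFin k).incl (n + 1) ((y.1 - y'.1, 0) : (W.addFin k).L (n + 2)) = (y.1 - y'.1, 0) :=
    Prod.ext rfl (map_zero (W.incl (n + 1)))
  rw [e2, e3] at b3
  -- the parametrized part
  have b4 := (G.hκ.slice h).mean_value convex_stdQuadrant G.relOpen (smoothDense_of_relOpen G.relOpen)
    (v₀ := 0) (m := n + 1) (A := 0) (ε := ε / 4) (δ := δ)
    -- The segment runs on level `n + 2`, but its length is measured on level `n + 1`;
    -- `Sc1.fibre_bound` permits this weaker norm.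
    (n := fun x => ‖(W.addFin k).incl (n + 1) x‖) (by fun_prop)
    (fun v hv hd => hball v hv (hd.trans_le l₄)) (fun u hu hud X => by
      have := hκ u h hu (hud.trans_le l₅) (X.1 (n + 1))
      have hX : (W.addFin k).incl (n + 1) (X.1 (n + 1 + 1)) = X.1 (n + 1) := X.2 _
      rw [hX, zero_apply, sub_zero]
      refine this.trans ?_
      gcongr
      calc C * ‖h.1 (n + 1 + 1)‖ ≤ C * (ε / 4 / C) := by gcongr; exact hh.le.trans l₇
        _ = ε / 4 := by field_simp) hv hv' (by simpa using hvd) (by simpa using hvd')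
  simp only [zero_apply, sub_zero] at b4
  rw [hyy] at b4
  have hfst : ‖y.1 - y'.1‖ ≤ ‖y - y'‖ := norm_fst_le (y - y')
  have hsnd : ‖y.2 - y'.2‖ ≤ ‖y - y'‖ := norm_snd_le (y - y')
  have hB' : ‖(((0 : EuclideanSpace ℝ (Fin N)), -(G.B (n + 1) y - G.B (n + 1) y' -
      G.DB (n + 1) 0 (y.1 - y'.1, 0))) : (W.addFin N).L (n + 1))‖ ≤ ε / 4 * ‖y - y'‖ + ε / 4 * ‖y - y'‖ := by
    rw [Prod.norm_def]
    simp only [norm_zero, norm_neg]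
    refine max_le (by positivity) ?_
    have : G.B (n + 1) y - G.B (n + 1) y' - G.DB (n + 1) 0 (y.1 - y'.1, 0) =
      (G.B (n + 1) (y.1, y.2) - G.B (n + 1) (y.1, y'.2)) + (G.B (n + 1) (y.1, y'.2) - G.B (n + 1) y' -
        G.DB (n + 1) 0 (y.1 - y'.1, 0)) := by
      rw [show ((y.1, y.2) : (W.addFin k).L (n + 1)) = y from rfl]
      abel
    rw [this]
    refine (norm_add_le _ _).trans (add_le_add (b2.trans ?_) (b3.trans ?_)) <;> gcongr
  have hsum : G.F (n + 1) y (h.1 (n + 1)) - G.F (n + 1) y' (h.1 (n + 1)) - G.T.map (n + 1) (y - y') =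
      (((0 : EuclideanSpace ℝ (Fin N)), -(G.B (n + 1) y - G.B (n + 1) y' -
      G.DB (n + 1) 0 (y.1 - y'.1, 0))) : (W.addFin N).L (n + 1)) +
      ((W.addFin N).incl (n + 1) (G.S (n + 1) y) - (W.addFin N).incl (n + 1) (G.S (n + 1) y') -
        G.DS n 0 ((W.addFin k).incl n (y - y'))) -
      (G.κ (n + 1) (y, h.1 (n + 1)) - G.κ (n + 1) (y', h.1 (n + 1))) := by
    rw [T_succ_apply, F, F]
    have : (((0 : EuclideanSpace ℝ (Fin N)), -(G.B (n + 1) y - G.B (n + 1) y' -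
      G.DB (n + 1) 0 (y.1 - y'.1, 0))) : (W.addFin N).L (n + 1)) =
      ((0, y.2 - G.B (n + 1) y) : (W.addFin N).L (n + 1)) - ((0, y'.2 - G.B (n + 1) y')) -
      ((0, (y - y').2 - G.DB (n + 1) 0 ((y - y').1, 0))) := by
      refine Prod.ext (by simp) ?_
      show -(G.B (n + 1) y - G.B (n + 1) y' - G.DB (n + 1) 0 (y.1 - y'.1, 0)) =
        y.2 - G.B (n + 1) y - (y'.2 - G.B (n + 1) y') -
        ((y.2 - y'.2) - G.DB (n + 1) 0 (y.1 - y'.1, 0))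
      abel
    rw [this]
    abel
  rw [hsum]
  refine (norm_sub_le _ _).trans ((add_le_add (norm_add_le _ _) b4).trans ?_)
  calc _ ≤ (ε / 4 * ‖y - y'‖ + ε / 4 * ‖y - y'‖) + ε / 4 * ‖y - y'‖ + ε / 4 * ‖y - y'‖ := by
        gcongr
        exact b1
    _ = ε * ‖y - y'‖ := by ring

/-- Differentiability of the germ at `0` in the norm of a positive level. -/
theorem deriv_F (n : ℕ) {ε : ℝ} (hε : 0 < ε) : ∃ δ > 0, ∃ C > 0, ∀ v ∈ (W.addFin k).lev G.V (n + 1),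
    ‖v‖ < δ → ∀ h : H.L (n + 1),
    ‖G.F (n + 1) v h - G.T.map (n + 1) v‖ ≤ ε * ‖v‖ + C * ‖h‖ := by
  have hε4 : 0 < ε / 4 := by positivity
  obtain ⟨δ₁, hδ₁, hS⟩ := G.hS.strict G.relOpen 0 G.zero_mem n hε4
  obtain ⟨δ₂, hδ₂, hB⟩ := G.hB.strict G.relOpen 0 G.zero_mem (n + 1) hε4
  obtain ⟨δ₃, hδ₃, hc⟩ := G.contr (n + 1) _ hε4
  obtain ⟨δ₄, hδ₄, hball⟩ := G.relOpen.ball (m := n + 2) (v₀ := 0) (G.zero_mem_lev (n + 2))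
  obtain ⟨δ₅, hδ₅, hκ⟩ := Metric.continuousOn_iff.1 (G.hκ.cont.1 (n + 1)) (0, 0)
    (mem_lev_prod.2 ⟨G.zero_mem_lev _, mem_univ _⟩) 1 one_pos
  obtain ⟨δ, hδ, l₁, l₂, l₃, l₄, l₅⟩ : ∃ δ > 0, δ ≤ δ₁ ∧ δ ≤ δ₂ ∧ δ ≤ δ₃ ∧ δ ≤ δ₄ ∧ δ ≤ δ₅ :=
    ⟨min δ₁ (min δ₂ (min δ₃ (min δ₄ δ₅))), by positivity, by simp, by simp, by simp, by simp, by simp⟩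
  refine ⟨δ, hδ, 2 / δ * 1, by positivity, fun v hv hvd h => ?_⟩
  have b1 := hS v hv 0 (G.zero_mem_lev _) (by simpa using hvd.trans_le l₁) (by simpa using hδ₁)
  rw [← G.incl_S n hv, map_zero, G.S_zero', sub_zero, sub_zero] at b1
  -- With `0` as the second point, the intermediate point `(v.1, 0)` lies on every level, so
  -- smallness of `v` on level `n + 1` suffices here.
  have hv0 : ((v.1, 0) : (W.addFin k).L (n + 2)) ∈ (W.addFin k).lev G.V (n + 2) := by
    refine hball _ ?_ ?_
    · have h2 : v ∈ (W.addFin k).lev (stdQuadrant W k d) (n + 1) := G.relOpen.subset hv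
      rw [mem_lev_stdQuadrant] at h2 ⊢
      exact h2
    · rw [sub_zero, Prod.norm_def]
      exact max_lt ((norm_fst_le v).trans_lt (hvd.trans_le l₄)) (by simpa using hδ₄)
  have e3 : (W.addFin k).incl (n + 1) ((v.1, 0) : (W.addFin k).L (n + 2)) = (v.1, 0) :=
    Prod.ext rfl (map_zero (W.incl (n + 1)))
  have hv0' : ((v.1, 0) : (W.addFin k).L (n + 1)) ∈ (W.addFin k).lev G.V (n + 1) := by
    rw [← e3]; exact hv0
  have e2 : ‖((v.1, 0) : (W.addFin k).L (n + 2))‖ = ‖v.1‖ := by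
    rw [Prod.norm_def]; simp
  have b2 := hc v.1 v.2 0 hv hv0' ((norm_fst_le v).trans_lt (hvd.trans_le l₃))
    ((norm_snd_le v).trans_lt (hvd.trans_le l₃)) (by simpa using hδ₃)
  have b3 := hB _ hv0 0 (G.zero_mem_lev _) (by
    show ‖((v.1, 0) : (W.addFin k).L (n + 2)) - 0‖ < δ₂
    rw [sub_zero, e2]
    exact (norm_fst_le v).trans_lt (hvd.trans_le l₂)) (by simpa using hδ₂)
  rw [map_zero, G.B_zero', sub_zero, sub_zero, e3, e2] at b3
  -- Continuity of `κ` at the origin and linearity in `h` give a bound linear in `h`, without any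
  -- smallness of `h`.
  have b4 : ‖G.κ (n + 1) (v, h)‖ ≤ 2 / δ * 1 * ‖h‖ := by
    have hl := fibre_isLinear G.hκ.cont G.κ_lin (m := n + 1) hv
    refine bound_of_homogeneous (A := H.L (n + 1)) (n := fun h => ‖h‖)
      (N := fun h => ‖G.κ (n + 1) (v, h)‖) hδ (fun c h => norm_smul c h)
      (fun c h => by rw [hl.map_smul, norm_smul, Real.norm_eq_abs]) (fun h => norm_nonneg h) ?_ h
    intro h hh
    have := hκ (v, h) (mem_lev_prod.2 ⟨hv, mem_univ _⟩) (by
      rw [Prod.dist_eq, dist_zero_right, dist_zero_right]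
      exact max_lt (hvd.trans_le l₅) (hh.trans_le l₅))
    have h0 : G.κ (n + 1) (0, 0) = 0 :=
      (fibre_isLinear G.hκ.cont G.κ_lin (m := n + 1) (G.zero_mem_lev _)).map_zero
    rw [h0, dist_zero_right] at this
    exact this.le
  have hfst : ‖v.1‖ ≤ ‖v‖ := norm_fst_le v
  have hsnd : ‖v.2‖ ≤ ‖v‖ := norm_snd_le v
  have hB' : ‖(((0 : EuclideanSpace ℝ (Fin N)), -(G.B (n + 1) v - G.DB (n + 1) 0 (v.1, 0))) :
      (W.addFin N).L (n + 1))‖ ≤ ε / 4 * ‖v‖ + ε / 4 * ‖v‖ := by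
    rw [Prod.norm_def]
    simp only [norm_zero, norm_neg]
    refine max_le (by positivity) ?_
    have : G.B (n + 1) v - G.DB (n + 1) 0 (v.1, 0) =
      (G.B (n + 1) (v.1, v.2) - G.B (n + 1) (v.1, 0)) + (G.B (n + 1) (v.1, 0) -
        G.DB (n + 1) 0 (v.1, 0)) := by
      rw [show ((v.1, v.2) : (W.addFin k).L (n + 1)) = v from rfl]
      abel
    rw [this]
    refine (norm_add_le _ _).trans (add_le_add (b2.trans ?_) (b3.trans ?_))
    · rw [sub_zero]; gcongr
    · gcongr
  have hsum : G.F (n + 1) v h - G.T.map (n + 1) v =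
      (((0 : EuclideanSpace ℝ (Fin N)), -(G.B (n + 1) v - G.DB (n + 1) 0 (v.1, 0))) :
        (W.addFin N).L (n + 1)) +
      ((W.addFin N).incl (n + 1) (G.S (n + 1) v) - G.DS n 0 ((W.addFin k).incl n v)) -
      G.κ (n + 1) (v, h) := by
    rw [T_succ_apply, F]
    have : (((0 : EuclideanSpace ℝ (Fin N)), -(G.B (n + 1) v - G.DB (n + 1) 0 (v.1, 0))) :
        (W.addFin N).L (n + 1)) =
      ((0, v.2 - G.B (n + 1) v) : (W.addFin N).L (n + 1)) -
      ((0, v.2 - G.DB (n + 1) 0 (v.1, 0))) := by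
      refine Prod.ext (by simp) ?_
      show -(G.B (n + 1) v - G.DB (n + 1) 0 (v.1, 0)) =
        v.2 - G.B (n + 1) v - (v.2 - G.DB (n + 1) 0 (v.1, 0))
      abel
    rw [this]
    abel
  rw [hsum]
  refine (norm_sub_le _ _).trans ((add_le_add (norm_add_le _ _) b4).trans ?_)
  have b1' : ‖(W.addFin N).incl (n + 1) (G.S (n + 1) v) - G.DS n 0 ((W.addFin k).incl n v)‖ ≤
    ε / 4 * ‖v‖ := b1
  calc _ ≤ (ε / 4 * ‖v‖ + ε / 4 * ‖v‖) + ε / 4 * ‖v‖ + 2 / δ * 1 * ‖h‖ := by gcongr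
    _ ≤ ε * ‖v‖ + 2 / δ * 1 * ‖h‖ := by nlinarith [norm_nonneg v]

end Germ

/-! ### Nearby linearizations and Newton iteration -/

namespace Germ

variable {W H : ScSpace.{u}} {k N d : ℕ} (G : Germ W H k N d)

theorem isDir_of_nonneg {v X : (W.addFin k).Smooth} (hv : v.1 0 ∈ G.V)
    (hX : ∀ j, 0 ≤ (X.1 0).1 j) : IsDir G.V v X := by
  refine isDir_of_relOpen G.relOpen hv ?_
  filter_upwards [self_mem_nhdsWithin] with t ht j hj
  exact add_nonneg (G.relOpen.subset hv j hj) (mul_nonneg (le_of_lt ht) (hX j))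

/-- The linearizations of the germ at smooth points converge in the operator norm of a positive level, as
the points converge on the next level. -/
theorem linearization_near (n : ℕ) {ε : ℝ} (hε : 0 < ε) : ∃ δ > 0, ∀ v : (W.addFin k).Smooth,
    v.1 0 ∈ G.V → ‖v.1 (n + 2)‖ < δ → ∀ h : H.Smooth, ‖h.1 (n + 2)‖ < δ →
    ∀ A : (W.addFin k).L (n + 1) →L[ℝ] (W.addFin N).L (n + 1),
    (∀ X, IsDir G.V v X → HasDerivWithinAt
      (fun t : ℝ => G.F (n + 1) ((v + t • X).1 (n + 1)) (h.1 (n + 1))) (A (X.1 (n + 1))) (Ici 0) 0) →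
    ∀ x, ‖A x - G.T.map (n + 1) x‖ ≤ ε * ‖x‖ := by
  -- The factor `M` pays for writing a vector `X` as the difference of `X + r • oneVec` and `r •
  -- oneVec`, with `r = ‖X‖`.
  set M := 1 + 2 * ‖(oneVec W k).1 (n + 1)‖ with hM
  have hMpos : 0 < M := by positivity
  obtain ⟨δ, hδ, hF⟩ := G.strict_F n (ε := ε / M) (by positivity)
  refine ⟨δ, hδ, fun v hv hvd h hh A hA => ?_⟩
  -- directions that stay in the domain
  have h1 : ∀ X, IsDir G.V v X →
      ‖A (X.1 (n + 1)) - G.T.map (n + 1) (X.1 (n + 1))‖ ≤ ε / M * ‖X.1 (n + 1)‖ := by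
    intro X hX
    refine norm_sub_le_of_hasDerivWithinAt (hA X hX) ?_
    have hcont : Filter.Tendsto (fun t : ℝ => ‖(v + t • X).1 (n + 2)‖) (𝓝[>] 0) (𝓝 ‖v.1 (n + 2)‖) := by
      have : Continuous (fun t : ℝ => ‖v.1 (n + 2) + t • X.1 (n + 2)‖) := by fun_prop
      simpa using (this.tendsto 0).mono_left nhdsWithin_le_nhds
    filter_upwards [hX, hcont.eventually (gt_mem_nhds hvd), self_mem_nhdsWithin] with t ht htd ht0
    have ht0 : 0 < t := ht0
    have := hF _ (smooth_mem_lev.2 ht) _ (smooth_mem_lev.2 hv) htd hvd h hh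
    rw [(v + t • X).2, v.2] at this
    have e1 : (W.addFin k).incl (n + 1) ((v + t • X).1 (n + 2) - v.1 (n + 2)) = t • X.1 (n + 1) := by
      rw [map_sub, (v + t • X).2, v.2]
      show v.1 (n + 1) + t • X.1 (n + 1) - v.1 (n + 1) = _
      abel
    rw [e1, map_smul, norm_smul, Real.norm_of_nonneg ht0.le] at this
    simp only [zero_smul, add_zero]
    calc _ ≤ _ := this
      _ = _ := by ring
  intro x
  have key : ∀ X : (W.addFin k).Smooth, ‖(A - G.T.map (n + 1)) (X.1 (n + 1))‖ ≤ ε * ‖X.1 (n + 1)‖ := by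
    intro X
    set r := ‖X.1 (n + 1)‖ with hr
    -- Adding `‖X‖` to every finite-dimensional coordinate makes all of them nonnegative.
    have hX : IsDir G.V v (X + r • oneVec W k) := G.isDir_of_nonneg hv fun j => by
      have e1 : (((X + r • oneVec W k).1 0).1) j = (X.1 0).1 j + r := by
        show (X.1 0).1 j + r * ((oneVec W k).1 0).1 j = _
        simp [oneVec]
      rw [e1, ← smooth_fin_fst X (n + 1)]
      have h2 : |(X.1 (n + 1)).1 j| ≤ r := by
        have a1 := EuclideanSpace.norm_eq (X.1 (n + 1)).1
        have a2 := PiLp.norm_apply_le (p := 2) (X.1 (n + 1)).1 j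
        exact (Real.norm_eq_abs _ ▸ a2).trans (norm_fst_le (X.1 (n + 1)))
      linarith [neg_le_of_abs_le h2]
    have h2 := h1 _ hX
    have h3 := h1 _ (G.isDir_of_nonneg hv (X := oneVec W k) fun j => by simp [oneVec])
    set o := (oneVec W k).1 (n + 1) with ho
    have e0 : X.1 (n + 1) = (X + r • oneVec W k).1 (n + 1) - r • o := by
      show X.1 (n + 1) = (X.1 (n + 1) + r • o) - r • o
      abel
    have e2 : (A - G.T.map (n + 1)) (X.1 (n + 1)) =
        (A ((X + r • oneVec W k).1 (n + 1)) - G.T.map (n + 1) ((X + r • oneVec W k).1 (n + 1))) -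
        r • (A o - G.T.map (n + 1) o) := by
      conv_lhs => rw [e0]
      rw [map_sub, map_smul]; rfl
    rw [e2]
    have hr0 : 0 ≤ r := norm_nonneg _
    have h4 : ‖(X + r • oneVec W k).1 (n + 1)‖ ≤ r + r * ‖o‖ := by
      refine (norm_add_le (X.1 (n + 1)) (r • o)).trans ?_
      rw [norm_smul, Real.norm_of_nonneg hr0]
    calc _ ≤ ‖A ((X + r • oneVec W k).1 (n + 1)) - G.T.map (n + 1) ((X + r • oneVec W k).1 (n + 1))‖ +
          ‖r • (A o - G.T.map (n + 1) o)‖ := norm_sub_le _ _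
      _ ≤ ε / M * (r + r * ‖o‖) + r * (ε / M * ‖o‖) := by
        rw [norm_smul, Real.norm_of_nonneg hr0]
        gcongr
        refine h2.trans ?_
        gcongr
      _ = ε / M * M * r := by rw [hM]; ring
      _ = ε * r := by rw [div_mul_cancel₀ _ hMpos.ne']
  exact clm_bound_smooth (A := A - G.T.map (n + 1)) key x

set_option maxHeartbeats 1000000 in
/-- Newton iteration: zeros of the germ near a zero `e`, approximately in the direction of a vector `X`
that points strictly into the quadrant. -/
theorem exists_zeros {Q : ScOp (W.addFin N) (W.addFin k)} (hQ : ∀ m y, G.T.map m (Q.map m y) = y)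
    (n : ℕ) : ∃ δ > 0, ∃ C > 0, ∀ e X : (W.addFin k).Smooth, ∀ h η : H.Smooth, e.1 0 ∈ G.V →
    ‖e.1 (n + 2)‖ < δ → ‖h.1 (n + 2)‖ < δ → ∀ ρ : ℝ,
    (∀ j : Fin k, j.val < d → (e.1 0).1 j = 0 → C * ρ < (X.1 0).1 j) →
    G.F (n + 1) (e.1 (n + 1)) (h.1 (n + 1)) = 0 →
    ∀ a, HasDerivWithinAt (fun t : ℝ =>
      G.F (n + 1) ((e + t • X).1 (n + 1)) ((h + t • η).1 (n + 1))) a (Ici 0) 0 → ‖a‖ < ρ →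
    ∀ᶠ t in 𝓝[>] (0 : ℝ), ∃ v ∈ (W.addFin k).lev G.V (n + 1),
      G.F (n + 1) v ((h + t • η).1 (n + 1)) = 0 ∧ ‖v - (e + t • X).1 (n + 1)‖ ≤ C * ρ * t := by
  set C₁ := ‖Q.map (n + 1)‖ with hC₁
  set C₂ := ‖Q.map (n + 2)‖ with hC₂
  have hC₁0 : 0 ≤ C₁ := norm_nonneg _
  have hC₂0 : 0 ≤ C₂ := norm_nonneg _
  -- The projection onto the kernel of `T` along the image of `Q`. Newton steps lie in the image of
  -- `Q`, so `π` is constant along the iteration.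
  set π : (W.addFin k).L (n + 2) →L[ℝ] (W.addFin k).L (n + 2) := ContinuousLinearMap.id ℝ _ -
    (Q.map (n + 2)).comp (G.T.map (n + 2)) with hπ
  have hπ0 : 0 ≤ ‖π‖ := norm_nonneg _
  -- With this constant each Newton step at least halves the residual on level `n + 1`.
  obtain ⟨δ₁, hδ₁, hB⟩ := G.strict_F n (ε := 1 / (2 * (C₁ + 1))) (by positivity)
  obtain ⟨δ₂, hδ₂, C₃, hC₃, hC⟩ := G.deriv_F (n + 1) (ε := 1 / (4 * (C₂ + 1))) (by positivity)
  obtain ⟨δ₃, hδ₃, hball⟩ := G.relOpen.ball (m := n + 1) (v₀ := 0) (G.zero_mem_lev (n + 1))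
  -- Half of `δ₃`, because the limit only inherits a non-strict bound and must still lie in the open
  -- ball.
  obtain ⟨δ₄, hδ₄, h₄⟩ := (W.addFin k).exists_incl_small (n + 1) (half_pos hδ₃)
  obtain ⟨r, hr, l₁, l₂, l₄⟩ : ∃ r > 0, r ≤ δ₁ ∧ r ≤ δ₂ ∧ r ≤ δ₄ :=
    ⟨min δ₁ (min δ₂ δ₄), by positivity, by simp, by simp, by simp⟩
  -- The quotients keep the contributions of `π (v 0)` and of the parameter to the norm on level `n
  -- + 2` below `r / 4` each. In `2 * C₁ + 1`, the `2 * C₁` bounds the geometric sum of the steps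
  -- and the `1` makes the constant positive.
  refine ⟨min r (min (r / (4 * (‖π‖ + 1))) (r / (4 * (C₂ * C₃ + 1)))), by positivity, 2 * C₁ + 1,
    by positivity, ?_⟩
  intro e X h η he hed hhd ρ hX hF0 a ha haρ
  have hρ : 0 < ρ := (norm_nonneg a).trans_lt haρ
  -- conditions on `t`
  have t1 : ∀ᶠ t in 𝓝[>] (0 : ℝ), ‖(e + t • X).1 (n + 2)‖ <
      min r (min (r / (4 * (‖π‖ + 1))) (r / (4 * (C₂ * C₃ + 1)))) := by
    have : Continuous (fun t : ℝ => ‖e.1 (n + 2) + t • X.1 (n + 2)‖) := by fun_prop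
    exact ((this.tendsto 0).mono_left nhdsWithin_le_nhds).eventually (gt_mem_nhds (by simpa using hed))
  have t2 : ∀ᶠ t in 𝓝[>] (0 : ℝ), ‖(h + t • η).1 (n + 2)‖ <
      min r (min (r / (4 * (‖π‖ + 1))) (r / (4 * (C₂ * C₃ + 1)))) := by
    have : Continuous (fun t : ℝ => ‖h.1 (n + 2) + t • η.1 (n + 2)‖) := by fun_prop
    exact ((this.tendsto 0).mono_left nhdsWithin_le_nhds).eventually (gt_mem_nhds (by simpa using hhd))
  -- The starting point keeps a distance from the faces that is at least the total displacement of
  -- the iteration, so the iterates cannot leave the quadrant.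
  have t3 : ∀ᶠ t in 𝓝[>] (0 : ℝ), ∀ j : Fin k, j.val < d →
      (2 * C₁ + 1) * ρ * t ≤ ((e + t • X).1 0).1 j := by
    simp only [Filter.eventually_all]
    intro j hj
    rcases (G.relOpen.subset he j hj).eq_or_lt with h0 | h0
    · filter_upwards [self_mem_nhdsWithin] with t ht
      show (2 * C₁ + 1) * ρ * t ≤ (e.1 0).1 j + t * (X.1 0).1 j
      rw [← h0, zero_add, mul_comm]
      exact mul_le_mul_of_nonneg_left (hX j hj h0.symm).le (le_of_lt ht)
    · have hc : Continuous (fun t : ℝ => (e.1 0).1 j + t * (X.1 0).1 j - (2 * C₁ + 1) * ρ * t) := by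
        fun_prop
      filter_upwards [((hc.tendsto 0).mono_left nhdsWithin_le_nhds).eventually
        (lt_mem_nhds (by simpa using h0))] with t ht
      exact (sub_pos.1 ht).le
  have t4 := eventually_norm_le_of_hasDerivWithinAt ha (by simpa using hF0) haρ
  filter_upwards [t1, t2, t3, t4, self_mem_nhdsWithin] with t ht1 ht2 ht3 ht4 ht0
  have ht0 : 0 < t := ht0
  set v₀ := (e + t • X) with hv₀
  set b := (h + t • η) with hb
  have hρt : 0 ≤ ρ * t := by positivity
  -- the iteration
  obtain ⟨v, hv0, hvs⟩ : ∃ v : ℕ → (W.addFin k).L (n + 2), v 0 = v₀.1 (n + 2) ∧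
      ∀ i, v (i + 1) = v i - Q.map (n + 2) (G.F (n + 2) (v i) (b.1 (n + 2))) :=
    ⟨fun i => Nat.rec (v₀.1 (n + 2))
      (fun _ v => v - Q.map (n + 2) (G.F (n + 2) v (b.1 (n + 2)))) i, rfl, fun i => rfl⟩
  have hstd : ∀ x : (W.addFin k).L (n + 1), ‖x - v₀.1 (n + 1)‖ ≤ (2 * C₁ + 1) * ρ * t →
      x ∈ (W.addFin k).lev (stdQuadrant W k d) (n + 1) := by
    intro x hx
    refine mem_lev_stdQuadrant.2 fun j hj => ?_
    have h1 := ht3 j hj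
    rw [← smooth_fin_fst v₀ (n + 1)] at h1
    have a2 : ‖(x.1 - (v₀.1 (n + 1)).1) j‖ ≤ ‖x.1 - (v₀.1 (n + 1)).1‖ := PiLp.norm_apply_le (p := 2) _ j
    have a3 : ‖x.1 - (v₀.1 (n + 1)).1‖ ≤ ‖x - v₀.1 (n + 1)‖ := norm_fst_le (x - v₀.1 (n + 1))
    have a4 := neg_le_of_abs_le (Real.norm_eq_abs _ ▸ (a2.trans a3).trans hx)
    have a5 : (x.1 - (v₀.1 (n + 1)).1) j = x.1 j - (v₀.1 (n + 1)).1 j := rfl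
    rw [a5] at a4
    linarith
  -- The iterates are only kept bounded on level `n + 2`, as the estimate of `strict_F` requires;
  -- convergence takes place on level `n + 1`, where the residuals decay geometrically.
  have hinv : ∀ i, v i ∈ (W.addFin k).lev G.V (n + 2) ∧ ‖v i‖ < r ∧
      ‖(W.addFin k).incl (n + 1) (v i) - v₀.1 (n + 1)‖ ≤ 2 * C₁ * (ρ * t) * (1 - (1 / 2) ^ i) ∧
      ‖G.F (n + 1) ((W.addFin k).incl (n + 1) (v i)) (b.1 (n + 1))‖ ≤ ρ * t * (1 / 2) ^ i ∧
      π (v i) = π (v 0) := by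
    intro i
    induction i with
    | zero =>
      have hincl : (W.addFin k).incl (n + 1) (v 0) = v₀.1 (n + 1) := by
        rw [hv0]; exact v₀.2 _
      have hr0 : ‖v 0‖ < r := (hv0 ▸ ht1 : ‖v 0‖ < _).trans_le (min_le_left _ _)
      refine ⟨?_, hr0, ?_, ?_, rfl⟩
      · have h1 := hball (v₀.1 (n + 1)) (hstd _ (by simp; positivity)) (by
          rw [sub_zero, ← hincl]
          exact (h₄ _ (hr0.trans_le l₄)).trans (by linarith))
        rw [← hincl] at h1
        exact h1
      · simp [hincl]
      · rw [hincl]; simpa using ht4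
    | succ i ih =>
      obtain ⟨i1, i2, i3, i4, i5⟩ := ih
      have hpow : (0 : ℝ) < (1 / 2) ^ i := by positivity
      have hpow1 : ((1 : ℝ) / 2) ^ (i + 1) = (1 / 2) ^ i / 2 := by rw [pow_succ]; ring
      have hFi : (W.addFin N).incl (n + 1) (G.F (n + 2) (v i) (b.1 (n + 2))) =
          G.F (n + 1) ((W.addFin k).incl (n + 1) (v i)) (b.1 (n + 1)) := by
        rw [G.incl_F (n + 1) i1, b.2]
      have hd : (W.addFin k).incl (n + 1) (v (i + 1) - v i) =
          -Q.map (n + 1) (G.F (n + 1) ((W.addFin k).incl (n + 1) (v i)) (b.1 (n + 1))) := by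
        rw [hvs, sub_sub_cancel_left, map_neg, Q.comm, hFi]
      have hdn : ‖(W.addFin k).incl (n + 1) (v (i + 1) - v i)‖ ≤ C₁ * (ρ * t * (1 / 2) ^ i) := by
        rw [hd, norm_neg]
        exact (Q.map (n + 1)).le_opNorm_of_le i4
      have j3 : ‖(W.addFin k).incl (n + 1) (v (i + 1)) - v₀.1 (n + 1)‖ ≤
          2 * C₁ * (ρ * t) * (1 - (1 / 2) ^ (i + 1)) := by
        have : (W.addFin k).incl (n + 1) (v (i + 1)) - v₀.1 (n + 1) =
          (W.addFin k).incl (n + 1) (v (i + 1) - v i) + ((W.addFin k).incl (n + 1) (v i) - v₀.1 (n + 1)) := by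
          rw [map_sub]; abel
        rw [this]
        refine (norm_add_le _ _).trans ((add_le_add hdn i3).trans (le_of_eq ?_))
        rw [hpow1]; ring
      have hTT : π (v (i + 1)) = π (v i) := by
        rw [hvs, map_sub]
        have : π (Q.map (n + 2) (G.F (n + 2) (v i) (b.1 (n + 2)))) = 0 := by
          show Q.map (n + 2) _ - Q.map (n + 2) (G.T.map (n + 2) (Q.map (n + 2) _)) = 0
          rw [hQ, sub_self]
        rw [this, sub_zero]
      have j2 : ‖v (i + 1)‖ < r := by
        -- Since `π` is constant along the iteration, the bound on level `n + 2` does not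
        -- accumulate: it involves only `v 0` and the nonlinear remainder at `v i`, estimated by
        -- `deriv_F`.
        have e1 : v (i + 1) = π (v 0) -
            Q.map (n + 2) (G.F (n + 2) (v i) (b.1 (n + 2)) - G.T.map (n + 2) (v i)) := by
          rw [← i5, hvs, map_sub]
          show _ = (v i - Q.map (n + 2) (G.T.map (n + 2) (v i))) - _
          abel
        have b1 : ‖π (v 0)‖ ≤ r / 4 := by
          calc ‖π (v 0)‖ ≤ ‖π‖ * ‖v 0‖ := π.le_opNorm _
            _ ≤ ‖π‖ * (r / (4 * (‖π‖ + 1))) := by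
              gcongr
              exact ((hv0 ▸ ht1 : ‖v 0‖ < _).trans_le ((min_le_right _ _).trans (min_le_left _ _))).le
            _ = r / 4 * (‖π‖ / (‖π‖ + 1)) := by field_simp
            _ ≤ r / 4 * 1 := by
              gcongr
              rw [div_le_one (by positivity)]; linarith
            _ = r / 4 := mul_one _
        have b2 := hC (v i) i1 (i2.trans_le l₂) (b.1 (n + 2))
        have b3 : ‖b.1 (n + 2)‖ ≤ r / (4 * (C₂ * C₃ + 1)) :=
          (ht2.trans_le ((min_le_right _ _).trans (min_le_right _ _))).le
        have b4 : C₂ * (1 / (4 * (C₂ + 1)) * ‖v i‖ + C₃ * ‖b.1 (n + 2)‖) ≤ r / 4 + r / 4 := by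
          have c1 : C₂ * (1 / (4 * (C₂ + 1)) * ‖v i‖) ≤ r / 4 := by
            calc C₂ * (1 / (4 * (C₂ + 1)) * ‖v i‖) ≤ C₂ * (1 / (4 * (C₂ + 1)) * r) := by gcongr
              _ = r / 4 * (C₂ / (C₂ + 1)) := by field_simp
              _ ≤ r / 4 * 1 := by
                gcongr
                rw [div_le_one (by positivity)]; linarith
              _ = r / 4 := mul_one _
          have c2 : C₂ * (C₃ * ‖b.1 (n + 2)‖) ≤ r / 4 := by
            calc C₂ * (C₃ * ‖b.1 (n + 2)‖) ≤ C₂ * (C₃ * (r / (4 * (C₂ * C₃ + 1)))) := by gcongr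
              _ = r / 4 * (C₂ * C₃ / (C₂ * C₃ + 1)) := by field_simp
              _ ≤ r / 4 * 1 := by
                gcongr
                rw [div_le_one (by positivity)]; linarith
              _ = r / 4 := mul_one _
          rw [mul_add]
          exact add_le_add c1 c2
        rw [e1]
        calc _ ≤ ‖π (v 0)‖ + ‖Q.map (n + 2) (G.F (n + 2) (v i) (b.1 (n + 2)) -
              G.T.map (n + 2) (v i))‖ := norm_sub_le _ _
          _ ≤ r / 4 + (r / 4 + r / 4) := by
            gcongr
            exact ((Q.map (n + 2)).le_opNorm_of_le b2).trans b4
          _ < r := by linarith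
      have hle : 2 * C₁ * (ρ * t) * (1 - (1 / 2) ^ (i + 1)) ≤ (2 * C₁ + 1) * ρ * t := by
        have : (0 : ℝ) < (1 / 2) ^ (i + 1) := by positivity
        nlinarith [mul_nonneg hC₁0 hρt, mul_nonneg (mul_nonneg hC₁0 hρt) this.le]
      have j1 : v (i + 1) ∈ (W.addFin k).lev G.V (n + 2) := by
        have := hball ((W.addFin k).incl (n + 1) (v (i + 1))) (hstd _ (j3.trans hle)) (by
          rw [sub_zero]
          exact (h₄ _ (j2.trans_le l₄)).trans (by linarith))
        exact this
      refine ⟨j1, j2, j3, ?_, hTT.trans i5⟩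
      have b1 := hB _ j1 _ i1 (j2.trans_le l₁) (i2.trans_le l₁) b
        ((ht2.trans_le (min_le_left _ _)).trans_le l₁)
      have b2 : G.T.map (n + 1) ((W.addFin k).incl (n + 1) (v (i + 1) - v i)) =
          -G.F (n + 1) ((W.addFin k).incl (n + 1) (v i)) (b.1 (n + 1)) := by
        rw [hd, map_neg, hQ]
      rw [b2, sub_neg_eq_add, sub_add_cancel] at b1
      refine b1.trans ?_
      calc 1 / (2 * (C₁ + 1)) * ‖(W.addFin k).incl (n + 1) (v (i + 1) - v i)‖
          ≤ 1 / (2 * (C₁ + 1)) * (C₁ * (ρ * t * (1 / 2) ^ i)) := by gcongr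
        _ = ρ * t * (1 / 2) ^ (i + 1) * (C₁ / (C₁ + 1)) := by rw [hpow1]; field_simp
        _ ≤ ρ * t * (1 / 2) ^ (i + 1) * 1 := by
          gcongr
          rw [div_le_one (by positivity)]; linarith
        _ = _ := mul_one _
  -- the limit
  have hcau : CauchySeq (fun i => (W.addFin k).incl (n + 1) (v i)) := by
    refine cauchySeq_of_le_geometric (1 / 2) (C₁ * (ρ * t)) (by norm_num) fun i => ?_
    rw [dist_comm, dist_eq_norm, ← map_sub, hvs, sub_sub_cancel_left, map_neg, norm_neg, Q.comm,
      G.incl_F (n + 1) (hinv i).1, b.2, mul_assoc]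
    exact (Q.map (n + 1)).le_opNorm_of_le (hinv i).2.2.2.1
  obtain ⟨z, hz⟩ := cauchySeq_tendsto_of_complete hcau
  have hz1 : ‖z - v₀.1 (n + 1)‖ ≤ (2 * C₁ + 1) * ρ * t := by
    refine le_of_tendsto (hz.sub_const _).norm (Filter.Eventually.of_forall fun i => ?_)
    refine (hinv i).2.2.1.trans ?_
    have : (0 : ℝ) < (1 / 2) ^ i := by positivity
    nlinarith [mul_nonneg hC₁0 hρt, mul_nonneg (mul_nonneg hC₁0 hρt) this.le]
  have hz2 : ‖z‖ ≤ δ₃ / 2 := le_of_tendsto hz.norm (Filter.Eventually.of_forall fun i =>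
    (h₄ _ ((hinv i).2.1.trans_le l₄)).le)
  have hzV : z ∈ (W.addFin k).lev G.V (n + 1) := hball z (hstd z hz1) (by rw [sub_zero]; linarith)
  refine ⟨z, hzV, ?_, hz1⟩
  have h1 : Filter.Tendsto (fun i => G.F (n + 1) ((W.addFin k).incl (n + 1) (v i)) (b.1 (n + 1))) Filter.atTop
      (𝓝 (G.F (n + 1) z (b.1 (n + 1)))) :=
    Filter.Tendsto.comp (G.continuousOn_F (n + 1) (b.1 (n + 1)) z hzV)
      (tendsto_nhdsWithin_iff.2 ⟨hz, Filter.Eventually.of_forall fun i => (hinv i).1⟩)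
  have h2 : Filter.Tendsto (fun i => G.F (n + 1) ((W.addFin k).incl (n + 1) (v i)) (b.1 (n + 1))) Filter.atTop
      (𝓝 0) := by
    refine squeeze_zero_norm (fun i => (hinv i).2.2.2.1) ?_
    simpa using (tendsto_pow_atTop_nhds_zero_of_lt_one (r := (1 / 2 : ℝ)) (by norm_num)
      (by norm_num)).const_mul (ρ * t)
  exact tendsto_nhds_unique h1 h2

end Germ

/-! ### From conjugation to a basic germ to parametrized germs -/

theorem IsRelOpen.preimage {A B : Type*} [TopologicalSpace A] [TopologicalSpace B] {C V : Set A}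
    {U U' : Set B} (hV : IsRelOpen C V) (hU : IsRelOpen U U') {f : A → B} (hf : ContinuousOn f V)
    (hm : MapsTo f V U) : IsRelOpen C {v ∈ V | f v ∈ U'} := by
  obtain ⟨O, hO, rfl⟩ := hU
  obtain ⟨O', hO', rfl⟩ := hV
  obtain ⟨u, hu, h⟩ := continuousOn_iff'.1 hf O hO
  refine ⟨O' ∩ u, hO'.inter hu, ?_⟩
  ext v
  have := Set.ext_iff.1 h v
  simp only [mem_inter_iff, mem_preimage] at this
  constructor
  · rintro ⟨hv, hv'⟩
    exact ⟨hv.1, hv.2, (this.1 ⟨hv'.2, hv⟩).1⟩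
  · rintro ⟨h1, h2, h3⟩
    exact ⟨⟨h1, h2⟩, hm ⟨h1, h2⟩, (this.2 ⟨h3, h1, h2⟩).1⟩

theorem IsRelOpen.inter_right {A : Type*} [TopologicalSpace A] {C U V : Set A} (hU : IsRelOpen C U)
    (hV : V ⊆ C) : IsRelOpen V (U ∩ V) := by
  obtain ⟨O, hO, rfl⟩ := hU
  exact ⟨O, hO, by ext x; exact ⟨fun h => ⟨h.2, h.1.2⟩, fun h => ⟨⟨hV h.1, h.2⟩, h.1⟩⟩⟩

/-- The projection of `ℝᴺ ⊕ W` onto `ℝᴺ`, which gains a level. -/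
noncomputable def finPart (W : ScSpace.{u}) (N : ℕ) : ScOp (W.addFin N) (W.addFin N).shift where
  map m := (ContinuousLinearMap.fst ℝ (EuclideanSpace ℝ (Fin N)) (W.L m)).prod 0
  comm m _ := Prod.ext rfl (map_zero (W.incl (m + 1)))

/-- A smooth point as a smooth point of the shifted scale. -/
def ScSpace.Smooth.shift {E : ScSpace.{u}} (e : E.Smooth) : E.shift.Smooth :=
  ⟨fun j => e.1 (j + 1), fun j => e.2 (j + 1)⟩

/-- Coordinates in which the family `g - q (·, h)` of maps on `U` is given by a germ. -/
structure GermChart {E F H : ScSpace.{u}} (U : Set (E.L 0)) (g : ScFam E F) (q : ScFam (E.prod H) F)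
    (e₀ : E.Smooth) (h₀ : H.Smooth) (W : ScSpace.{u}) (k N d : ℕ) where
  G : Germ W H k N d
  U₁ : Set (E.L 0)
  mem : e₀.1 0 ∈ U₁
  relOpen : IsRelOpen U U₁
  ψ : ScFam E (W.addFin k)
  Dψ : ∀ m, E.L (m + 1) → (E.L m →L[ℝ] (W.addFin k).L m)
  hψ : Sc1 U₁ ψ Dψ
  ψ' : ScFam (W.addFin k) E
  Dψ' : ∀ m, (W.addFin k).L (m + 1) → ((W.addFin k).L m →L[ℝ] E.L m)
  hψ' : Sc1 G.V ψ' Dψ'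
  mapsTo : MapsTo (ψ 0) U₁ G.V
  mapsTo' : MapsTo (ψ' 0) G.V U₁
  left_inv : ∀ x ∈ U₁, ψ' 0 (ψ 0 x) = x
  right_inv : ∀ y ∈ G.V, ψ 0 (ψ' 0 y) = y
  ψ_zero : ψ 0 (e₀.1 0) = 0
  Ψ : ScFam (E.prod F) (W.addFin N)
  DΨ : ∀ m, (E.prod F).L (m + 1) → ((E.prod F).L m →L[ℝ] (W.addFin N).L m)
  hΨ : Sc1 (E := E.prod F) (U₁ ×ˢ univ) Ψ DΨ
  Ψ_lin : ∀ x ∈ U₁, IsLinearMap ℝ (fun h : F.L 0 => Ψ 0 (x, h))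
  Ψ' : ScFam ((W.addFin k).prod (W.addFin N)) F
  hΨ' : IsScContinuous (E := (W.addFin k).prod (W.addFin N)) (G.V ×ˢ univ) Ψ'
  Ψ'_lin : ∀ x ∈ G.V, IsLinearMap ℝ (fun h : (W.addFin N).L 0 => Ψ' 0 (x, h))
  fibre_left_inv : ∀ x ∈ U₁, ∀ h, Ψ' 0 (ψ 0 x, Ψ 0 (x, h)) = h
  fibre_right_inv : ∀ y ∈ G.V, ∀ h, Ψ 0 (ψ' 0 y, Ψ' 0 (y, h)) = h
  F_eq : ∀ v ∈ G.V, ∀ h, G.F 0 v (h - h₀.1 0) = Ψ 0 (ψ' 0 v, g 0 (ψ' 0 v) - q 0 (ψ' 0 v, h))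

/-- With `f = Ψ (g - s₀)` one has `Ψ (g - q h) = f + Ψ (s₀ - q h₀) - Ψ (q (h - h₀))`. The
finite-dimensional component of `f` and the second term gain a level, since `s₀` is a sc⁺-section
and `h₀` is smooth; they form `S`. The last term is `κ`, centred so that `h = h₀` corresponds to
parameter `0`. The choice of `h₀` gives `S 0 = 0`. -/
theorem ConjToBasicGerm.exists_germChart {E F H : ScSpace.{u}} {U₀ U : Set (E.L 0)} {d : ℕ}
    {g : ScFam E F} {e₀ : E.Smooth} (hg : ConjToBasicGerm U₀ d g e₀) (hU : IsRelOpen U₀ U)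
    (he₀ : e₀.1 0 ∈ U) {q : ScFam (E.prod H) F} {Dq} {q₁ : ScFam (E.prod H.shift) F.shift} {Dq₁}
    (hq : Sc1 (E := E.prod H) (U ×ˢ univ) q Dq)
    (hl : ∀ x ∈ U, IsLinearMap ℝ (fun h : H.L 0 => q 0 (x, h)))
    (hq₁ : Sc1 (E := E.prod H.shift) (U ×ˢ univ) q₁ Dq₁)
    (hqq : ∀ x ∈ U, ∀ h : H.L 1, F.incl 0 (q₁ 0 (x, h)) = q 0 (x, H.incl 0 h))
    {h₀ : H.Smooth} (h₀g : q 0 (e₀.1 0, h₀.1 0) = g 0 (e₀.1 0)) :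
    ∃ (W : ScSpace.{u}) (k N : ℕ), Nonempty (GermChart U g q e₀ h₀ W k N d) := by
  obtain ⟨W, k, N, U', V, s₀, ψ, ψ', Ψ, Ψ', f, he, hU', hV, hs₀, hs₀g, hiso, hψ0, hf, hfs, B, hB, hfB,
    hcontr⟩ := hg
  obtain ⟨Ds, hs, -⟩ := hs₀.exists_sc1
  obtain ⟨Dψ, hψ, -⟩ := hiso.smooth.exists_sc1
  obtain ⟨Dψ', hψ', -⟩ := hiso.smooth'.exists_sc1
  obtain ⟨hΨs, hΨl, Ψ₁, hΨ₁s, hΨ₁⟩ := hiso.strong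
  obtain ⟨hΨs', hΨl', -⟩ := hiso.strong'
  obtain ⟨DΨ, hΨ, -⟩ := hΨs.exists_sc1
  obtain ⟨DΨ₁, hΨ₁', -⟩ := hΨ₁s.exists_sc1
  obtain ⟨Df, hf1, -⟩ := hfs.exists_sc1
  obtain ⟨DB, hB1, -⟩ := hB.exists_sc1
  set V₁ : Set ((W.addFin k).L 0) := {v ∈ V | ψ' 0 v ∈ U} with hV₁
  have hVV : V₁ ⊆ V := fun v hv => hv.1
  have hV₁o : IsRelOpen (stdQuadrant W k d) V₁ :=
    hV.preimage hU (hψ'.cont.1 0) fun v hv => hU'.subset (hiso.mapsTo' hv)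
  have hψ'0 : ψ' 0 0 = e₀.1 0 := by rw [← hψ0, hiso.left_inv _ he]
  have h0V : (0 : (W.addFin k).L 0) ∈ V := by rw [← hψ0]; exact hiso.mapsTo he
  have h0V₁ : (0 : (W.addFin k).L 0) ∈ V₁ := ⟨h0V, by rw [hψ'0]; exact he₀⟩
  have hUU : U' ∩ U ⊆ U' := inter_subset_left
  have hm' : MapsTo (ψ' 0) V₁ (U' ∩ U) := fun v hv => ⟨hiso.mapsTo' hv.1, hv.2⟩
  have hm'U : MapsTo (ψ' 0) V₁ U := fun v hv => hv.2
  have hm'U' : MapsTo (ψ' 0) V₁ U' := fun v hv => hiso.mapsTo' hv.1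
  have hψ'1 := hψ'.mono hVV
  have hS := (((Sc1.ofOp (finPart W N) univ).comp (hf1.mono hVV) (fun _ _ => mem_univ _)).add
    (hψ'1.pair hm'U' ((hs.comp hψ'1 hm'U').sub ((hq₁.slice h₀.shift).comp hψ'1 hm'U)) hΨ₁'))
  have hκ := ((hψ'1.comp (Sc1.ofOp (⟨fun m => ContinuousLinearMap.fst ℝ _ _, fun _ _ => rfl⟩ :
    ScOp ((W.addFin k).prod H) (W.addFin k)) (V₁ ×ˢ univ)) fun p hp => hp.1).pair
      (fun p hp => hm'U' hp.1) (hq.comp ((hψ'1.comp (Sc1.ofOp (⟨fun m => ContinuousLinearMap.fst ℝ _ _,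
        fun _ _ => rfl⟩ : ScOp ((W.addFin k).prod H) (W.addFin k)) (V₁ ×ˢ univ)) fun p hp => hp.1).prodMk
        (Sc1.ofOp (⟨fun m => ContinuousLinearMap.snd ℝ _ _, fun _ _ => rfl⟩ :
    ScOp ((W.addFin k).prod H) H) (V₁ ×ˢ univ))) fun p hp => ⟨hm'U hp.1, mem_univ _⟩) hΨ)
  have hf0 : f 0 0 = 0 := by
    rw [hf 0 h0V, hψ'0, hs₀g, sub_self]
    exact (hΨl _ he).map_zero
  have hSincl : ∀ v ∈ V₁, (W.addFin N).incl 0 ((finPart W N).map 0 (f 0 v) +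
      Ψ₁ 0 (ψ' 0 v, s₀ 0 (ψ' 0 v) - q₁ 0 (ψ' 0 v, h₀.1 1))) =
      ((f 0 v).1, 0) + (Ψ 0 (ψ' 0 v, F.incl 0 (s₀ 0 (ψ' 0 v))) -
        Ψ 0 (ψ' 0 v, q 0 (ψ' 0 v, h₀.1 0))) := by
    intro v hv
    rw [map_add, hΨ₁ _ (hm'U' hv), map_sub, hqq _ hv.2, h₀.2]
    refine congrArg₂ (· + ·) (Prod.ext rfl (map_zero (W.incl 0))) ?_
    exact (hΨl _ (hm'U' hv)).map_sub _ _
  refine ⟨W, k, N, ⟨{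
    G := {
      V := V₁
      relOpen := hV₁o
      zero_mem := h0V₁
      B := B
      DB := DB
      hB := hB1.mono hVV
      contr := fun i ε hε => (hcontr i ε hε).imp fun δ h => ⟨h.1, fun c w₁ w₂ h₁ h₂ =>
        h.2 c w₁ w₂ (hVV h₁) (hVV h₂)⟩
      B_zero := by
        have := hfB 0 h0V
        rw [hf0] at this
        have h2 : (0 : W.L 0) = 0 - B 0 0 := this
        rw [zero_sub, eq_comm, neg_eq_zero] at h2
        exact h2
      S := fun m v => (finPart W N).map m (f m v) +
        Ψ₁ m (ψ' m v, s₀ m (ψ' m v) - q₁ m (ψ' m v, h₀.1 (m + 1)))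
      DS := _
      hS := hS
      S_zero := by
        apply (W.addFin N).incl_injective 0
        refine (hSincl 0 h0V₁).trans ?_
        rw [hψ'0, hs₀g, h₀g, sub_self, hf0, map_zero]
        exact add_zero _
      κ := fun m p => Ψ m (ψ' m p.1, q m (ψ' m p.1, p.2))
      Dκ := _
      hκ := hκ
      κ_lin := fun x hx => by
        have h1 := hΨl _ (hm'U' hx)
        have h2 := hl _ hx.2
        exact (h1.mk'.comp h2.mk').isLinear }
    U₁ := U' ∩ U
    mem := ⟨he, he₀⟩
    relOpen := hU'.inter_right hU.subset
    ψ := ψ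
    Dψ := Dψ
    hψ := hψ.mono hUU
    ψ' := ψ'
    Dψ' := Dψ'
    hψ' := hψ'1
    mapsTo := fun x hx => ⟨hiso.mapsTo hx.1, by rw [hiso.left_inv _ hx.1]; exact hx.2⟩
    mapsTo' := hm'
    left_inv := fun x hx => hiso.left_inv x hx.1
    right_inv := fun x hx => hiso.right_inv x hx.1
    ψ_zero := hψ0
    Ψ := Ψ
    DΨ := DΨ
    hΨ := hΨ.mono (prod_mono hUU subset_rfl)
    Ψ_lin := fun x hx => hΨl x hx.1
    Ψ' := Ψ'
    hΨ' := (hΨs' 0).mono (prod_mono hVV subset_rfl)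
    Ψ'_lin := fun x hx => hΨl' x hx.1
    fibre_left_inv := fun x hx => hiso.fibre_left_inv x hx.1
    fibre_right_inv := fun x hx => hiso.fibre_right_inv x hx.1
    F_eq := ?_ }⟩⟩
  intro v hv h
  have hlin := hΨl _ (hm'U' hv)
  have h1 := hfB v hv.1
  show ((0, v.2 - B 0 v) : (W.addFin N).L 0) + (W.addFin N).incl 0 _ - Ψ 0 (ψ' 0 v, q 0 (ψ' 0 v,
    h - h₀.1 0)) = _
  have e1 : q 0 (ψ' 0 v, h - h₀.1 0) = q 0 (ψ' 0 v, h) - q 0 (ψ' 0 v, h₀.1 0) :=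
    (hl _ hv.2).map_sub h (h₀.1 0)
  have e2 : f 0 v = Ψ 0 (ψ' 0 v, g 0 (ψ' 0 v)) - Ψ 0 (ψ' 0 v, F.incl 0 (s₀ 0 (ψ' 0 v))) :=
    (hf v hv.1).trans (hlin.map_sub _ _)
  have e3 : f 0 v = ((f 0 v).1, 0) + (0, v.2 - B 0 v) := by
    rw [← h1]; exact Prod.ext (add_zero _).symm (zero_add _).symm
  rw [hSincl v hv, e1, hlin.map_sub (q 0 (ψ' 0 v, h)), hlin.map_sub (g 0 (ψ' 0 v))]
  rw [e2] at e3
  have e4 : (((f 0 v).1, 0) : (W.addFin N).L 0) = Ψ 0 (ψ' 0 v, g 0 (ψ' 0 v)) -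
    Ψ 0 (ψ' 0 v, F.incl 0 (s₀ 0 (ψ' 0 v))) - (0, v.2 - B 0 v) := by
    rw [← e2]
    exact Prod.ext (sub_zero _).symm (by
      show (0 : W.L 0) = (f 0 v).2 - (v.2 - B 0 v)
      rw [h1, sub_self])
  rw [e4]
  abel

theorem nonneg_of_hasDerivWithinAt {φ : ℝ → ℝ} {a : ℝ} (h : HasDerivWithinAt φ a (Ici 0) 0)
    (h0 : φ 0 = 0) (hφ : ∀ᶠ t in 𝓝[>] (0 : ℝ), 0 ≤ φ t) : 0 ≤ a := by
  have h1 := (hasDerivWithinAt_iff_tendsto_slope.1 h)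
  rw [Ici_sdiff_left] at h1
  refine ge_of_tendsto h1 ?_
  filter_upwards [hφ, self_mem_nhdsWithin] with t ht ht0
  have ht0 : 0 < t := ht0
  rw [slope_def_module, sub_zero, h0, sub_zero]
  exact mul_nonneg (inv_nonneg.2 ht0.le) ht

/-! ### Tangent vectors to the zeros of the germs -/

namespace Germ

variable {W H : ScSpace.{u}} {k N d : ℕ} (G : Germ W H k N d)

theorem isDir_of_pos {v X : (W.addFin k).Smooth} (hv : v.1 0 ∈ G.V)
    (hX : ∀ j : Fin k, j.val < d → (v.1 0).1 j = 0 → 0 < (X.1 0).1 j) : IsDir G.V v X :=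
  isDir_of_relOpen G.relOpen hv (inward_stdQuadrant (G.relOpen.subset hv) hX).isDir

theorem down_F (m : ℕ) {v : (W.addFin k).L m} (hv : v ∈ (W.addFin k).lev G.V m) (h : H.L m) :
    (W.addFin N).down m (G.F m v h) = G.F 0 ((W.addFin k).down m v) (H.down m h) := by
  induction m with
  | zero => rfl
  | succ m ih =>
    rw [down_succ, G.incl_F m hv]
    exact ih (mem_lev_succ.1 hv) _

/-- A map that vanishes at the zeros of the germs for all values of the parameter has vanishing derivative
in the directions annihilated by the linearization, provided these point strictly into the quadrant. -/
theorem deriv_eq_zero {Q : ScOp (W.addFin N) (W.addFin k)} (hQ : ∀ m y, G.T.map m (Q.map m y) = y)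
    (n : ℕ) : ∃ δ > 0, ∀ e : (W.addFin k).Smooth, ∀ h : H.Smooth, e.1 0 ∈ G.V →
    ‖e.1 (n + 2)‖ < δ → ‖h.1 (n + 2)‖ < δ → G.F (n + 1) (e.1 (n + 1)) (h.1 (n + 1)) = 0 →
    ∀ A : ((W.addFin k).prod H).L (n + 1) →L[ℝ] (W.addFin N).L (n + 1),
    (∀ X : (W.addFin k).Smooth, ∀ η : H.Smooth, IsDir G.V e X → HasDerivWithinAt
      (fun t : ℝ => G.F (n + 1) ((e + t • X).1 (n + 1)) ((h + t • η).1 (n + 1)))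
        (A (X.1 (n + 1), η.1 (n + 1))) (Ici 0) 0) →
    ∀ (E' : ScSpace.{u}) (R : ScFam (W.addFin k) E') (DR : _), Sc1 G.V R DR →
    (∀ v ∈ G.V, ∀ h, G.F 0 v h = 0 → R 0 v = 0) →
    ∀ X η, A (X, η) = 0 → (∀ j : Fin k, j.val < d → (e.1 0).1 j = 0 → 0 < X.1 j) →
    DR n (e.1 (n + 1)) ((W.addFin k).incl n X) = 0 := by
  obtain ⟨δ, hδ, C, hC, hz⟩ := G.exists_zeros hQ n
  refine ⟨δ, hδ, fun e h he hed hhd hF A hA E' R DR hR hR0 X η hAX hX => ?_⟩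
  -- a lower bound for the relevant coordinates of `X`
  obtain ⟨c, hc, hcX⟩ : ∃ c > 0, ∀ j : Fin k, j.val < d → (e.1 0).1 j = 0 → 2 * c < X.1 j := by
    have : ∀ᶠ c in 𝓝[>] (0 : ℝ), ∀ j : Fin k, j.val < d → (e.1 0).1 j = 0 → 2 * c < X.1 j := by
      simp only [Filter.eventually_all]
      intro j hj hj0
      have hc : Continuous (fun c : ℝ => 2 * c) := by fun_prop
      exact ((hc.tendsto 0).mono_left nhdsWithin_le_nhds).eventually
        (gt_mem_nhds (by simpa using hX j hj hj0))
    obtain ⟨c, hc, h⟩ := (this.and self_mem_nhdsWithin).exists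
    exact ⟨c, h, hc⟩
  set L : (W.addFin k).L (n + 1) →L[ℝ] E'.L n := (DR n (e.1 (n + 1))).comp ((W.addFin k).incl n) with hL
  -- It collects the errors below: strict differentiability of `R`, the distance of the zero from
  -- the ray, and the replacement of `X` by a smooth vector.
  set K := ‖L‖ * (C + 1) + (‖X‖ + c + C) with hK
  have hK0 : 0 ≤ K := by positivity
  have hR0' : ∀ v ∈ (W.addFin k).lev G.V (n + 1), ∀ h, G.F (n + 1) v h = 0 →
      R n ((W.addFin k).incl n v) = 0 := by
    intro v hv h hvh
    apply down_injective n
    rw [hR.cont.down (mem_lev_succ.1 hv), map_zero]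
    refine hR0 _ hv (H.down (n + 1) h) ?_
    have := G.down_F (n + 1) hv h
    rw [hvh, map_zero] at this
    exact this.symm
  -- Replace `(X, η)` by a smooth pair within `ρ` whose image under `A` has norm below `ρ`. Newton
  -- iteration yields a zero within `C * ρ * t` of the ray from `e`. As `R` vanishes there and at
  -- `e`, its derivative on the difference is small compared with `t`; dividing by `t` leaves a
  -- multiple of `ρ`.
  have key : ∀ᶠ ρ in 𝓝[>] (0 : ℝ), ‖L X‖ ≤ K * ρ := by
    have hρ1 : ∀ᶠ ρ in 𝓝[>] (0 : ℝ), C * ρ < c ∧ ρ < c ∧ ρ < 1 := by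
      have h1 : Continuous (fun ρ : ℝ => C * ρ) := by fun_prop
      refine Filter.Eventually.and (((h1.tendsto 0).mono_left nhdsWithin_le_nhds).eventually
        (gt_mem_nhds (by simpa using hc))) ?_
      exact Filter.Eventually.and (nhdsWithin_le_nhds (gt_mem_nhds hc))
        (nhdsWithin_le_nhds (gt_mem_nhds one_pos))
    filter_upwards [hρ1, self_mem_nhdsWithin] with ρ ⟨hCρ, hρc, hρ1⟩ hρ
    have hρ : 0 < ρ := hρ
    obtain ⟨δ', hδ', hcont⟩ := Metric.continuousAt_iff.1 (A.continuous.continuousAt (x := (X, η))) ρ hρ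
    obtain ⟨p, hp⟩ := ((W.addFin k).prod H).dense_smooth (n + 1) (X, η) (lt_min hδ' hρ)
    have hp1 : ‖A (p.1 (n + 1))‖ < ρ := by
      have := hcont (x := p.1 (n + 1)) (by
        rw [dist_eq_norm]; exact hp.trans_le (min_le_left _ _))
      rwa [hAX, dist_zero_right] at this
    set X' : (W.addFin k).Smooth := ⟨fun j => (p.1 j).1, fun j => congrArg Prod.fst (p.2 j)⟩ with hX'
    set η' : H.Smooth := ⟨fun j => (p.1 j).2, fun j => congrArg Prod.snd (p.2 j)⟩ with hη'
    have hX'X : ‖X'.1 (n + 1) - X‖ < ρ :=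
      (norm_fst_le (p.1 (n + 1) - (X, η))).trans_lt (hp.trans_le (min_le_right _ _))
    have hX'j : ∀ j : Fin k, j.val < d → (e.1 0).1 j = 0 → C * ρ < (X'.1 0).1 j := by
      intro j hj hj0
      have h1 := hcX j hj hj0
      rw [← smooth_fin_fst X' (n + 1)]
      have a2 : ‖((X'.1 (n + 1)).1 - X.1) j‖ ≤ ‖(X'.1 (n + 1)).1 - X.1‖ := PiLp.norm_apply_le (p := 2) _ j
      have a3 : ‖(X'.1 (n + 1)).1 - X.1‖ ≤ ‖X'.1 (n + 1) - X‖ := norm_fst_le (X'.1 (n + 1) - X)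
      have a4 := neg_le_of_abs_le (Real.norm_eq_abs _ ▸ (a2.trans a3).trans hX'X.le)
      have a5 : ((X'.1 (n + 1)).1 - X.1) j = (X'.1 (n + 1)).1 j - X.1 j := rfl
      rw [a5] at a4
      linarith
    have hdir : IsDir G.V e X' := G.isDir_of_pos he fun j hj hj0 =>
      (mul_pos hC hρ).trans (hX'j j hj hj0)
    have hzt := hz e X' h η' he hed hhd ρ hX'j hF _ (hA X' η' hdir) hp1
    obtain ⟨δ₂, hδ₂, hst⟩ := hR.strict G.relOpen e he n hρ
    have htend : ∀ᶠ t in 𝓝[>] (0 : ℝ), t * ‖X'.1 (n + 1)‖ + C * ρ * t < δ₂ := by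
      have h1 : Continuous (fun t : ℝ => t * ‖X'.1 (n + 1)‖ + C * ρ * t) := by fun_prop
      exact ((h1.tendsto 0).mono_left nhdsWithin_le_nhds).eventually
        (gt_mem_nhds (by simpa using hδ₂))
    obtain ⟨t, ⟨v, hv, hvF, hvt⟩, htt, ht⟩ := (hzt.and (htend.and self_mem_nhdsWithin)).exists
    have ht : 0 < t := ht
    have hve : v - e.1 (n + 1) = (v - (e + t • X').1 (n + 1)) + t • X'.1 (n + 1) := by
      show _ = (v - (e.1 (n + 1) + t • X'.1 (n + 1))) + t • X'.1 (n + 1)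
      abel
    have hven : ‖v - e.1 (n + 1)‖ ≤ t * ‖X'.1 (n + 1)‖ + C * ρ * t := by
      rw [hve]
      refine (norm_add_le _ _).trans ((add_le_add hvt le_rfl).trans (le_of_eq ?_))
      rw [norm_smul, Real.norm_of_nonneg ht.le]
      ring
    have h1 := hst v hv (e.1 (n + 1)) (smooth_mem_lev.2 he) (hven.trans_lt htt) (by simpa using hδ₂)
    rw [hR0' v hv _ hvF, hR0' (e.1 (n + 1)) (smooth_mem_lev.2 he) _ hF, sub_zero, zero_sub, norm_neg] at h1
    have h1 : ‖L (v - e.1 (n + 1))‖ ≤ ρ * ‖v - e.1 (n + 1)‖ := h1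
    have h2 : t • L X = L (v - e.1 (n + 1)) - L (v - (e + t • X').1 (n + 1)) -
        t • L (X'.1 (n + 1) - X) := by
      rw [hve, map_add, map_smul, map_sub L (X'.1 (n + 1)), smul_sub]
      abel
    have hX'n : ‖X'.1 (n + 1)‖ ≤ ‖X‖ + c := by
      have : X'.1 (n + 1) = X + (X'.1 (n + 1) - X) := by abel
      rw [this]
      exact (norm_add_le _ _).trans (by linarith)
    have h3 : t * ‖L X‖ ≤ t * (K * ρ) := by
      calc t * ‖L X‖ = ‖t • L X‖ := by rw [norm_smul, Real.norm_of_nonneg ht.le]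
        _ ≤ ‖L (v - e.1 (n + 1))‖ + ‖L (v - (e + t • X').1 (n + 1))‖ + ‖t • L (X'.1 (n + 1) - X)‖ := by
          rw [h2]
          exact (norm_sub_le _ _).trans (add_le_add (norm_sub_le _ _) le_rfl)
        _ ≤ ρ * (t * (‖X‖ + c) + C * 1 * t) + ‖L‖ * (C * ρ * t) + t * (‖L‖ * ρ) := by
          refine add_le_add (add_le_add (h1.trans ?_) (L.le_opNorm_of_le hvt)) ?_
          · gcongr
            refine hven.trans ?_
            gcongr
          · rw [norm_smul, Real.norm_of_nonneg ht.le]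
            gcongr
            exact L.le_opNorm_of_le hX'X.le
        _ = t * (K * ρ) := by rw [hK]; ring
    exact le_of_mul_le_mul_left h3 ht
  have h0 : ‖L X‖ ≤ 0 := by
    have hcont : Continuous (fun ρ : ℝ => K * ρ) := by fun_prop
    have : Filter.Tendsto (fun ρ : ℝ => K * ρ) (𝓝[>] 0) (𝓝 0) := by
      simpa using (hcont.tendsto 0).mono_left nhdsWithin_le_nhds
    exact ge_of_tendsto this key
  exact norm_le_zero_iff.1 h0

end Germ

/-! ### Linearization of the family `g - q (·, h)` -/

section FamilyLinearization

variable {E F H : ScSpace.{u}} {U : Set (E.L 0)} {q : ScFam (E.prod H) F} {Dq}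

/-- The pair of two smooth points. -/
def ScSpace.Smooth.pair (e : E.Smooth) (h : H.Smooth) : (E.prod H).Smooth :=
  ⟨fun j => (e.1 j, h.1 j), fun j => Prod.ext (e.2 j) (h.2 j)⟩

/-- Over a fixed base point `q` is linear, so it equals its derivative in the fibre direction at
every `h`, not just at `h = 0`. -/
theorem Sc1.fibre_snd (hq : Sc1 (E := E.prod H) (U ×ˢ univ) q Dq)
    (hl : ∀ x ∈ U, IsLinearMap ℝ (fun h : H.L 0 => q 0 (x, h))) {e : E.Smooth}
    (he : e.1 0 ∈ U) (h : H.Smooth) (m : ℕ) (Y : H.L m) :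
    Dq m (e.1 (m + 1), h.1 (m + 1)) (0, Y) = q m (e.1 m, Y) := by
  have h2 : ((Dq m (e.1 (m + 1), h.1 (m + 1))).comp (ContinuousLinearMap.inr ℝ (E.L m) (H.L m))) =
      (fibreOp hq.cont hl e he).map m := by
    refine clm_ext_smooth fun Y => ?_
    have h3 := hq.hasDerivWithinAt_dir (e := e.pair h) (X := Smooth.pair 0 Y) ⟨he, mem_univ _⟩
      (Filter.Eventually.of_forall fun t => ⟨by
        show e.1 0 + t • (0 : E.L 0) ∈ U
        simpa using he, mem_univ _⟩) m
    have h4 : HasDerivAt (fun t : ℝ => q m (e.1 m, h.1 m) + t • q m (e.1 m, Y.1 m))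
        ((1 : ℝ) • q m (e.1 m, Y.1 m)) 0 :=
      ((hasDerivAt_id (0 : ℝ)).smul_const _).const_add _
    rw [one_smul] at h4
    have hlin := fibre_isLinear hq.cont hl (m := m) (smooth_mem_lev.2 he)
    have h5 : ∀ t : ℝ, q m ((e.pair h + t • Smooth.pair 0 Y).1 m) =
        q m (e.1 m, h.1 m) + t • q m (e.1 m, Y.1 m) := fun t => by
      have e1 : (e.pair h + t • Smooth.pair 0 Y).1 m = (e.1 m, h.1 m + t • Y.1 m) :=
        Prod.ext (by show e.1 m + t • (0 : E.L m) = e.1 m; simp) rfl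
      rw [e1]
      refine (hlin.map_add _ _).trans ?_
      rw [hlin.map_smul t (Y.1 m)]
    exact uniq_Ici h3 h4.hasDerivWithinAt (Filter.Eventually.of_forall h5) (h5 0)
  exact congrArg (fun A => A Y) h2

variable {g : ScFam E F} {Dg}

/-- The linearization at `e` of `g - q (·, h)`. -/
noncomputable def linFam (hg : Sc1 U g Dg) (hq : Sc1 (E := E.prod H) (U ×ˢ univ) q Dq) (e : E.Smooth)
    (he : e.1 0 ∈ U) (h : H.Smooth) : ScOp E F := (hg.sub (hq.slice h)).op e he

theorem linFam_apply (hg : Sc1 U g Dg) (hq : Sc1 (E := E.prod H) (U ×ˢ univ) q Dq) (e : E.Smooth)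
    (he : e.1 0 ∈ U) (h : H.Smooth) (m : ℕ) (X : E.L m) : (linFam hg hq e he h).map m X =
    Dg m (e.1 (m + 1)) X - Dq m (e.1 (m + 1), h.1 (m + 1)) (X, 0) := rfl

end FamilyLinearization

/-- The inverse of a sc-isomorphism. -/
def ScIso.symm {E F : ScSpace.{u}} (A : ScIso E F) : ScIso F E where
  fwd := A.bwd
  bwd := A.fwd
  left_inv := A.right_inv
  right_inv := A.left_inv

/-! ### Linearizations in germ coordinates -/

namespace GermChart

variable {E F H : ScSpace.{u}} {U : Set (E.L 0)} {g : ScFam E F} {q : ScFam (E.prod H) F}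
  {e₀ : E.Smooth} {h₀ : H.Smooth} {W : ScSpace.{u}} {k N d : ℕ}
  (c : GermChart U g q e₀ h₀ W k N d)

/-- The coordinates of a smooth point. -/
noncomputable def pt (e : E.Smooth) : (W.addFin k).Smooth := c.hψ.cont.app e

variable {c}

theorem pt_val {e : E.Smooth} (he : e.1 0 ∈ c.U₁) (m : ℕ) : (c.pt e).1 m = c.ψ m (e.1 m) :=
  c.hψ.cont.app_val he m

theorem pt_mem {e : E.Smooth} (he : e.1 0 ∈ c.U₁) : (c.pt e).1 0 ∈ c.G.V := by
  rw [pt_val he]; exact c.mapsTo he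

theorem pt_zero : c.pt e₀ = 0 := Smooth.ext_zero (by rw [pt_val c.mem, c.ψ_zero]; rfl)

theorem left_inv' {m : ℕ} {x : E.L m} (hx : x ∈ E.lev c.U₁ m) : c.ψ' m (c.ψ m x) = x := by
  apply down_injective m
  rw [(c.hψ'.cont.comp c.hψ.cont c.mapsTo).down hx]
  exact c.left_inv _ hx

theorem ψ'_pt {e : E.Smooth} (he : e.1 0 ∈ c.U₁) (m : ℕ) : c.ψ' m ((c.pt e).1 m) = e.1 m := by
  rw [pt_val he, left_inv' (smooth_mem_lev.2 he)]

theorem fatV : Fat c.G.V := Fat.of_relOpen c.G.relOpen fat_stdQuadrant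

theorem fatU₁ (hU : Fat U) : Fat c.U₁ := Fat.of_relOpen c.relOpen hU

/-- The differential of the inverse coordinates, as a sc-isomorphism. -/
noncomputable def tangentIso (hU : Fat U) (e : E.Smooth) (he : e.1 0 ∈ c.U₁) :
    ScIso (W.addFin k) E where
  fwd := c.hψ'.op (c.pt e) (pt_mem he)
  bwd := c.hψ.op e he
  left_inv m X := by
    have h := (c.hψ.comp c.hψ' c.mapsTo').unique (Sc1.ofOp (ScOp.id _) c.G.V) c.right_inv fatV
      (pt_mem he) m
    rw [ψ'_pt he] at h
    exact congrArg (fun A => A X) h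
  right_inv m X := by
    have h := (c.hψ'.comp c.hψ c.mapsTo).unique (Sc1.ofOp (ScOp.id _) c.U₁) c.left_inv (fatU₁ hU)
      he m
    rw [← pt_val he] at h
    exact congrArg (fun A => A X) h

/-- The coordinate change in the fibre, as a sc-isomorphism. -/
noncomputable def fibreIso (e : E.Smooth) (he : e.1 0 ∈ c.U₁) : ScIso F (W.addFin N) where
  fwd := fibreOp c.hΨ.cont c.Ψ_lin e he
  bwd := fibreOp c.hΨ' c.Ψ'_lin (c.pt e) (pt_mem he)
  left_inv m h := by
    apply down_injective m
    rw [ScOp.down_map, ScOp.down_map, fibreOp_map, fibreOp_map, pt_val he]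
    exact c.fibre_left_inv _ he _
  right_inv m h := by
    apply down_injective m
    rw [ScOp.down_map, ScOp.down_map, fibreOp_map, fibreOp_map, ← ψ'_pt he 0]
    exact c.fibre_right_inv _ (pt_mem he) _

variable {Dg Dq}

theorem F_eq' (hg : Sc1 U g Dg) (hq : Sc1 (E := E.prod H) (U ×ˢ univ) q Dq)
    {m : ℕ} {v : (W.addFin k).L m} (hv : v ∈ (W.addFin k).lev c.G.V m) (h : H.L m) :
    c.G.F m v (h - h₀.1 m) = c.Ψ m (c.ψ' m v, g m (c.ψ' m v) - q m (c.ψ' m v, h)) := by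
  apply down_injective m
  have hx : c.ψ' m v ∈ E.lev c.U₁ m := c.hψ'.cont.mapsTo c.mapsTo' m hv
  have hx' : c.ψ' m v ∈ E.lev U m := c.relOpen.subset hx
  rw [c.G.down_F m hv, map_sub, down_smooth, c.F_eq _ hv,
    c.hΨ.cont.down (x := (c.ψ' m v, g m (c.ψ' m v) - q m (c.ψ' m v, h)))
      (mem_lev_prod.2 ⟨hx, mem_univ _⟩), prod_down, map_sub, hg.cont.down hx',
    hq.cont.down (x := (c.ψ' m v, h)) (mem_lev_prod.2 ⟨hx', mem_univ _⟩), prod_down,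
    c.hψ'.cont.down hv]

/-- The derivative of the family of germs at a zero. -/
theorem hasDerivWithinAt_F (hg : Sc1 U g Dg) (hq : Sc1 (E := E.prod H) (U ×ˢ univ) q Dq)
    (hl : ∀ x ∈ U, IsLinearMap ℝ (fun h : H.L 0 => q 0 (x, h))) (hU : Fat U)
    {e : E.Smooth} (he : e.1 0 ∈ c.U₁) {h : H.Smooth} (hZ : g 0 (e.1 0) = q 0 (e.1 0, h.1 0)) (m : ℕ)
    {X : (W.addFin k).Smooth} (hX : IsDir c.G.V (c.pt e) X) (η : H.Smooth) :
    HasDerivWithinAt (fun t : ℝ => c.G.F m ((c.pt e + t • X).1 m) ((h - h₀ + t • η).1 m))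
      ((fibreIso e he).fwd.map m ((linFam hg hq e (c.relOpen.subset he) h).map m
        ((tangentIso hU e he).fwd.map m (X.1 m)) - q m (e.1 m, η.1 m))) (Ici 0) 0 := by
  have heU := c.relOpen.subset he
  have hmU : MapsTo (c.ψ' 0) c.G.V U := fun v hv => c.relOpen.subset (c.mapsTo' hv)
  have hψ1 := c.hψ'.comp (Sc1.ofOp (⟨fun m => ContinuousLinearMap.fst ℝ _ _,
    fun _ _ => rfl⟩ : ScOp ((W.addFin k).prod H) (W.addFin k)) (c.G.V ×ˢ univ)) fun p hp => hp.1
  have hsnd := Sc1.ofOp (⟨fun m => ContinuousLinearMap.snd ℝ _ _,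
    fun _ _ => rfl⟩ : ScOp ((W.addFin k).prod H) H) (c.G.V ×ˢ univ)
  have hΦ := hψ1.pair (fun p hp => c.mapsTo' hp.1) ((hg.comp hψ1 fun p hp => hmU hp.1).sub
    (hψ1.pair (fun p hp => hmU hp.1) hsnd hq)) c.hΨ
  have hdir : IsDir (E := (W.addFin k).prod H) (c.G.V ×ˢ univ) ((c.pt e).pair h) (X.pair η) := by
    filter_upwards [hX] with t ht
    exact ⟨ht, mem_univ _⟩
  have hpt := pt_mem he
  have h1 := hΦ.hasDerivWithinAt_dir (e := (c.pt e).pair h) (X := X.pair η) ⟨hpt, mem_univ _⟩ hdir m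
  -- At a zero the fibre argument of `Ψ` vanishes, so the derivative of `Ψ` in the base drops out by
  -- `Sc1.fibre_zero`.
  have hZ' : g (m + 1) (e.1 (m + 1)) - q (m + 1) (e.1 (m + 1), h.1 (m + 1)) = 0 := by
    apply down_injective (m + 1)
    rw [map_sub, hg.cont.down (smooth_mem_lev.2 heU), hq.cont.down (x := (e.1 (m + 1), h.1 (m + 1)))
      (mem_lev_prod.2 ⟨smooth_mem_lev.2 heU, mem_univ _⟩), prod_down, down_smooth, down_smooth, hZ,
      sub_self, map_zero]
  refine (h1.congr_deriv ?_).congr_of_eventuallyEq ?_ ?_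
  · show c.DΨ m (c.ψ' (m + 1) ((c.pt e).1 (m + 1)), g (m + 1) (c.ψ' (m + 1) ((c.pt e).1 (m + 1))) -
        q (m + 1) (c.ψ' (m + 1) ((c.pt e).1 (m + 1)), h.1 (m + 1)))
        (c.Dψ' m ((c.pt e).1 (m + 1)) (X.1 m),
          Dg m (c.ψ' (m + 1) ((c.pt e).1 (m + 1))) (c.Dψ' m ((c.pt e).1 (m + 1)) (X.1 m)) -
          Dq m (c.ψ' (m + 1) ((c.pt e).1 (m + 1)), h.1 (m + 1))
            (c.Dψ' m ((c.pt e).1 (m + 1)) (X.1 m), η.1 m)) = _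
    rw [ψ'_pt he, hZ', c.hΨ.fibre_zero c.Ψ_lin (fatU₁ hU) he]
    show _ = c.Ψ m (e.1 m, _)
    rw [linFam_apply, ← hq.fibre_snd hl heU h m]
    congr 2
    rw [sub_sub]
    congr 1
    set Y := c.Dψ' m ((c.pt e).1 (m + 1)) (X.1 m)
    have : ((Y, η.1 m) : E.L m × H.L m) = (Y, 0) + (0, η.1 m) := by simp
    rw [this]
    exact map_add (Dq m (e.1 (m + 1), h.1 (m + 1))) (Y, 0) (0, η.1 m)
  · rw [← Ioi_insert, nhdsWithin_insert]
    have key : ∀ t : ℝ, (c.pt e + t • X).1 0 ∈ c.G.V →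
        c.G.F m ((c.pt e + t • X).1 m) ((h - h₀ + t • η).1 m) = c.Ψ m
        (c.ψ' m ((c.pt e + t • X).1 m), g m (c.ψ' m ((c.pt e + t • X).1 m)) -
          q m (c.ψ' m ((c.pt e + t • X).1 m), (h + t • η).1 m)) := fun t ht => by
      have e1 : (h - h₀ + t • η).1 m = (h + t • η).1 m - h₀.1 m := by
        show h.1 m - h₀.1 m + t • η.1 m = h.1 m + t • η.1 m - h₀.1 m
        abel
      rw [e1, F_eq' hg hq (smooth_mem_lev.2 ht)]
    refine Filter.eventually_sup.2 ⟨Filter.eventually_pure.2 (key 0 (by simpa using hpt)), ?_⟩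
    filter_upwards [hX] with t ht using key t ht
  · have e1 : (h - h₀ + (0 : ℝ) • η).1 m = (h + (0 : ℝ) • η).1 m - h₀.1 m := by
      show h.1 m - h₀.1 m + (0 : ℝ) • η.1 m = h.1 m + (0 : ℝ) • η.1 m - h₀.1 m
      abel
    show c.G.F m _ _ = _
    rw [e1, F_eq' hg hq (smooth_mem_lev.2 (by simpa using hpt))]
    rfl

/-- In the coordinates, the linearization at the centre is that of the germ. -/
theorem lin_center (hg : Sc1 U g Dg) (hq : Sc1 (E := E.prod H) (U ×ˢ univ) q Dq)
    (hl : ∀ x ∈ U, IsLinearMap ℝ (fun h : H.L 0 => q 0 (x, h))) (hU : Fat U)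
    (hZ : g 0 (e₀.1 0) = q 0 (e₀.1 0, h₀.1 0)) :
    c.G.T = (fibreIso e₀ c.mem).fwd.comp ((linFam hg hq e₀ (c.relOpen.subset c.mem) h₀).comp
      (tangentIso hU e₀ c.mem).fwd) := by
  set S := (fibreIso e₀ c.mem).fwd.comp ((linFam hg hq e₀ (c.relOpen.subset c.mem) h₀).comp
      (tangentIso hU e₀ c.mem).fwd) with hS
  -- The estimate is available on positive levels only, and one level determines a sc-operator.
  -- Applied at the centre itself, it holds for every `ε`, which forces equality.
  refine ScOp.ext_level 1 fun X => ?_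
  have key : ∀ ε : ℝ, 0 < ε → ‖S.map 1 (X.1 1) - c.G.T.map 1 (X.1 1)‖ ≤ ε * ‖X.1 1‖ := by
    intro ε hε
    obtain ⟨δ, hδ, h⟩ := c.G.linearization_near 0 hε
    refine h 0 c.G.zero_mem (by simpa using hδ) 0 (by simpa using hδ) (S.map 1) ?_ (X.1 1)
    intro Y hY
    rw [← pt_zero] at hY
    have := hasDerivWithinAt_F hg hq hl hU c.mem hZ 1 hY 0
    rw [pt_zero] at this
    have h0 : q 1 (e₀.1 1, (0 : H.Smooth).1 1) = 0 :=
      (fibre_isLinear hq.cont hl (m := 1) (smooth_mem_lev.2 (c.relOpen.subset c.mem))).map_zero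
    rw [h0] at this
    simp only [smul_zero, add_zero, sub_self, sub_zero] at this
    exact this
  have h0 : ‖S.map 1 (X.1 1) - c.G.T.map 1 (X.1 1)‖ ≤ 0 := by
    have hcont : Continuous (fun ρ : ℝ => ρ * ‖X.1 1‖) := by fun_prop
    have : Filter.Tendsto (fun ρ : ℝ => ρ * ‖X.1 1‖) (𝓝[>] 0) (𝓝 0) := by
      simpa using (hcont.tendsto 0).mono_left nhdsWithin_le_nhds
    exact ge_of_tendsto this (by filter_upwards [self_mem_nhdsWithin] with ε hε using key ε hε)
  exact (sub_eq_zero.1 (norm_le_zero_iff.1 h0)).symm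

/-- By `lin_center` the operator is conjugate under sc-isomorphisms to the linearization of the
germ, which is the identity modulo finite-dimensional factors and a level-gaining term. -/
theorem isFredholm_center (hg : Sc1 U g Dg) (hq : Sc1 (E := E.prod H) (U ×ˢ univ) q Dq)
    (hl : ∀ x ∈ U, IsLinearMap ℝ (fun h : H.L 0 => q 0 (x, h))) (hU : Fat U)
    (hZ : g 0 (e₀.1 0) = q 0 (e₀.1 0, h₀.1 0)) :
    (linFam hg hq e₀ (c.relOpen.subset c.mem) h₀).IsFredholm := by
  have h := c.G.isFredholm_T.conj (tangentIso hU e₀ c.mem).symm (fibreIso e₀ c.mem).symm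
  rw [lin_center hg hq hl hU hZ] at h
  convert h using 1
  ext m x
  show _ = (fibreIso e₀ c.mem).bwd.map m ((fibreIso e₀ c.mem).fwd.map m
    ((linFam hg hq e₀ (c.relOpen.subset c.mem) h₀).map m ((tangentIso hU e₀ c.mem).fwd.map m
      ((tangentIso hU e₀ c.mem).bwd.map m x))))
  rw [ScIso.left_inv, ScIso.right_inv]

/-- Points near the centre lie in the domain of the coordinates and have small coordinates. -/
theorem pt_near (m : ℕ) {ε : ℝ} (hε : 0 < ε) : ∃ δ > 0, ∀ e : E.Smooth, e.1 0 ∈ U →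
    ‖e.1 m - e₀.1 m‖ < δ → e.1 0 ∈ c.U₁ ∧ ‖(c.pt e).1 m‖ < ε := by
  obtain ⟨δ₁, hδ₁, h₁⟩ := c.relOpen.ball (m := m) (v₀ := e₀.1 m) (smooth_mem_lev.2 c.mem)
  obtain ⟨δ₂, hδ₂, h₂⟩ := Metric.continuousOn_iff.1 (c.hψ.cont.1 m) (e₀.1 m)
    (smooth_mem_lev.2 c.mem) ε hε
  refine ⟨min δ₁ δ₂, lt_min hδ₁ hδ₂, fun e he hd => ?_⟩
  have he1 := h₁ (e.1 m) (smooth_mem_lev.2 he) (hd.trans_le (min_le_left _ _))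
  refine ⟨smooth_mem_lev.1 he1, ?_⟩
  have := h₂ (e.1 m) he1 (by rw [dist_eq_norm]; exact hd.trans_le (min_le_right _ _))
  rwa [← pt_val (smooth_mem_lev.1 he1), ← pt_val c.mem, pt_zero, Smooth.zero_val, dist_zero_right]
    at this

/-- Surjectivity and bijectivity of the linearization on a positive level are open conditions with respect
to the next level. -/
theorem lin_near (c : GermChart U g q e₀ h₀ W k N d) (hg : Sc1 U g Dg) (hq : Sc1 (E := E.prod H) (U ×ˢ univ) q Dq)
    (hl : ∀ x ∈ U, IsLinearMap ℝ (fun h : H.L 0 => q 0 (x, h))) (hU : Fat U)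
    (hZ : g 0 (e₀.1 0) = q 0 (e₀.1 0, h₀.1 0)) (he₀ : e₀.1 0 ∈ U) (n : ℕ)
    (hs : Function.Surjective ((linFam hg hq e₀ he₀ h₀).map (n + 1))) :
    ∃ δ > 0, ∀ e : E.Smooth, ∀ h : H.Smooth, ∀ he : e.1 0 ∈ U, ‖e.1 (n + 2) - e₀.1 (n + 2)‖ < δ →
      ‖h.1 (n + 2) - h₀.1 (n + 2)‖ < δ → g 0 (e.1 0) = q 0 (e.1 0, h.1 0) →
      Function.Surjective ((linFam hg hq e he h).map (n + 1)) ∧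
      (Function.Injective ((linFam hg hq e₀ he₀ h₀).map (n + 1)) →
        Function.Injective ((linFam hg hq e he h).map (n + 1))) := by
  have hfib : ∀ (e : E.Smooth) (he : e.1 0 ∈ c.U₁) (m : ℕ),
      Function.Bijective ((fibreIso e he).fwd.map m) := fun e he m =>
    ⟨(fibreIso e he).left_inv m |> Function.LeftInverse.injective,
      (fibreIso e he).right_inv m |> Function.RightInverse.surjective⟩
  have htan : ∀ (e : E.Smooth) (he : e.1 0 ∈ c.U₁) (m : ℕ),
      Function.Bijective ((tangentIso hU e he).fwd.map m) := fun e he m =>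
    ⟨(tangentIso hU e he).left_inv m |> Function.LeftInverse.injective,
      (tangentIso hU e he).right_inv m |> Function.RightInverse.surjective⟩
  have hT := lin_center (c := c) hg hq hl hU hZ
  have hTs : Function.Surjective (c.G.T.map (n + 1)) := by
    rw [hT]
    exact (hfib e₀ c.mem _).2.comp (hs.comp (htan e₀ c.mem _).2)
  -- Surjectivity on level `n + 1` spreads to level `0`, where the right inverse is constructed as a
  -- sc-operator.
  obtain ⟨Q, hQ⟩ := c.G.isFredholm_T.exists_rightInverse
    (c.G.isFredholm_T.surjective_of_level hTs 0)
  obtain ⟨ε, hε, hnear⟩ := surjective_of_near (hQ (n + 1))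
  obtain ⟨δ₁, hδ₁, h₁⟩ := c.G.linearization_near n hε
  obtain ⟨δ₂, hδ₂, h₂⟩ := pt_near (c := c) (n + 2) hδ₁
  refine ⟨min δ₁ δ₂, lt_min hδ₁ hδ₂, fun e h he hed hhd heZ => ?_⟩
  obtain ⟨he1, hpt⟩ := h₂ e he (hed.trans_le (min_le_right _ _))
  set S := (fibreIso e he1).fwd.comp ((linFam hg hq e he h).comp (tangentIso hU e he1).fwd) with hS
  have h0 : q (n + 1) (e.1 (n + 1), (0 : H.Smooth).1 (n + 1)) = 0 :=
    (fibre_isLinear hq.cont hl (m := n + 1) (smooth_mem_lev.2 he)).map_zero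
  have hb := h₁ (c.pt e) (pt_mem he1) hpt (h - h₀) (hhd.trans_le (min_le_left _ _)) (S.map (n + 1))
    (fun X hX => by
      have := hasDerivWithinAt_F hg hq hl hU he1 heZ (n + 1) hX 0
      rw [h0] at this
      simp only [smul_zero, add_zero, sub_zero] at this
      exact this)
  obtain ⟨hsurj, hinj⟩ := hnear (S.map (n + 1)) hb
  have hSe : (S.map (n + 1) : (W.addFin k).L (n + 1) → (W.addFin N).L (n + 1)) =
    (fibreIso e he1).fwd.map (n + 1) ∘ (linFam hg hq e he h).map (n + 1) ∘
      (tangentIso hU e he1).fwd.map (n + 1) := rfl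
  rw [hSe] at hsurj hinj
  constructor
  · have := Function.Surjective.of_comp_left hsurj (hfib e he1 _).1
    exact Function.Surjective.of_comp this
  · intro hi
    have hTi : Function.Injective (c.G.T.map (n + 1)) := by
      rw [hT]
      exact (hfib e₀ c.mem _).1.comp (hi.comp (htan e₀ c.mem _).1)
    have := Function.Injective.of_comp (hinj hTi)
    exact Function.Injective.of_comp_right this (htan e he1 _).2

/-- Strictly inward vectors have positive derivatives of the vanishing coordinates. -/
theorem coord_pos (hU : Fat U) {e : E.Smooth} (he : e.1 0 ∈ c.U₁) {ν : E.Smooth} (hν : Inward U e ν)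
    {j : Fin k} (hj : j.val < d) (h0 : ((c.pt e).1 0).1 j = 0) :
    0 < ((c.hψ.op e he).map 0 (ν.1 0)).1 j := by
  set A := c.hψ.op e he with hA
  -- The vector that decreases the `j`-th coordinate at unit rate. A small multiple of it,
  -- transported to `U`, may be added to `ν` without leaving `U`; the `j`-th coordinate still cannot
  -- decrease, so `ν` itself increases it at rate at least `s`.
  set w : (W.addFin k).Smooth := mkFin (WithLp.toLp 2 (Pi.single j (-1))) 0 with hw
  obtain ⟨s, hs, hdir⟩ := hν.of_relOpen c.relOpen he ((tangentIso hU e he).fwd.app w)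
  have h1 := c.hψ.hasDerivWithinAt_dir he hdir 0
  have h2 := ((EuclideanSpace.proj j : EuclideanSpace ℝ (Fin k) →L[ℝ] ℝ).comp
    (ContinuousLinearMap.fst ℝ _ (W.L 0))).hasFDerivAt.comp_hasDerivWithinAt 0 h1
  have h3 := nonneg_of_hasDerivWithinAt h2 (by
    simp only [Function.comp_apply, zero_smul, add_zero]
    rw [← pt_val he]
    exact h0) (by
      filter_upwards [hdir] with t ht
      exact c.G.relOpen.subset (c.mapsTo ht) j hj)
  have h4 : A.map 0 ((ν + s • (tangentIso hU e he).fwd.app w).1 0) = A.map 0 (ν.1 0) + s • w.1 0 := by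
    show A.map 0 (ν.1 0 + s • (tangentIso hU e he).fwd.map 0 (w.1 0)) = _
    rw [map_add, map_smul]
    congr 2
    exact (tangentIso hU e he).left_inv 0 (w.1 0)
  have h5 : 0 ≤ (A.map 0 ((ν + s • (tangentIso hU e he).fwd.app w).1 0)).1 j := h3
  rw [h4] at h5
  have h6 : (A.map 0 (ν.1 0) + s • w.1 0).1 j = (A.map 0 (ν.1 0)).1 j + s * (-1) := by
    show (A.map 0 (ν.1 0)).1 j + s * (Pi.single j (-1) : Fin k → ℝ) j = _
    rw [Pi.single_eq_same]
  rw [h6] at h5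
  linarith

/-- If the linearization at the centre is surjective, then near the centre a map `R` vanishing at all
solutions `y` of `g y = q (y, h)`, for all `h`, has vanishing derivative in the directions `X` for which
`T X` is of the form `q (e, η)`, provided this holds for a direction pointing strictly inward. -/
theorem deriv_eq_zero (c : GermChart U g q e₀ h₀ W k N d) (hg : Sc1 U g Dg) (hq : Sc1 (E := E.prod H) (U ×ˢ univ) q Dq)
    (hl : ∀ x ∈ U, IsLinearMap ℝ (fun h : H.L 0 => q 0 (x, h))) (hU : Fat U)
    (hZ : g 0 (e₀.1 0) = q 0 (e₀.1 0, h₀.1 0)) (he₀ : e₀.1 0 ∈ U) (n : ℕ)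
    (hs : Function.Surjective ((linFam hg hq e₀ he₀ h₀).map 0)) :
    ∃ δ > 0, ∀ e : E.Smooth, ∀ h : H.Smooth, ∀ he : e.1 0 ∈ U, ‖e.1 (n + 2) - e₀.1 (n + 2)‖ < δ →
      ‖h.1 (n + 2) - h₀.1 (n + 2)‖ < δ → g 0 (e.1 0) = q 0 (e.1 0, h.1 0) →
      ∀ (E' : ScSpace.{u}) (R : ScFam E E') (DR : _), Sc1 U R DR →
      (∀ y ∈ U, ∀ h, g 0 y = q 0 (y, h) → R 0 y = 0) →
      ∀ ν : E.Smooth, Inward U e ν → DR n (e.1 (n + 1)) (ν.1 n) = 0 →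
      (∃ η, (linFam hg hq e he h).map (n + 1) (ν.1 (n + 1)) = q (n + 1) (e.1 (n + 1), η)) →
      ∀ X η, (linFam hg hq e he h).map (n + 1) X = q (n + 1) (e.1 (n + 1), η) →
      DR n (e.1 (n + 1)) (E.incl n X) = 0 := by
  have hT := lin_center (c := c) hg hq hl hU hZ
  have hTs : Function.Surjective (c.G.T.map 0) := by
    rw [hT]
    exact ((fibreIso e₀ c.mem).right_inv 0 |> Function.RightInverse.surjective).comp
      (hs.comp ((tangentIso hU e₀ c.mem).right_inv 0 |> Function.RightInverse.surjective))
  obtain ⟨Q, hQ⟩ := c.G.isFredholm_T.exists_rightInverse hTs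
  obtain ⟨δ₁, hδ₁, h₁⟩ := c.G.deriv_eq_zero hQ n
  obtain ⟨δ₂, hδ₂, h₂⟩ := pt_near (c := c) (n + 2) hδ₁
  refine ⟨min δ₁ δ₂, lt_min hδ₁ hδ₂, fun e h he hed hhd heZ E' R DR hR hR0 ν hν hνR hνη => ?_⟩
  obtain ⟨he1, hpt⟩ := h₂ e he (hed.trans_le (min_le_right _ _))
  obtain ⟨ην, hην⟩ := hνη
  set T := linFam hg hq e he h with hTdef
  set A := c.hψ.op e he1 with hA
  have hmU : MapsTo (c.ψ' 0) c.G.V U := fun v hv => c.relOpen.subset (c.mapsTo' hv)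
  have hlin := fibre_isLinear hq.cont hl (m := n + 1) (x := e.1 (n + 1)) (smooth_mem_lev.2 he)
  have hFe : c.G.F (n + 1) ((c.pt e).1 (n + 1)) ((h - h₀).1 (n + 1)) = 0 := by
    have hgq : g (n + 1) (e.1 (n + 1)) - q (n + 1) (e.1 (n + 1), h.1 (n + 1)) = 0 := by
      apply down_injective (n + 1)
      rw [map_sub, hg.cont.down (smooth_mem_lev.2 he), hq.cont.down (x := (e.1 (n + 1), h.1 (n + 1)))
        (mem_lev_prod.2 ⟨smooth_mem_lev.2 he, mem_univ _⟩), prod_down, down_smooth, down_smooth, heZ,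
        sub_self, map_zero]
    rw [Smooth.sub_val, F_eq' hg hq (smooth_mem_lev.2 (pt_mem he1)), ψ'_pt he1, hgq]
    exact (fibre_isLinear c.hΨ.cont c.Ψ_lin (smooth_mem_lev.2 he1)).map_zero
  -- the case of directions that point strictly inward
  have key : ∀ X η, T.map (n + 1) X = q (n + 1) (e.1 (n + 1), η) →
      (∀ j : Fin k, j.val < d → ((c.pt e).1 0).1 j = 0 → 0 < (A.map (n + 1) X).1 j) →
      DR n (e.1 (n + 1)) (E.incl n X) = 0 := by
    intro X η hX hpos
    have h3 := h₁ (c.pt e) (h - h₀) (pt_mem he1) hpt (hhd.trans_le (min_le_left _ _)) hFe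
      (((fibreIso e he1).fwd.map (n + 1)).comp
        ((((T.map (n + 1)).comp ((tangentIso hU e he1).fwd.map (n + 1))).comp
          (ContinuousLinearMap.fst ℝ ((W.addFin k).L (n + 1)) (H.L (n + 1)))) -
          ((fibreOp hq.cont hl e he).map (n + 1)).comp
          (ContinuousLinearMap.snd ℝ ((W.addFin k).L (n + 1)) (H.L (n + 1)))))
      (fun X η hX => hasDerivWithinAt_F hg hq hl hU he1 heZ (n + 1) hX η) E' _ _
      (hR.comp c.hψ' hmU) (fun v hv h' hv' => hR0 _ (hmU hv) (h' + h₀.1 0) ?_)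
      (A.map (n + 1) X) η ?_ hpos
    · rw [ψ'_pt he1] at h3
      have h4 : (tangentIso hU e he1).fwd.map n ((W.addFin k).incl n (A.map (n + 1) X)) =
          E.incl n X := by
        rw [A.comm]
        exact (tangentIso hU e he1).right_inv n _
      rw [← h4]
      exact h3
    · have h4 := c.F_eq v hv (h' + h₀.1 0)
      rw [add_sub_cancel_right, hv'] at h4
      have hvU := c.mapsTo' hv
      have h5 := c.fibre_left_inv _ hvU (g 0 (c.ψ' 0 v) - q 0 (c.ψ' 0 v, h' + h₀.1 0))
      rw [← h4, (c.Ψ'_lin _ (c.mapsTo hvU)).map_zero] at h5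
      exact sub_eq_zero.1 h5.symm
    · show (fibreIso e he1).fwd.map (n + 1) (T.map (n + 1) ((tangentIso hU e he1).fwd.map (n + 1)
        ((tangentIso hU e he1).bwd.map (n + 1) X)) - q (n + 1) (e.1 (n + 1), η)) = 0
      rw [ScIso.right_inv, hX, sub_self, map_zero]
  intro X η hX
  have hνpos : ∀ j : Fin k, j.val < d → ((c.pt e).1 0).1 j = 0 → 0 < (A.map (n + 1) (ν.1 (n + 1))).1 j := by
    intro j hj hj0
    have := coord_pos hU he1 hν hj hj0
    rwa [← ScOp.app_val, ← smooth_fin_fst _ (n + 1)] at this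
  -- A large multiple of `ν` makes `X + r • ν` strictly inward. The derivative of `R` annihilates
  -- both this vector and `ν`, hence also `X`.
  obtain ⟨r, hr⟩ : ∃ r : ℝ, ∀ j : Fin k, j.val < d → ((c.pt e).1 0).1 j = 0 →
      0 < (A.map (n + 1) X).1 j + r * (A.map (n + 1) (ν.1 (n + 1))).1 j := by
    have : ∀ᶠ r : ℝ in Filter.atTop, ∀ j : Fin k, j.val < d → ((c.pt e).1 0).1 j = 0 →
      0 < (A.map (n + 1) X).1 j + r * (A.map (n + 1) (ν.1 (n + 1))).1 j := by
      simp only [Filter.eventually_all]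
      intro j hj hj0
      exact (Filter.tendsto_atTop_add_const_left _ _ (Filter.tendsto_id.atTop_mul_const
        (hνpos j hj hj0))).eventually_gt_atTop 0
    exact this.exists
  have h3 := key (X + r • ν.1 (n + 1)) (η + r • ην) (by
    rw [map_add, map_smul, hX, hην, hlin.map_add, hlin.map_smul]) (fun j hj hj0 => by
      rw [map_add, map_smul]
      exact hr j hj hj0)
  rwa [map_add, map_smul, ν.2, map_add, map_smul, hνR, smul_zero, add_zero] at h3

end GermChart

/-! ### Openness for sc-Fredholm maps -/

theorem ScOp.isIsoOnLevel_iff {E F : ScSpace.{u}} {T : ScOp E F} {i : ℕ} :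
    T.IsIsoOnLevel i ↔ Function.Bijective (T.map i) := by
  constructor
  · rintro ⟨A, hA⟩
    rw [← hA]
    exact A.bijective
  · intro h
    exact ⟨ContinuousLinearEquiv.ofBijective (T.map i) (LinearMap.ker_eq_bot.2 h.1)
      (LinearMap.range_eq_top.2 h.2), ContinuousLinearEquiv.coe_ofBijective _ _ _⟩

theorem ScOp.isScIso_iff {E F : ScSpace.{u}} {T : ScOp E F} :
    T.IsScIso ↔ ∀ m, Function.Bijective (T.map m) := by
  constructor
  · rintro ⟨A, rfl⟩ m
    exact ⟨Function.LeftInverse.injective (A.left_inv m), Function.RightInverse.surjective (A.right_inv m)⟩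
  · intro h
    choose A hA using fun m => ScOp.isIsoOnLevel_iff.2 (h m)
    have hA' : ∀ m x, A m x = T.map m x := fun m x => congrArg (fun B => B x) (hA m)
    refine ⟨⟨T, ⟨fun m => (A m).symm, fun m y => ?_⟩, fun m x => ?_, fun m y => ?_⟩, rfl⟩
    · apply (h m).1
      show T.map m (E.incl m ((A (m + 1)).symm y)) = T.map m ((A m).symm (F.incl m y))
      rw [← T.comm, ← hA', ← hA', ContinuousLinearEquiv.apply_symm_apply,
        ContinuousLinearEquiv.apply_symm_apply]
    · show (A m).symm (T.map m x) = x
      rw [← hA', ContinuousLinearEquiv.symm_apply_apply]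
    · show T.map m ((A m).symm y) = y
      rw [← hA', ContinuousLinearEquiv.apply_symm_apply]

theorem isOpen_induced_level {E : ScSpace.{u}} {m : ℕ} {A : Set E.Smooth}
    (h : ∀ e ∈ A, ∃ δ > 0, ∀ e' : E.Smooth, ‖e'.1 m - e.1 m‖ < δ → e' ∈ A) :
    IsOpen[TopologicalSpace.induced (fun e : E.Smooth => e.1 m) inferInstance] A := by
  let _ : TopologicalSpace E.Smooth := TopologicalSpace.induced (fun e : E.Smooth => e.1 m) inferInstance
  rw [isOpen_iff_mem_nhds]
  intro e he
  obtain ⟨δ, hδ, h⟩ := h e he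
  rw [nhds_induced, Filter.mem_comap]
  exact ⟨_, Metric.ball_mem_nhds (e.1 m) hδ, fun e' he' => h e' (by simpa [dist_eq_norm] using he')⟩

theorem isLinearMap_snd {E F : ScSpace.{u}} {U : Set (E.L 0)} : ∀ x ∈ U, IsLinearMap ℝ
    (fun h : F.L 0 => ((fun (m : ℕ) (p : E.L m × F.L m) => p.2) : ScFam (E.prod F) F) 0 (x, h)) :=
  fun _ _ => ⟨fun _ _ => rfl, fun _ _ => rfl⟩

/-- Openness of regularity and bijectivity for maps that are conjugate to basic germs. -/
theorem scFredholm_lin_near {E F : ScSpace.{u}} {s : ScFam E F} {D} (hs : Sc1 univ s D) (e₀ : E.Smooth)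
    (h : ConjToBasicGerm univ 0 s e₀) :
    (hs.op e₀ (mem_univ _)).IsFredholm ∧
    ∀ n, Function.Surjective ((hs.op e₀ (mem_univ _)).map (n + 1)) → ∃ δ > 0, ∀ e : E.Smooth,
      ‖e.1 (n + 2) - e₀.1 (n + 2)‖ < δ → Function.Surjective ((hs.op e (mem_univ _)).map (n + 1)) ∧
      (Function.Injective ((hs.op e₀ (mem_univ _)).map (n + 1)) →
        Function.Injective ((hs.op e (mem_univ _)).map (n + 1))) := by
  -- With the projection onto the fibre as `q`, the family is `s - h`; the parameter `h = s e` makes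
  -- every smooth `e` a zero without altering the differential.
  have hq : Sc1 (E := E.prod F) (univ ×ˢ univ) (fun (m : ℕ) (p : E.L m × F.L m) => p.2)
      (fun m _ => ContinuousLinearMap.snd ℝ (E.L m) (F.L m)) :=
    Sc1.ofOp (⟨fun m => ContinuousLinearMap.snd ℝ _ _, fun _ _ => rfl⟩ : ScOp (E.prod F) F) _
  have hq₁ : Sc1 (E := E.prod F.shift) (univ ×ˢ univ) (fun (m : ℕ) (p : E.L m × F.shift.L m) => p.2)
      (fun m _ => ContinuousLinearMap.snd ℝ (E.L m) (F.shift.L m)) :=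
    Sc1.ofOp (⟨fun m => ContinuousLinearMap.snd ℝ _ _, fun _ _ => rfl⟩ :
      ScOp (E.prod F.shift) F.shift) _
  have hval : ∀ e m, (hs.cont.app e).1 m = s m (e.1 m) := fun e m => hs.cont.app_val (mem_univ _) m
  obtain ⟨W, k, N, ⟨c⟩⟩ := h.exists_germChart (q := fun (m : ℕ) (p : E.L m × F.L m) => p.2)
    (q₁ := fun (m : ℕ) (p : E.L m × F.shift.L m) => p.2) ⟨univ, isOpen_univ, by simp⟩ (mem_univ _)
    hq isLinearMap_snd hq₁ (fun _ _ _ => rfl) (h₀ := hs.cont.app e₀) (hval e₀ 0)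
  have hlin : ∀ e h, linFam hs hq e (mem_univ _) h = hs.op e (mem_univ _) := fun e h => by
    ext m X
    rw [linFam_apply]
    exact sub_zero _
  have hZ : ∀ e : E.Smooth, s 0 (e.1 0) = (hs.cont.app e).1 0 := fun e => (hval e 0).symm
  refine ⟨?_, fun n hsurj => ?_⟩
  · have := GermChart.isFredholm_center (c := c) hs hq isLinearMap_snd fat_univ (hZ e₀)
    rwa [hlin] at this
  · rw [← hlin e₀ (hs.cont.app e₀)] at hsurj ⊢
    obtain ⟨δ, hδ, h⟩ := c.lin_near hs hq isLinearMap_snd fat_univ (hZ e₀) (mem_univ _) n hsurj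
    obtain ⟨δ', hδ', h'⟩ := Metric.continuousOn_iff.1 (hs.cont.1 (n + 2)) (e₀.1 (n + 2))
      (mem_univ _) δ hδ
    refine ⟨min δ δ', lt_min hδ hδ', fun e he => ?_⟩
    have := h e (hs.cont.app e) (mem_univ _) (he.trans_le (min_le_left _ _)) (by
      rw [hval, hval, ← dist_eq_norm]
      exact h' _ (mem_univ _) (by rw [dist_eq_norm]; exact he.trans_le (min_le_right _ _))) (hZ e)
    rwa [hlin] at this

theorem corollary_maps {E F : ScSpace.{u}} {s : ScFam E F} (h : ∀ e₀ : E.Smooth, IsScFredholmAt s e₀)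
    {i : ℕ} (hi : 1 ≤ i) :
    IsOpen[TopologicalSpace.induced (fun e : E.Smooth => e.1 (i + 1)) inferInstance]
      {e : E.Smooth | ∃ D : ScOp E F, HasScDeriv s univ e D ∧ range (D.map i) = univ} ∧
    IsOpen[TopologicalSpace.induced (fun e : E.Smooth => e.1 (i + 1)) inferInstance]
      {e : E.Smooth | ∃ D : ScOp E F, HasScDeriv s univ e D ∧ D.IsIsoOnLevel i} ∧
    IsOpen[TopologicalSpace.induced (fun e : E.Smooth => e.1 (i + 1)) inferInstance]
      {e : E.Smooth | ∃ D : ScOp E F, HasScDeriv s univ e D ∧ D.IsScIso} := by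
  obtain ⟨n, rfl⟩ : ∃ n, i = n + 1 := ⟨i - 1, by omega⟩
  obtain ⟨D, hs, hD⟩ := (h 0).1.exists_sc1
  have hop : ∀ e, HasScDeriv s univ e (hs.op e (mem_univ _)) := fun e m => hD m _ (mem_univ _)
  have huniq : ∀ e T, HasScDeriv s univ e T → T = hs.op e (mem_univ _) := fun e T hT => by
    ext m X
    rw [hT.eq hs fat_univ (mem_univ _)]
    rfl
  have hF := fun e => scFredholm_lin_near hs e (h e).2.2
  refine ⟨isOpen_induced_level ?_, isOpen_induced_level ?_, isOpen_induced_level ?_⟩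
  · rintro e ⟨T, hT, hr⟩
    rw [huniq e T hT, range_eq_univ] at hr
    obtain ⟨δ, hδ, h⟩ := (hF e).2 n hr
    exact ⟨δ, hδ, fun e' he' => ⟨_, hop e', range_eq_univ.2 (h e' he').1⟩⟩
  · rintro e ⟨T, hT, hr⟩
    rw [huniq e T hT, ScOp.isIsoOnLevel_iff] at hr
    obtain ⟨δ, hδ, h⟩ := (hF e).2 n hr.2
    exact ⟨δ, hδ, fun e' he' => ⟨_, hop e', ScOp.isIsoOnLevel_iff.2
      ⟨(h e' he').2 hr.1, (h e' he').1⟩⟩⟩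
  · rintro e ⟨T, hT, hr⟩
    rw [huniq e T hT, ScOp.isScIso_iff] at hr
    obtain ⟨δ, hδ, h⟩ := (hF e).2 n (hr (n + 1)).2
    refine ⟨δ, hδ, fun e' he' => ⟨_, hop e', ScOp.isScIso_iff.2 fun m => ?_⟩⟩
    -- The nearby differential is sc-Fredholm too, so its bijectivity on level `n + 1` gives
    -- bijectivity on all levels.
    exact ⟨(hF e').1.injective_of_level ((h e' he').2 (hr (n + 1)).1) m,
      (hF e').1.surjective_of_level (h e' he').1 m⟩

/-! ### Transfer of surjectivity between two descriptions of a linearization -/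

/-- The operators relating the linearization `D : im P → im Q` of a section in one trivialization to the
linearization `T` of a filled section in another one. -/
structure Transfer {E F E' F' : ScSpace.{u}} (P : ScOp E E) (Q : ScOp F F) (D : ScOp E F)
    (P' : ScOp E' E') (T : ScOp E' F') where
  a : ScOp E' E
  a' : ScOp E E'
  q : ScOp F F'
  q' : ScOp F' F
  a_P' : ∀ m X, a.map m (P'.map m X) = a.map m X
  P_a : ∀ m X, P.map m (a.map m X) = a.map m X
  a'_a : ∀ m X, a'.map m (a.map m X) = P'.map m X
  a_a' : ∀ m X, a.map m (a'.map m X) = P.map m X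
  T_P' : ∀ m X, T.map m (P'.map m X) = q.map m (D.map m (a.map m X))
  q'_q : ∀ m h, q'.map m (q.map m h) = Q.map m h
  q_Q : ∀ m h, q.map m (Q.map m h) = q.map m h
  Q_Q : ∀ m h, Q.map m (Q.map m h) = Q.map m h
  Q_D : ∀ m X, Q.map m (D.map m X) = D.map m X

namespace Transfer

variable {E F E' F' : ScSpace.{u}} {P : ScOp E E} {Q : ScOp F F} {D : ScOp E F}
    {P' : ScOp E' E'} {T : ScOp E' F'} {i : ℕ}

theorem P_P (A : Transfer P Q D P' T) (X : E.L i) : P.map i (P.map i X) = P.map i X := by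
  rw [← A.a_a' i X, A.P_a]

/-- The hypothesis `hA` says that vectors mapped by `T` into the fibre are tangent to the retract.
For such `Z` the identity `T Z = q (D (a Z))` holds, and `q'` recovers `D (a Z)` from it. -/
theorem solve (A : Transfer P Q D P' T) (hA : ∀ Z k, T.map i Z = A.q.map i k → P'.map i Z = Z) {Z : E'.L i}
    {k : F.L i} (h : T.map i Z = A.q.map i k) : D.map i (A.a.map i Z) = Q.map i k := by
  rw [← A.Q_D, ← A.q'_q i k, ← h, ← A.q'_q, ← A.T_P', hA Z k h]

theorem T_a' (A : Transfer P Q D P' T) {X : E.L i} (hX : X ∈ range (P.map i)) :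
    T.map i (P'.map i (A.a'.map i X)) = A.q.map i (D.map i X) := by
  obtain ⟨X, rfl⟩ := hX
  rw [A.T_P', A.a_a', A.P_P]

theorem mapsLevelOnto (A : Transfer P Q D P' T) (hT : Function.Surjective (T.map i))
    (hA : ∀ Z k, T.map i Z = A.q.map i k → P'.map i Z = Z) : MapsLevelOnto P Q D i := by
  apply subset_antisymm
  · rintro _ ⟨X, -, rfl⟩
    exact ⟨_, A.Q_D i X⟩
  · rintro _ ⟨k, rfl⟩
    obtain ⟨Z, hZ⟩ := hT (A.q.map i k)
    exact ⟨A.a.map i Z, ⟨_, A.P_a i Z⟩, A.solve hA hZ⟩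

/-- The inverse of `D` between the images of `P` and `Q` is `a ∘ T⁻¹ ∘ q`: a solution for `T` with
right-hand side in the fibre is automatically tangent. -/
theorem inverse_aux (A : Transfer P Q D P' T) (hT : Function.Injective (T.map i))
    (hA : ∀ Z k, T.map i Z = A.q.map i k → P'.map i Z = Z) {B : F'.L i → E'.L i}
    (hB : ∀ y, T.map i (B y) = y) :
    (∀ X ∈ range (P.map i), D.map i X ∈ range (Q.map i) ∧
      A.a.map i (B (A.q.map i (D.map i X))) = X) ∧
    ∀ h ∈ range (Q.map i), A.a.map i (B (A.q.map i h)) ∈ range (P.map i) ∧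
      D.map i (A.a.map i (B (A.q.map i h))) = h := by
  refine ⟨fun X hX => ⟨⟨_, A.Q_D i X⟩, ?_⟩, ?_⟩
  · rw [← A.T_a' hX, hT (hB (T.map i (P'.map i (A.a'.map i X)))), A.a_P', A.a_a']
    obtain ⟨X, rfl⟩ := hX
    exact A.P_P X
  · rintro _ ⟨k, rfl⟩
    refine ⟨⟨_, A.P_a i _⟩, ?_⟩
    rw [A.solve hA (hB _), A.Q_Q]

theorem isIsoOnLevelBetween (A : Transfer P Q D P' T) (hT : Function.Bijective (T.map i))
    (hA : ∀ Z k, T.map i Z = A.q.map i k → P'.map i Z = Z) : IsIsoOnLevelBetween P Q D i := by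
  obtain ⟨B, hB⟩ := ScOp.isIsoOnLevel_iff.2 hT
  exact ⟨(A.a.map i).comp ((B.symm : F'.L i →L[ℝ] E'.L i).comp (A.q.map i)),
    A.inverse_aux hT.1 hA (B := B.symm) fun y => by
      rw [← hB]; exact B.apply_symm_apply y⟩

theorem isScIsoBetween (A : Transfer P Q D P' T) (hT : ∀ m, Function.Bijective (T.map m))
    (hA : ∀ m, ∀ Z k, T.map m Z = A.q.map m k → P'.map m Z = Z) : IsScIsoBetween P Q D := by
  obtain ⟨B, rfl⟩ := ScOp.isScIso_iff.2 hT
  exact ⟨A.a.comp (B.bwd.comp A.q), fun m => A.inverse_aux (hT m).1 (hA m) (B.right_inv m)⟩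

/-- On tangent vectors `T` is `q ∘ D ∘ a`, so surjectivity of `D` puts the whole fibre in the range
of `T`. -/
theorem mem_range_of_mapsLevelOnto (A : Transfer P Q D P' T) (h : MapsLevelOnto P Q D i) (w : F'.L i) :
    A.q.map i (A.q'.map i w) ∈ range (T.map i) := by
  have h1 : Q.map i (A.q'.map i w) ∈ range (Q.map i) := ⟨_, rfl⟩
  rw [← h] at h1
  obtain ⟨X, hX, hXw⟩ := h1
  exact ⟨_, by rw [A.T_a' hX, hXw, A.q_Q]⟩

/-- A kernel vector of `T` is mapped into the fibre, hence is tangent; there `T` is described by the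
injective operator `D`. -/
theorem injective_of_isIsoOnLevelBetween (A : Transfer P Q D P' T)
    (h : IsIsoOnLevelBetween P Q D i) (hA : ∀ Z k, T.map i Z = A.q.map i k → P'.map i Z = Z) :
    Function.Injective (T.map i) := by
  obtain ⟨B, hB, -⟩ := h
  refine (injective_iff_map_eq_zero (T.map i)).2 fun Z hZ => ?_
  have h0 : T.map i Z = A.q.map i 0 := by rw [hZ, map_zero]
  have h1 := A.solve hA h0
  have h2 := (hB (A.a.map i Z) ⟨_, A.P_a i Z⟩).2
  rw [h1, map_zero, map_zero] at h2
  rw [← hA Z 0 h0, ← A.a'_a, ← h2, map_zero]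

end Transfer

theorem IsIsoOnLevelBetween.mapsLevelOnto {E F : ScSpace.{u}} {P : ScOp E E} {Q : ScOp F F}
    {D : ScOp E F} {i : ℕ} (h : IsIsoOnLevelBetween P Q D i) : MapsLevelOnto P Q D i := by
  obtain ⟨B, h1, h2⟩ := h
  apply subset_antisymm
  · rintro _ ⟨X, hX, rfl⟩
    exact (h1 X hX).1
  · intro k hk
    exact ⟨B k, (h2 k hk).1, (h2 k hk).2⟩

theorem IsScIsoBetween.isIsoOnLevelBetween {E F : ScSpace.{u}} {P : ScOp E E} {Q : ScOp F F}
    {D : ScOp E F} (h : IsScIsoBetween P Q D) (i : ℕ) : IsIsoOnLevelBetween P Q D i := by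
  obtain ⟨A, hA⟩ := h
  exact ⟨A.map i, hA i⟩

/-! ### Models and charts -/

namespace StrongModel

variable (M : StrongModel.{u})

theorem fat : Fat M.U := Fat.of_relOpen M.relOpen M.C.fat

/-- The differential of the retraction. -/
noncomputable def Dr := M.r_smooth.exists_sc1.choose

theorem hr : Sc1 M.U M.r M.Dr := M.r_smooth.exists_sc1.choose_spec.1

/-- The differential of the family of fibre projections. -/
noncomputable def DΓ := M.Γ_strong.1.exists_sc1.choose

theorem hΓ : Sc1 (E := M.E.prod M.F) (M.U ×ˢ univ) M.Γ M.DΓ := M.Γ_strong.1.exists_sc1.choose_spec.1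

theorem Γ_lin : ∀ x ∈ M.U, IsLinearMap ℝ (fun h : M.F.L 0 => M.Γ 0 (x, h)) := M.Γ_strong.2.1

theorem hasScDeriv_r (e : M.E.Smooth) (he : e.1 0 ∈ M.U) : HasScDeriv M.r M.U e (M.hr.op e he) :=
  fun m => M.r_smooth.exists_sc1.choose_spec.2 m _ (smooth_mem_lev.2 he)

variable {M}

theorem O_subset : M.O ⊆ M.U := by
  rintro _ ⟨y, hy, rfl⟩
  exact M.r_mapsTo hy

theorem r_of_mem_O {y : M.E.L 0} (h : y ∈ M.O) : M.r 0 y = y := by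
  obtain ⟨y, hy, rfl⟩ := h
  exact M.r_idem y hy

theorem r_smooth_val {e : M.E.Smooth} (h : e.1 0 ∈ M.O) (m : ℕ) : M.r m (e.1 m) = e.1 m := by
  apply down_injective m
  rw [M.hr.cont.down (smooth_mem_lev.2 (O_subset h)), down_smooth, r_of_mem_O h]

end StrongModel

namespace StrongChart

variable {X : Type v} [TopologicalSpace X] {Y : X → Type w} [∀ x, AddCommGroup (Y x)]
  [∀ x, Module ℝ (Y x)] [TopologicalSpace (Bundle.TotalSpace Unit Y)]

section

variable (c : StrongChart.{u} X Y)

theorem φ_mem {x : X} (hx : x ∈ c.dom) : c.φ x ∈ c.M.O := by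
  rw [← c.φ_image]; exact mem_image_of_mem _ hx

theorem φ_mem_U {x : X} (hx : x ∈ c.dom) : c.φ x ∈ c.M.U := StrongModel.O_subset (c.φ_mem hx)

theorem r_φ {x : X} (hx : x ∈ c.dom) : c.M.r 0 (c.φ x) = c.φ x := StrongModel.r_of_mem_O (c.φ_mem hx)

theorem φ_inj {x x' : X} (hx : x ∈ c.dom) (hx' : x' ∈ c.dom) (h : c.φ x = c.φ x') : x = x' :=
  congrArg Subtype.val (c.φ_embedding.injective (a₁ := ⟨x, hx⟩) (a₂ := ⟨x', hx'⟩) h)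

theorem Γ_Φ {x : X} (hx : x ∈ c.dom) (η : Y x) : c.M.Γ 0 (c.φ x, c.Φ x η) = c.Φ x η := by
  have : c.Φ x η ∈ {h | c.M.Γ 0 (c.φ x, h) = h} := by rw [← c.Φ_range x hx]; exact ⟨η, rfl⟩
  exact this

theorem exists_Φ {x : X} (hx : x ∈ c.dom) {y : c.M.E.L 0} (hy : y ∈ c.M.U) (hxy : c.φ x = c.M.r 0 y)
    (h : c.M.F.L 0) : ∃ η, c.Φ x η = c.M.Γ 0 (y, h) := by
  have : c.M.Γ 0 (y, h) ∈ {h | c.M.Γ 0 (c.φ x, h) = h} := by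
    rw [hxy]; exact c.M.Γ_idem y hy h
  rw [← c.Φ_range x hx] at this
  exact this

/-- The part of the domain of the retraction lying over a subset of the base. -/
def pre (N : Set X) : Set (c.M.E.L 0) := {y ∈ c.M.U | c.M.r 0 y ∈ c.φ '' N}

theorem pre_subset (N : Set X) : c.pre N ⊆ c.M.U := fun _ h => h.1

theorem φ_mem_pre {N : Set X} (hN : N ⊆ c.dom) {x : X} (hx : x ∈ N) : c.φ x ∈ c.pre N :=
  ⟨c.φ_mem_U (hN hx), x, hx, (c.r_φ (hN hx)).symm⟩

theorem r_mapsTo_pre (N : Set X) : MapsTo (c.M.r 0) (c.pre N) (c.pre N) := fun y hy =>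
  ⟨c.M.r_mapsTo hy.1, by rw [c.M.r_idem _ hy.1]; exact hy.2⟩

theorem exists_isOpen_image {N : Set X} (hN : IsOpen N) (hNc : N ⊆ c.dom) :
    IsRelOpen c.M.O (c.φ '' N) := by
  have h1 : IsOpen ((↑) ⁻¹' N : Set c.dom) := hN.preimage continuous_subtype_val
  obtain ⟨Ω, hΩ, h⟩ := c.φ_embedding.isOpen_iff.1 h1
  refine ⟨Ω, hΩ, ?_⟩
  ext y
  constructor
  · rintro ⟨x, hx, rfl⟩
    refine ⟨c.φ_mem (hNc hx), ?_⟩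
    have : (⟨x, hNc hx⟩ : c.dom) ∈ ((↑) ⁻¹' N : Set c.dom) := hx
    rw [← h] at this
    exact this
  · rintro ⟨hy, hyΩ⟩
    rw [← c.φ_image] at hy
    obtain ⟨x, hx, rfl⟩ := hy
    have : (⟨x, hx⟩ : c.dom) ∈ (fun x : c.dom => c.φ x) ⁻¹' Ω := hyΩ
    rw [h] at this
    exact ⟨x, this, rfl⟩

theorem relOpen_pre {N : Set X} (hN : IsOpen N) (hNc : N ⊆ c.dom) : IsRelOpen c.M.U (c.pre N) :=
  IsRelOpen.preimage ⟨univ, isOpen_univ, by simp⟩ (c.exists_isOpen_image hN hNc) (c.M.hr.cont.1 0)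
    fun y hy => ⟨y, hy, rfl⟩

theorem fat_pre {N : Set X} (hN : IsOpen N) (hNc : N ⊆ c.dom) : Fat (c.pre N) :=
  Fat.of_relOpen (c.relOpen_pre hN hNc) c.M.fat

end

/-- The transition map between two trivializations, over a subset `N` of the base. -/
structure Trans (c c' : StrongChart.{u} X Y) (N : Set X) where
  t : ScFam c.M.E c'.M.E
  Dt : ∀ m, c.M.E.L (m + 1) → (c.M.E.L m →L[ℝ] c'.M.E.L m)
  ht : Sc1 (c.pre N) t Dt
  G : ScFam (c.M.E.prod c.M.F) c'.M.F
  DG : ∀ m, (c.M.E.prod c.M.F).L (m + 1) → ((c.M.E.prod c.M.F).L m →L[ℝ] c'.M.F.L m)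
  hG : Sc1 (E := c.M.E.prod c.M.F) (c.pre N ×ˢ univ) G DG
  G_lin : ∀ x ∈ c.pre N, IsLinearMap ℝ (fun h : c.M.F.L 0 => G 0 (x, h))
  G₁ : ScFam (c.M.E.prod c.M.F.shift) c'.M.F.shift
  DG₁ : ∀ m, (c.M.E.prod c.M.F.shift).L (m + 1) →
    ((c.M.E.prod c.M.F.shift).L m →L[ℝ] c'.M.F.shift.L m)
  hG₁ : Sc1 (E := c.M.E.prod c.M.F.shift) (c.pre N ×ˢ univ) G₁ DG₁
  incl_G₁ : ∀ x ∈ c.pre N, ∀ h : c.M.F.L 1, c'.M.F.incl 0 (G₁ 0 (x, h)) = G 0 (x, c.M.F.incl 0 h)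
  t_eq : ∀ y ∈ c.M.U, ∀ x ∈ N, c.φ x = c.M.r 0 y → t 0 y = c'.φ x
  G_eq : ∀ y ∈ c.M.U, ∀ x ∈ N, c.φ x = c.M.r 0 y → ∀ (h : c.M.F.L 0) (η : Y x),
    c.Φ x η = c.M.Γ 0 (y, h) → G 0 (y, h) = c'.Φ x η

variable {c c' c'' : StrongChart.{u} X Y} {N : Set X}

theorem Transition.exists_trans (h : c.Transition c') (hN : N ⊆ c.dom ∩ c'.dom) :
    Nonempty (Trans c c' N) := by
  obtain ⟨t, G, ht, ⟨hG, hGl, G₁, hG₁, hGG⟩, hspec⟩ := h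
  obtain ⟨Dt, ht, -⟩ := ht.exists_sc1
  obtain ⟨DG, hG, -⟩ := hG.exists_sc1
  obtain ⟨DG₁, hG₁, -⟩ := hG₁.exists_sc1
  have hsub : c.pre N ⊆ {y ∈ c.M.U | c.M.r 0 y ∈ c.φ '' (c.dom ∩ c'.dom)} := fun y hy =>
    ⟨hy.1, image_mono hN hy.2⟩
  exact ⟨⟨t, Dt, ht.mono hsub, G, DG, hG.mono (prod_mono hsub subset_rfl), fun x hx => hGl x (hsub hx),
    G₁, DG₁, hG₁.mono (prod_mono hsub subset_rfl), fun x hx => hGG x (hsub hx),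
    fun y hy x hx hxy => (hspec y hy x (hN hx) hxy).1,
    fun y hy x hx hxy => (hspec y hy x (hN hx) hxy).2⟩⟩

namespace Trans

theorem mapsTo (A : Trans c c' N) (hN : N ⊆ c'.dom) : MapsTo (A.t 0) (c.pre N) (c'.pre N) := by
  rintro y ⟨hy, x, hx, hxy⟩
  rw [A.t_eq y hy x hx hxy]
  exact c'.φ_mem_pre hN hx

/-- Composition of transition maps. -/
noncomputable def comp (B : Trans c' c'' N) (A : Trans c c' N) (hN' : N ⊆ c'.dom) :
    Trans c c'' N where
  t m y := B.t m (A.t m y)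
  Dt := _
  ht := B.ht.comp A.ht (A.mapsTo hN')
  G m p := B.G m (A.t m p.1, A.G m p)
  DG := _
  hG := (A.ht.comp (Sc1.ofOp (⟨fun m => ContinuousLinearMap.fst ℝ _ _, fun _ _ => rfl⟩ :
    ScOp (c.M.E.prod c.M.F) c.M.E) (c.pre N ×ˢ univ)) fun p hp => hp.1).pair
      (fun p hp => A.mapsTo hN' hp.1) A.hG B.hG
  G_lin x hx := ((B.G_lin _ (A.mapsTo hN' hx)).mk'.comp (A.G_lin x hx).mk').isLinear
  G₁ m p := B.G₁ m (A.t m p.1, A.G₁ m p)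
  DG₁ := _
  hG₁ := (A.ht.comp (Sc1.ofOp (⟨fun m => ContinuousLinearMap.fst ℝ _ _, fun _ _ => rfl⟩ :
    ScOp (c.M.E.prod c.M.F.shift) c.M.E) (c.pre N ×ˢ univ)) fun p hp => hp.1).pair
      (fun p hp => A.mapsTo hN' hp.1) A.hG₁ B.hG₁
  incl_G₁ x hx h := by
    rw [B.incl_G₁ _ (A.mapsTo hN' hx), A.incl_G₁ x hx]
  t_eq y hy x hx hxy := by
    rw [A.t_eq y hy x hx hxy]
    exact B.t_eq _ (c'.φ_mem_U (hN' hx)) x hx (c'.r_φ (hN' hx)).symm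
  G_eq y hy x hx hxy h η hη := by
    show B.G 0 (A.t 0 y, A.G 0 (y, h)) = _
    rw [A.t_eq y hy x hx hxy, A.G_eq y hy x hx hxy h η hη]
    exact B.G_eq _ (c'.φ_mem_U (hN' hx)) x hx (c'.r_φ (hN' hx)).symm _ η (c'.Γ_Φ (hN' hx) η).symm

end Trans

end StrongChart

/-! ### A filled section and the section in another trivialization -/

section

variable {X : Type v} [TopologicalSpace X] {Y : X → Type w} [∀ x, AddCommGroup (Y x)]
  [∀ x, Module ℝ (Y x)] [TopologicalSpace (Bundle.TotalSpace Unit Y)]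

/-- A local representative `f` of the section `σ` in the trivialization `c`, and a map `g` extending the
principal part of `σ` in the trivialization `b`, together with the transition maps over an open set `N`. -/
structure FilledPair (b c : StrongChart.{u} X Y) (σ : ∀ x, Y x) (N : Set X) where
  isOpen : IsOpen N
  hb : N ⊆ b.dom
  hc : N ⊆ c.dom
  tr : b.Trans c N
  tr' : c.Trans b N
  f : ScFam c.M.E c.M.F
  Df : ∀ m, c.M.E.L (m + 1) → (c.M.E.L m →L[ℝ] c.M.F.L m)
  hf : Sc1 c.M.U f Df
  f_deriv : ∀ (e : c.M.E.Smooth) (he : e.1 0 ∈ c.M.U), HasScDeriv f c.M.U e (hf.op e he)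
  f_rep : c.IsLocalRep σ f
  g : ScFam b.M.E b.M.F
  Dg : ∀ m, b.M.E.L (m + 1) → (b.M.E.L m →L[ℝ] b.M.F.L m)
  hg : Sc1 b.M.U g Dg
  g_eq : ∀ x ∈ b.dom, g 0 (b.φ x) = b.Φ x (σ x)

namespace FilledPair

variable {b c : StrongChart.{u} X Y} {σ : ∀ x, Y x} {N : Set X} (A : FilledPair b c σ N)

/-- The fibres of the trivialization `c`, mapped to those of `b`. -/
noncomputable def q : ScFam (b.M.E.prod c.M.F) b.M.F := fun m p => A.tr'.G m (A.tr.t m p.1, p.2)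

/-- The differential of `q`. -/
noncomputable def Dq (m : ℕ) (p : (b.M.E.prod c.M.F).L (m + 1)) :
    (b.M.E.prod c.M.F).L m →L[ℝ] b.M.F.L m :=
  (A.tr'.DG m (A.tr.t (m + 1) p.1, p.2)).comp (((A.tr.Dt m p.1).comp
    (ContinuousLinearMap.fst ℝ (b.M.E.L m) (c.M.F.L m))).prod
    (ContinuousLinearMap.snd ℝ (b.M.E.L m) (c.M.F.L m)))

theorem hq : Sc1 (E := b.M.E.prod c.M.F) (b.pre N ×ˢ univ) A.q A.Dq :=
  (A.tr.ht.comp (Sc1.ofOp (⟨fun _ => ContinuousLinearMap.fst ℝ _ _, fun _ _ => rfl⟩ :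
    ScOp (b.M.E.prod c.M.F) b.M.E) (b.pre N ×ˢ univ)) fun _ hp => hp.1).pair
      (fun _ hp => A.tr.mapsTo A.hc hp.1) (Sc1.ofOp (⟨fun _ => ContinuousLinearMap.snd ℝ _ _,
        fun _ _ => rfl⟩ : ScOp (b.M.E.prod c.M.F) c.M.F) (b.pre N ×ˢ univ)) A.tr'.hG

theorem q_lin : ∀ x ∈ b.pre N, IsLinearMap ℝ (fun h : c.M.F.L 0 => A.q 0 (x, h)) := fun _ hx =>
  A.tr'.G_lin _ (A.tr.mapsTo A.hc hx)

theorem exists_strong_q : ∃ (q₁ : ScFam (b.M.E.prod c.M.F.shift) b.M.F.shift) (Dq₁ : _),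
    Sc1 (E := b.M.E.prod c.M.F.shift) (b.pre N ×ˢ univ) q₁ Dq₁ ∧
    ∀ x ∈ b.pre N, ∀ h : c.M.F.L 1, b.M.F.incl 0 (q₁ 0 (x, h)) = A.q 0 (x, c.M.F.incl 0 h) :=
  ⟨fun m p => A.tr'.G₁ m (A.tr.t m p.1, p.2), _,
    (A.tr.ht.comp (Sc1.ofOp (⟨fun _ => ContinuousLinearMap.fst ℝ _ _, fun _ _ => rfl⟩ :
    ScOp (b.M.E.prod c.M.F.shift) b.M.E) (b.pre N ×ˢ univ)) fun _ hp => hp.1).pair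
      (fun _ hp => A.tr.mapsTo A.hc hp.1) (Sc1.ofOp (⟨fun _ => ContinuousLinearMap.snd ℝ _ _,
        fun _ _ => rfl⟩ : ScOp (b.M.E.prod c.M.F.shift) c.M.F.shift) (b.pre N ×ˢ univ)) A.tr'.hG₁,
    fun _ hx h => A.tr'.incl_G₁ _ (A.tr.mapsTo A.hc hx) h⟩

/-! ### Identities between the maps -/

/-- Both sides represent the same vector `η` of the bundle. The identities below between
retractions, projections and transition maps are read off from such points and vectors. -/
theorem q_eq {y : b.M.E.L 0} (hy : y ∈ b.M.U) {x : X} (hx : x ∈ N) (hxy : b.φ x = b.M.r 0 y)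
    {h : c.M.F.L 0} {η : Y x} (hη : c.Φ x η = c.M.Γ 0 (c.φ x, h)) : A.q 0 (y, h) = b.Φ x η := by
  show A.tr'.G 0 (A.tr.t 0 y, h) = _
  rw [A.tr.t_eq y hy x hx hxy]
  exact A.tr'.G_eq _ (c.φ_mem_U (A.hc hx)) x hx (c.r_φ (A.hc hx)).symm h η hη

theorem exists_η (A : FilledPair b c σ N) {x : X} (hx : x ∈ N) (h : c.M.F.L 0) :
    ∃ η, c.Φ x η = c.M.Γ 0 (c.φ x, h) :=
  c.exists_Φ (A.hc hx) (c.φ_mem_U (A.hc hx)) (c.r_φ (A.hc hx)).symm h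

theorem t_r {y : b.M.E.L 0} (hy : y ∈ b.pre N) : A.tr.t 0 (b.M.r 0 y) = A.tr.t 0 y := by
  obtain ⟨hy, x, hx, hxy⟩ := hy
  rw [A.tr.t_eq y hy x hx hxy, A.tr.t_eq _ (b.M.r_mapsTo hy) x hx (by rw [b.M.r_idem y hy, hxy])]

theorem r_t {y : b.M.E.L 0} (hy : y ∈ b.pre N) : c.M.r 0 (A.tr.t 0 y) = A.tr.t 0 y := by
  obtain ⟨hy, x, hx, hxy⟩ := hy
  rw [A.tr.t_eq y hy x hx hxy, c.r_φ (A.hc hx)]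

theorem t'_t {y : b.M.E.L 0} (hy : y ∈ b.pre N) : A.tr'.t 0 (A.tr.t 0 y) = b.M.r 0 y := by
  obtain ⟨hy, x, hx, hxy⟩ := hy
  rw [A.tr.t_eq y hy x hx hxy, A.tr'.t_eq _ (c.φ_mem_U (A.hc hx)) x hx (c.r_φ (A.hc hx)).symm, hxy]

theorem t_t' {y : c.M.E.L 0} (hy : y ∈ c.pre N) : A.tr.t 0 (A.tr'.t 0 y) = c.M.r 0 y := by
  obtain ⟨hy, x, hx, hxy⟩ := hy
  rw [A.tr'.t_eq y hy x hx hxy, A.tr.t_eq _ (b.φ_mem_U (A.hb hx)) x hx (b.r_φ (A.hb hx)).symm, hxy]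

theorem Γ_q {y : b.M.E.L 0} (hy : y ∈ b.pre N) (h : c.M.F.L 0) :
    b.M.Γ 0 (b.M.r 0 y, A.q 0 (y, h)) = A.q 0 (y, h) := by
  obtain ⟨hy, x, hx, hxy⟩ := hy
  obtain ⟨η, hη⟩ := A.exists_η hx h
  rw [A.q_eq hy hx hxy hη, ← hxy, b.Γ_Φ (A.hb hx)]

theorem q_r {y : b.M.E.L 0} (hy : y ∈ b.pre N) (h : c.M.F.L 0) :
    A.q 0 (b.M.r 0 y, h) = A.q 0 (y, h) := by
  show A.tr'.G 0 (A.tr.t 0 _, h) = A.tr'.G 0 (A.tr.t 0 y, h)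
  rw [A.t_r hy]

theorem g_r {y : b.M.E.L 0} (hy : y ∈ b.pre N) :
    A.g 0 (b.M.r 0 y) = A.q 0 (y, A.f 0 (A.tr.t 0 y)) := by
  obtain ⟨hy, x, hx, hxy⟩ := hy
  rw [← hxy, A.g_eq x (A.hb hx), A.tr.t_eq y hy x hx hxy, A.q_eq hy hx hxy (η := σ x)]
  rw [A.f_rep.2 _ (c.φ_mem_U (A.hc hx)) x (A.hc hx) (c.r_φ (A.hc hx)).symm, c.Γ_Φ (A.hc hx)]

theorem G_q {x : X} (hx : x ∈ N) (h : c.M.F.L 0) :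
    A.tr.G 0 (b.φ x, A.q 0 (b.φ x, h)) = c.M.Γ 0 (c.φ x, h) := by
  obtain ⟨η, hη⟩ := A.exists_η hx h
  have hU := b.φ_mem_U (A.hb hx)
  have hr := (b.r_φ (A.hb hx)).symm
  rw [A.q_eq hU hx hr hη, A.tr.G_eq _ hU x hx hr _ η (b.Γ_Φ (A.hb hx) η).symm, hη]

theorem q_Γ {x : X} (hx : x ∈ N) (h : c.M.F.L 0) :
    A.q 0 (b.φ x, c.M.Γ 0 (c.φ x, h)) = A.q 0 (b.φ x, h) := by
  obtain ⟨η, hη⟩ := A.exists_η hx h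
  have hU := b.φ_mem_U (A.hb hx)
  have hr := (b.r_φ (A.hb hx)).symm
  rw [A.q_eq hU hx hr hη, A.q_eq hU hx hr (η := η)]
  rw [← hη, c.Γ_Φ (A.hc hx)]

theorem q_G {x : X} (hx : x ∈ N) (h : b.M.F.L 0) :
    A.q 0 (b.φ x, A.tr.G 0 (b.φ x, h)) = b.M.Γ 0 (b.φ x, h) := by
  have hU := b.φ_mem_U (A.hb hx)
  have hr := (b.r_φ (A.hb hx)).symm
  obtain ⟨η, hη⟩ := b.exists_Φ (A.hb hx) hU hr h
  rw [A.tr.G_eq _ hU x hx hr h η hη, A.q_eq hU hx hr (c.Γ_Φ (A.hc hx) η).symm, hη]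

/-! ### Linearization at a smooth point -/

variable {x : X} {e' : b.M.E.Smooth} {e : c.M.E.Smooth}

theorem Γ_idem_φ {c : StrongChart.{u} X Y} {x : X} (hx : x ∈ c.dom) (h : c.M.F.L 0) :
    c.M.Γ 0 (c.φ x, c.M.Γ 0 (c.φ x, h)) = c.M.Γ 0 (c.φ x, h) := by
  have := c.M.Γ_idem _ (c.φ_mem_U hx) h
  rwa [c.r_φ hx] at this

theorem mem_pre' (A : FilledPair b c σ N) (hx : x ∈ N) (he' : e'.1 0 = b.φ x) : e'.1 0 ∈ b.pre N := by
  rw [he']; exact b.φ_mem_pre A.hb hx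

theorem mem_pre (A : FilledPair b c σ N) (hx : x ∈ N) (he : e.1 0 = c.φ x) : e.1 0 ∈ c.pre N := by
  rw [he]; exact c.φ_mem_pre A.hc hx

theorem t_val (hx : x ∈ N) (he' : e'.1 0 = b.φ x) (he : e.1 0 = c.φ x) (m : ℕ) :
    A.tr.t m (e'.1 m) = e.1 m := by
  apply down_injective m
  rw [A.tr.ht.cont.down (smooth_mem_lev.2 (A.mem_pre' hx he')), down_smooth, down_smooth, he', he]
  exact A.tr.t_eq _ (b.φ_mem_U (A.hb hx)) x hx (b.r_φ (A.hb hx)).symm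

theorem t'_val (hx : x ∈ N) (he' : e'.1 0 = b.φ x) (he : e.1 0 = c.φ x) (m : ℕ) :
    A.tr'.t m (e.1 m) = e'.1 m := by
  apply down_injective m
  rw [A.tr'.ht.cont.down (smooth_mem_lev.2 (A.mem_pre hx he)), down_smooth, down_smooth, he', he]
  exact A.tr'.t_eq _ (c.φ_mem_U (A.hc hx)) x hx (c.r_φ (A.hc hx)).symm

theorem r_val {c : StrongChart.{u} X Y} {x : X} {e : c.M.E.Smooth} (hx : x ∈ c.dom)
    (he : e.1 0 = c.φ x) (m : ℕ) : c.M.r m (e.1 m) = e.1 m :=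
  StrongModel.r_smooth_val (by rw [he]; exact c.φ_mem hx) m

/-- The value of the local representative at a smooth point. -/
noncomputable def val (e : c.M.E.Smooth) : c.M.F.Smooth := A.hf.cont.app e

theorem val_val (hx : x ∈ N) (he : e.1 0 = c.φ x) (m : ℕ) : (A.val e).1 m = A.f m (e.1 m) :=
  A.hf.cont.app_val (by rw [he]; exact c.φ_mem_U (A.hc hx)) m

theorem g_e' (hx : x ∈ N) (he' : e'.1 0 = b.φ x) (he : e.1 0 = c.φ x) :
    A.g 0 (e'.1 0) = A.q 0 (e'.1 0, (A.val e).1 0) := by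
  have h := A.g_r (A.mem_pre' hx he')
  rw [r_val (A.hb hx) he' 0, A.t_val hx he' he 0, ← A.val_val hx he] at h
  exact h

theorem hg' : Sc1 (b.pre N) A.g A.Dg := A.hg.mono (b.pre_subset N)

/-- The linearization of the filled section, in the trivialization `b`. -/
noncomputable def T (hx : x ∈ N) (he' : e'.1 0 = b.φ x) (e : c.M.E.Smooth) : ScOp b.M.E b.M.F :=
  linFam A.hg' A.hq e' (A.mem_pre' hx he') (A.val e)

theorem fat_b (A : FilledPair b c σ N) : Fat (b.pre N) := b.fat_pre A.isOpen A.hb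

theorem fat_c (A : FilledPair b c σ N) : Fat (c.pre N) := c.fat_pre A.isOpen A.hc

theorem hr_b : Sc1 (b.pre N) b.M.r b.M.Dr := b.M.hr.mono (b.pre_subset N)

theorem hr_c : Sc1 (c.pre N) c.M.r c.M.Dr := c.M.hr.mono (c.pre_subset N)

/-- The linearization of the family `y ↦ g y - q (y, h)` is that of the family composed with `r`, in the
directions tangent to the retract. -/
theorem T_P' (hx : x ∈ N) (he' : e'.1 0 = b.φ x) (he : e.1 0 = c.φ x) (m : ℕ) (Z : b.M.E.L m) :
    (A.T hx he' e).map m (b.M.Dr m (e'.1 (m + 1)) Z) =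
      A.q m (e'.1 m, A.Df m (e.1 (m + 1)) (A.tr.Dt m (e'.1 (m + 1)) Z)) := by
  have hm := A.mem_pre' hx he'
  have hft := A.hf.comp A.tr.ht fun y hy => c.pre_subset N (A.tr.mapsTo A.hc hy)
  have h1 := (A.hg'.sub (A.hq.slice (A.val e))).comp hr_b (b.r_mapsTo_pre N)
  have h2 := (Sc1.ofOp (ScOp.id _) (b.pre N)).pair (fun _ hy => hy)
    (hft.sub (Sc1.const (A.val e) (b.pre N))) A.hq
  -- Over the retract `g` is the principal part of the section, so `g (r y) - q (r y, h) = q (y, f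
  -- (t y) - h)`. At the point in question the fibre argument on the right vanishes, and only the
  -- fibre operator survives differentiation.
  have h3 := h1.unique h2 (fun y hy => by
    show A.g 0 (b.M.r 0 y) - A.q 0 (b.M.r 0 y, _) = A.q 0 (y, A.f 0 (A.tr.t 0 y) - _)
    rw [A.q_r hy, A.g_r hy]
    exact ((A.q_lin y hy).map_sub _ _).symm) A.fat_b hm m
  have h4 := congrArg (fun B => B Z) h3
  have h5 : A.f (m + 1) (A.tr.t (m + 1) (e'.1 (m + 1))) - (A.val e).1 (m + 1) = 0 := by
    rw [A.t_val hx he' he, A.val_val hx he, sub_self]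
  rw [r_val (A.hb hx) he'] at h4
  refine h4.trans ?_
  show A.Dq m (e'.1 (m + 1), A.f (m + 1) (A.tr.t (m + 1) (e'.1 (m + 1))) - (A.val e).1 (m + 1))
    (Z, A.Df m (A.tr.t (m + 1) (e'.1 (m + 1))) (A.tr.Dt m (e'.1 (m + 1)) Z) - 0) = _
  rw [h5, A.hq.fibre_zero A.q_lin A.fat_b hm, A.t_val hx he' he, sub_zero]

/-- The fibre projection of the trivialization `c` at the point `e`. -/
noncomputable def _root_.StrongChart.Q (c : StrongChart.{u} X Y) (e : c.M.E.Smooth) (he : e.1 0 ∈ c.M.U) :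
    ScOp c.M.F c.M.F := fibreOp c.M.hΓ.cont c.M.Γ_lin e he

theorem mem_U (A : FilledPair b c σ N) (hx : x ∈ N) (he : e.1 0 = c.φ x) : e.1 0 ∈ c.M.U :=
  c.pre_subset N (A.mem_pre hx he)

theorem mem_U' (A : FilledPair b c σ N) (hx : x ∈ N) (he' : e'.1 0 = b.φ x) : e'.1 0 ∈ b.M.U :=
  b.pre_subset N (A.mem_pre' hx he')

/-- The relation between the linearizations in the two trivializations. -/
noncomputable def transfer (hx : x ∈ N) (he' : e'.1 0 = b.φ x) (he : e.1 0 = c.φ x) :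
    Transfer (c.M.hr.op e (A.mem_U hx he)) (c.Q e (A.mem_U hx he))
      ((c.Q e (A.mem_U hx he)).comp (A.hf.op e (A.mem_U hx he))) (b.M.hr.op e' (A.mem_U' hx he'))
      (A.T hx he' e) := by
  have hm' := A.mem_pre' hx he'
  have hm := A.mem_pre hx he
  have hQQ : ∀ m h, (c.Q e (A.mem_U hx he)).map m ((c.Q e (A.mem_U hx he)).map m h) =
      (c.Q e (A.mem_U hx he)).map m h := fun m h => by
    apply down_injective m
    rw [ScOp.down_map, ScOp.down_map]
    show c.M.Γ 0 (e.1 0, c.M.Γ 0 (e.1 0, _)) = c.M.Γ 0 (e.1 0, _)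
    rw [he]
    exact Γ_idem_φ (A.hc hx) _
  have hqQ : ∀ m h, (fibreOp A.hq.cont A.q_lin e' hm').map m ((c.Q e (A.mem_U hx he)).map m h) =
      (fibreOp A.hq.cont A.q_lin e' hm').map m h := fun m h => by
    apply down_injective m
    rw [ScOp.down_map, ScOp.down_map, ScOp.down_map]
    show A.q 0 (e'.1 0, c.M.Γ 0 (e.1 0, _)) = A.q 0 (e'.1 0, _)
    rw [he, he']
    exact A.q_Γ hx _
  exact
  { a := A.tr.ht.op e' hm'
    a' := A.tr'.ht.op e hm
    q := fibreOp A.hq.cont A.q_lin e' hm'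
    q' := fibreOp A.tr.hG.cont A.tr.G_lin e' hm'
    a_P' := fun m X => by
      have h := (A.tr.ht.comp hr_b (b.r_mapsTo_pre N)).unique A.tr.ht (fun y hy => A.t_r hy) A.fat_b hm' m
      rw [r_val (A.hb hx) he'] at h
      exact congrArg (fun B => B X) h
    P_a := fun m X => by
      have h := (hr_c.comp A.tr.ht (A.tr.mapsTo A.hc)).unique A.tr.ht (fun y hy => A.r_t hy) A.fat_b
        hm' m
      rw [A.t_val hx he' he] at h
      exact congrArg (fun B => B X) h
    a'_a := fun m X => by
      have h := (A.tr'.ht.comp A.tr.ht (A.tr.mapsTo A.hc)).unique hr_b (fun y hy => A.t'_t hy) A.fat_b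
        hm' m
      rw [A.t_val hx he' he] at h
      exact congrArg (fun B => B X) h
    a_a' := fun m X => by
      have h := (A.tr.ht.comp A.tr'.ht (A.tr'.mapsTo A.hb)).unique hr_c (fun y hy => A.t_t' hy) A.fat_c
        hm m
      rw [A.t'_val hx he' he] at h
      exact congrArg (fun B => B X) h
    T_P' := fun m X => by
      rw [ScOp.comp_map, hqQ]
      exact A.T_P' hx he' he m X
    q'_q := fun m h => by
      apply down_injective m
      rw [ScOp.down_map, ScOp.down_map, ScOp.down_map]
      show A.tr.G 0 (e'.1 0, A.q 0 (e'.1 0, _)) = c.M.Γ 0 (e.1 0, _)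
      rw [he, he']
      exact A.G_q hx _
    q_Q := hqQ
    Q_Q := hQQ
    Q_D := fun m X => hQQ m _ }

theorem transfer_q_q' (hx : x ∈ N) (he' : e'.1 0 = b.φ x) (he : e.1 0 = c.φ x) (m : ℕ)
    (h : b.M.F.L m) : (A.transfer hx he' he).q.map m ((A.transfer hx he' he).q'.map m h) =
    (b.Q e' (A.mem_U' hx he')).map m h := by
  apply down_injective m
  rw [ScOp.down_map, ScOp.down_map, ScOp.down_map]
  show A.q 0 (e'.1 0, A.tr.G 0 (e'.1 0, _)) = b.M.Γ 0 (e'.1 0, _)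
  rw [he']
  exact A.q_G hx _

/-- The linearization of `y ↦ g y - Γ (r y, g y)`. -/
theorem filling_deriv (hx : x ∈ N) (he' : e'.1 0 = b.φ x) (he : e.1 0 = c.φ x)
    {H : ScOp b.M.E b.M.F}
    (hH : HasScDeriv (fun m y => A.g m y - b.M.Γ m (b.M.r m y, A.g m y)) b.M.U e' H) (m : ℕ)
    (Z : b.M.E.L m) : H.map m Z = (A.T hx he' e).map m Z -
      (b.Q e' (A.mem_U' hx he')).map m ((A.T hx he' e).map m Z) := by
  have hm := A.mem_pre' hx he'
  have h1 := A.hg.sub (b.M.hr.pair (fun y hy => b.M.r_mapsTo hy) A.hg b.M.hΓ)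
  have h2 := A.hg'.sub (A.hq.slice (A.val e))
  have h3 := h2.sub (hr_b.pair (fun y hy => b.M.r_mapsTo hy.1) h2 b.M.hΓ)
  -- As `q (y, h)` lies in the fibre over `r y`, subtracting it from `g` does not change the part
  -- outside the fibre. After the subtraction the section vanishes at the point, and the derivative
  -- of `Γ` in the base drops out.
  have h4 := (h1.mono (b.pre_subset N)).unique h3 (fun y hy => by
    have e1 := (b.M.Γ_lin _ (b.M.r_mapsTo hy.1)).map_sub (A.g 0 y) (A.q 0 (y, (A.val e).1 0))
    show A.g 0 y - b.M.Γ 0 (b.M.r 0 y, A.g 0 y) = A.g 0 y - A.q 0 (y, (A.val e).1 0) -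
      b.M.Γ 0 (b.M.r 0 y, A.g 0 y - A.q 0 (y, (A.val e).1 0))
    rw [e1, A.Γ_q hy]
    abel) A.fat_b hm m
  rw [hH.eq h1 b.M.fat (b.pre_subset N hm), h4]
  have h5 : A.g (m + 1) (e'.1 (m + 1)) - A.q (m + 1) (e'.1 (m + 1), (A.val e).1 (m + 1)) = 0 := by
    apply down_injective (m + 1)
    rw [map_sub, A.hg'.cont.down (smooth_mem_lev.2 hm),
      A.hq.cont.down (x := (e'.1 (m + 1), (A.val e).1 (m + 1)))
        (mem_lev_prod.2 ⟨smooth_mem_lev.2 hm, mem_univ _⟩), prod_down, down_smooth, down_smooth,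
      A.g_e' hx he' he, sub_self, map_zero]
  show (A.T hx he' e).map m Z - b.M.DΓ m (b.M.r (m + 1) (e'.1 (m + 1)), A.g (m + 1) (e'.1 (m + 1)) -
    A.q (m + 1) (e'.1 (m + 1), (A.val e).1 (m + 1))) (b.M.Dr m (e'.1 (m + 1)) Z,
      (A.T hx he' e).map m Z) = _
  rw [h5, r_val (A.hb hx) he', b.M.hΓ.fibre_zero b.M.Γ_lin b.M.fat (b.pre_subset N hm)]
  rfl

end FilledPair

end

/-! ### Tameness, and sc-Fredholm points relative to a given trivialization -/

/-- Tameness provides strictly inward vectors tangent to the retract. -/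
theorem StrongModel.IsTame.exists_inward {M : StrongModel.{u}} (hM : M.IsTame) {e : M.E.Smooth}
    (he : e.1 0 ∈ M.O) : ∃ ν : M.E.Smooth, Inward M.U e ν ∧
      ∀ m, M.Dr m (e.1 (m + 1)) (ν.1 m) = ν.1 m := by
  obtain ⟨P, π, hP, hππ, hπP, hπ⟩ := hM.2 e he
  have heU := StrongModel.O_subset he
  have hPD : ∀ m, P.map m = M.Dr m (e.1 (m + 1)) := fun m => hP.eq M.hr M.fat heU m
  -- The sc-projection `π` moves a vector only by elements of its kernel, which lies in the tangent
  -- space of the face; so the coordinates vanishing at `e` keep the value `1`.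
  refine ⟨π.app M.C.oneVec, ?_, fun m => ?_⟩
  · refine (M.C.inward (M.relOpen.subset heU) fun j hj => ?_).of_relOpen M.relOpen heU
    have h1 := hπ (M.C.oneVec.1 0 - π.map 0 (M.C.oneVec.1 0)) (by rw [map_sub, hππ, sub_self]) j hj
    rw [← M.C.coordₗ_apply, map_sub, M.C.coordₗ_apply, M.C.coord_oneVec, M.C.coordₗ_apply,
      sub_eq_zero] at h1
    show 0 < M.C.coord j (π.map 0 (M.C.oneVec.1 0))
    rw [← h1]
    exact one_pos
  · have h1 : (π.app M.C.oneVec).1 m ∈ range (P.map m) := by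
      rw [← hπP]; exact ⟨_, rfl⟩
    obtain ⟨z, hz⟩ := h1
    have h2 := (M.hr.comp M.hr M.r_mapsTo).unique M.hr M.r_idem M.fat heU m
    rw [StrongModel.r_smooth_val he] at h2
    rw [← hz, hPD]
    exact congrArg (fun B => B z) h2

section

variable {X : Type v} [TopologicalSpace X] {Y : X → Type w} [∀ x, AddCommGroup (Y x)]
  [∀ x, Module ℝ (Y x)] [TopologicalSpace (Bundle.TotalSpace Unit Y)]

namespace FilledPair

variable {b c : StrongChart.{u} X Y} {σ : ∀ x, Y x} {N : Set X} (A : FilledPair b c σ N)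
  {x : X} {e : c.M.E.Smooth}

theorem isLinearization (hx : x ∈ N) (he : e.1 0 = c.φ x) : c.IsLinearization σ e
    (c.M.hr.op e (A.mem_U hx he)) (c.Q e (A.mem_U hx he))
    ((c.Q e (A.mem_U hx he)).comp (A.hf.op e (A.mem_U hx he))) :=
  ⟨c.M.hasScDeriv_r e _, fun _ _ => rfl, A.f, _, A.f_rep, A.f_deriv e _, fun _ _ => rfl⟩

theorem eq_of_isLinearization (hx : x ∈ N) (he : e.1 0 = c.φ x) {P : ScOp c.M.E c.M.E}
    {Q : ScOp c.M.F c.M.F} {D D' : ScOp c.M.E c.M.F} (hP : HasScDeriv c.M.r c.M.U e P)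
    (hQ : ∀ m h, Q.map m h = c.M.Γ m (e.1 m, h)) (hD' : HasScDeriv A.f c.M.U e D')
    (hD : ∀ m X, D.map m X = Q.map m (D'.map m X)) :
    P = c.M.hr.op e (A.mem_U hx he) ∧ Q = c.Q e (A.mem_U hx he) ∧
      D = (c.Q e (A.mem_U hx he)).comp (A.hf.op e (A.mem_U hx he)) := by
  have h2 : Q = c.Q e (A.mem_U hx he) := by
    ext m h
    exact hQ m h
  refine ⟨?_, h2, ?_⟩
  · ext m Z
    rw [hP.eq c.M.hr c.M.fat (A.mem_U hx he)]
    rfl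
  · ext m Z
    rw [hD, hD'.eq A.hf c.M.fat (A.mem_U hx he), h2]
    rfl

end FilledPair

/-- The data provided by the sc-Fredholm property of the section `σ` at the point `x`, relative to a given
trivialization `c`. -/
structure FredholmPair (S : StrongBundle.{u} X Y) (c : StrongChart.{u} X Y) (σ : ∀ x, Y x) (x : X) where
  b : StrongChart.{u} X Y
  N : Set X
  A : FilledPair b c σ N
  mem : x ∈ N
  tame : b.M.IsTame
  e₀ : b.M.E.Smooth
  he₀ : e₀.1 0 = b.φ x
  d : ℕ
  mem_O : ∀ y ∈ b.M.U, b.M.Γ 0 (b.M.r 0 y, A.g 0 y) = A.g 0 y → y ∈ b.M.O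
  filling : ∃ (P : ScOp b.M.E b.M.E) (H : ScOp b.M.E b.M.F), HasScDeriv b.M.r b.M.U e₀ P ∧
    HasScDeriv (fun m y => A.g m y - b.M.Γ m (b.M.r m y, A.g m y)) b.M.U e₀ H ∧
    BijOn (H.map 0) {X | P.map 0 X = 0} {h | b.M.Γ 0 (e₀.1 0, h) = 0}
  conj : ConjToBasicGerm b.M.U d A.g e₀
  a : StrongChart.{u} X Y
  ha : a ∈ S.atlas
  hNa : N ⊆ a.dom
  ab : a.Trans b N
  ac : a.Trans c N

/-- Trivializations are compatible with the atlas, not a priori with each other; the transition maps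
between `b` and `c` are therefore composed through a chart `a` of the atlas around the point. -/
theorem StrongBundle.IsScFredholmSection.exists_fredholmPair {S : StrongBundle.{u} X Y} {σ : ∀ x, Y x}
    (hσ : S.IsScFredholmSection σ) {c : StrongChart.{u} X Y} (hc : S.IsTrivialization c) (x : S.SmoothPt)
    (hx : x.1 ∈ c.dom) {f : ScFam c.M.E c.M.F} (hf : c.IsLocalRep σ f) :
    ∃ B : FredholmPair S c σ x.1, B.A.f = f := by
  obtain ⟨b, hb, htame, hxb, e₀, τ, g, d, he₀, hτ, ⟨hg, hgτ, hgO, hfill⟩, hconj⟩ := hσ.fredholm x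
  obtain ⟨a, ha, hxa⟩ := S.cover x.1
  set N := a.dom ∩ (b.dom ∩ c.dom) with hN
  have hNa : N ⊆ a.dom := inter_subset_left
  have hNb : N ⊆ b.dom := fun _ h => h.2.1
  have hNc : N ⊆ c.dom := fun _ h => h.2.2
  obtain ⟨ab⟩ := (hb a ha).2.exists_trans (subset_inter hNa hNb)
  obtain ⟨ba⟩ := (hb a ha).1.exists_trans (subset_inter hNb hNa)
  obtain ⟨ac⟩ := (hc a ha).2.exists_trans (subset_inter hNa hNc)
  obtain ⟨ca⟩ := (hc a ha).1.exists_trans (subset_inter hNc hNa)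
  obtain ⟨Df, hDf, hDf'⟩ := hf.1.exists_sc1
  obtain ⟨Dg, hDg, -⟩ := hg.exists_sc1
  exact ⟨{
    b := b
    N := N
    A := {
      isOpen := a.dom_open.inter (b.dom_open.inter c.dom_open)
      hb := hNb
      hc := hNc
      tr := ac.comp ba hNa
      tr' := ab.comp ca hNa
      f := f
      Df := Df
      hf := hDf
      f_deriv := fun e he m => hDf' m _ (smooth_mem_lev.2 he)
      f_rep := hf
      g := g
      Dg := Dg
      hg := hDg
      g_eq := fun z hz => by rw [hgτ _ (b.φ_mem hz), hτ z hz] }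
    mem := ⟨hxa, hxb, hx⟩
    tame := htame
    e₀ := e₀
    he₀ := he₀
    d := d
    mem_O := hgO
    filling := hfill
    conj := hconj
    a := a
    ha := ha
    hNa := hNa
    ab := ab
    ac := ac }, rfl⟩

namespace FredholmPair

variable {S : StrongBundle.{u} X Y} {c : StrongChart.{u} X Y} {σ : ∀ x, Y x} {x : X}
  (B : FredholmPair S c σ x) {e : c.M.E.Smooth}

theorem exists_germChart (he : e.1 0 = c.φ x) : ∃ (W : ScSpace.{u}) (k n : ℕ),
    Nonempty (GermChart (B.b.pre B.N) B.A.g B.A.q B.e₀ (B.A.val e) W k n B.d) := by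
  obtain ⟨q₁, Dq₁, h₁, h₂⟩ := B.A.exists_strong_q
  exact B.conj.exists_germChart (B.b.relOpen_pre B.A.isOpen B.A.hb) (B.A.mem_pre' B.mem B.he₀) B.A.hq
    B.A.q_lin h₁ h₂ (B.A.g_e' B.mem B.he₀ he).symm

/-- The linearization of the filled section at the centre. -/
noncomputable def T (e : c.M.E.Smooth) : ScOp B.b.M.E B.b.M.F := B.A.T B.mem B.he₀ e

theorem isFredholm_T (he : e.1 0 = c.φ x) : (B.T e).IsFredholm := by
  obtain ⟨W, k, n, ⟨C⟩⟩ := B.exists_germChart he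
  exact C.isFredholm_center B.A.hg' B.A.hq B.A.q_lin B.A.fat_b (B.A.g_e' B.mem B.he₀ he)

/-- The operators at the centre, in the two trivializations. -/
noncomputable def transfer (he : e.1 0 = c.φ x) := B.A.transfer B.mem B.he₀ he

/-- The filling condition in terms of `T`: by `filling_deriv` the operator in that condition is `(id
- Γ) ∘ T`. -/
theorem exists_filling_op (he : e.1 0 = c.φ x) :
    BijOn (fun Z => (B.T e).map 0 Z - (B.b.Q B.e₀ (B.A.mem_U' B.mem B.he₀)).map 0 ((B.T e).map 0 Z))
      {Z | (B.b.M.hr.op B.e₀ (B.A.mem_U' B.mem B.he₀)).map 0 Z = 0}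
      {h | (B.b.Q B.e₀ (B.A.mem_U' B.mem B.he₀)).map 0 h = 0} := by
  obtain ⟨P, H, hP, hH, hbij⟩ := B.filling
  have hPD : ∀ Z, P.map 0 Z = (B.b.M.hr.op B.e₀ (B.A.mem_U' B.mem B.he₀)).map 0 Z := fun Z => by
    rw [hP.eq B.b.M.hr B.b.M.fat (B.A.mem_U' B.mem B.he₀)]
    rfl
  have hHD := fun Z => B.A.filling_deriv B.mem B.he₀ he hH 0 Z
  have e1 : (H.map 0 : _ → _) = (fun Z => (B.T e).map 0 Z -
    (B.b.Q B.e₀ (B.A.mem_U' B.mem B.he₀)).map 0 ((B.T e).map 0 Z)) := funext hHD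
  rw [e1] at hbij
  simp only [hPD] at hbij
  exact hbij

/-- The vectors `T Z` and `T (P' Z)` both lie in the fibre, so `(id - Q') ∘ T` annihilates `Z - P'
Z`, a vector of the kernel of `P'`; on that kernel it is injective by the filling condition. -/
theorem fixed_center (he : e.1 0 = c.φ x) (m : ℕ) (Z : B.b.M.E.L m) (k : c.M.F.L m)
    (h : (B.T e).map m Z = (B.transfer he).q.map m k) :
    (B.b.M.hr.op B.e₀ (B.A.mem_U' B.mem B.he₀)).map m Z = Z := by
  set P' := B.b.M.hr.op B.e₀ (B.A.mem_U' B.mem B.he₀) with hP'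
  set Q' := B.b.Q B.e₀ (B.A.mem_U' B.mem B.he₀) with hQ'
  have hbij := B.exists_filling_op he
  have hQq : ∀ k, Q'.map 0 ((B.transfer he).q.map 0 k) = (B.transfer he).q.map 0 k := fun k => by
    rw [hQ', ← B.A.transfer_q_q' B.mem B.he₀ he]
    show (B.transfer he).q.map 0 ((B.transfer he).q'.map 0 ((B.transfer he).q.map 0 k)) = _
    rw [(B.transfer he).q'_q, (B.transfer he).q_Q]
  apply down_injective m
  rw [ScOp.down_map]
  set z := B.b.M.E.down m Z with hz
  have h0 : (B.T e).map 0 z = (B.transfer he).q.map 0 (c.M.F.down m k) := by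
    rw [hz, ← ScOp.down_map, h, ScOp.down_map]
  have h1 : (B.T e).map 0 (P'.map 0 z) = _ := (B.transfer he).T_P' 0 z
  have hPP : P'.map 0 (P'.map 0 z) = P'.map 0 z := by
    rw [hP', ← (B.transfer he).a'_a 0 z, ← (B.transfer he).a'_a, (B.transfer he).a_a',
      (B.transfer he).P_a]
  have h2 : z - P'.map 0 z = 0 := hbij.injOn (by
      show P'.map 0 (z - P'.map 0 z) = 0
      rw [map_sub, hPP, sub_self]) (map_zero (P'.map 0)) (by
      show (B.T e).map 0 (z - P'.map 0 z) - Q'.map 0 ((B.T e).map 0 (z - P'.map 0 z)) =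
        (B.T e).map 0 0 - Q'.map 0 ((B.T e).map 0 0)
      rw [map_sub (B.T e |>.map 0), h0, h1, map_sub, hQq, hQq, sub_self, map_zero, map_zero, sub_self])
  exact (sub_eq_zero.1 h2).symm

/-- The section covers the fibre directions and the filling covers the complementary ones.
Surjectivity on level `i` reaches only smooth vectors of the fibre directly; density and closedness
of the range on level `0` do the rest. -/
theorem surjective_center (he : e.1 0 = c.φ x) {i : ℕ}
    (h : MapsLevelOnto (c.M.hr.op e (B.A.mem_U B.mem he)) (c.Q e (B.A.mem_U B.mem he))
      ((c.Q e (B.A.mem_U B.mem he)).comp (B.A.hf.op e (B.A.mem_U B.mem he))) i) (m : ℕ) :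
    Function.Surjective ((B.T e).map m) := by
  set P' := B.b.M.hr.op B.e₀ (B.A.mem_U' B.mem B.he₀) with hP'
  set Q' := B.b.Q B.e₀ (B.A.mem_U' B.mem B.he₀) with hQ'
  refine (B.isFredholm_T he).surjective_of_dense fun y => ?_
  have hQQ : ∀ w, Q'.map 0 (Q'.map 0 w) = Q'.map 0 w := fun w => by
    rw [hQ', ← B.A.transfer_q_q' B.mem B.he₀ he, ← B.A.transfer_q_q' B.mem B.he₀ he]
    show (B.transfer he).q.map 0 ((B.transfer he).q'.map 0 ((B.transfer he).q.map 0 _)) = _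
    rw [(B.transfer he).q'_q, (B.transfer he).q_Q]
    rfl
  -- the range of `Q'` lies in the closure of the range of `T`
  have hcl : ∀ w, Q'.map 0 w ∈ closure (range ((B.T e).map 0)) := by
    intro w
    refine (B.b.M.F.dense 0).induction_on (p := fun w => Q'.map 0 w ∈ closure (range ((B.T e).map 0))) w
      (isClosed_closure.preimage (Q'.map 0).continuous) fun w => subset_closure ?_
    obtain ⟨Z, hZ⟩ := (B.transfer he).mem_range_of_mapsLevelOnto h (w.1 i)
    refine ⟨B.b.M.E.down i Z, ?_⟩
    have h1 : (B.A.T B.mem B.he₀ e).map i Z = Q'.map i (w.1 i) :=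
      hZ.trans (B.A.transfer_q_q' B.mem B.he₀ he i _)
    have h2 := congrArg (B.b.M.F.down i) h1
    rw [ScOp.down_map, ScOp.down_map, down_smooth] at h2
    exact h2
  obtain ⟨Z, -, hZ⟩ := (B.exists_filling_op he).surjOn (show y.1 0 - Q'.map 0 (y.1 0) ∈ _ by
    show Q'.map 0 (y.1 0 - Q'.map 0 (y.1 0)) = 0
    rw [map_sub, hQQ, sub_self])
  have hZ : (B.T e).map 0 Z - Q'.map 0 ((B.T e).map 0 Z) = y.1 0 - Q'.map 0 (y.1 0) := hZ
  -- Once `T Z` matches the part of `y` outside the fibre, the remainder lies in the fibre, where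
  -- the closure statement applies.
  have hy : y.1 0 = (B.T e).map 0 Z + Q'.map 0 (y.1 0 - (B.T e).map 0 Z) := by
    rw [map_sub, ← sub_eq_zero]
    rw [← sub_eq_zero] at hZ
    rw [← neg_eq_zero, ← hZ]
    abel
  have hsub : closure (range ((B.T e).map 0)) =
      (((LinearMap.range ((B.T e).map 0).toLinearMap).topologicalClosure : Submodule ℝ _) : Set _) := by
    rw [Submodule.topologicalClosure_coe]
    rfl
  rw [hy]
  have h1 : (B.T e).map 0 Z ∈ closure (range ((B.T e).map 0)) := subset_closure ⟨Z, rfl⟩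
  have h2 := hcl (y.1 0 - (B.T e).map 0 Z)
  rw [hsub] at h1 h2 ⊢
  exact add_mem h1 h2

/-- Near the centre, the linearization of the filled section remains surjective, and its behaviour
transverse to the retract remains as required by the definition of a filling. -/
theorem near (he : e.1 0 = c.φ x) (n : ℕ) (hs : ∀ m, Function.Surjective ((B.T e).map m)) :
    ∃ δ > 0, ∀ x₁ : X, ∀ e₁' : B.b.M.E.Smooth, ∀ e₁ : c.M.E.Smooth, ∀ (hx₁ : x₁ ∈ B.N)
      (he₁' : e₁'.1 0 = B.b.φ x₁) (he₁ : e₁.1 0 = c.φ x₁), ‖e₁'.1 (n + 2) - B.e₀.1 (n + 2)‖ < δ →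
      ‖B.A.f (n + 2) (e₁.1 (n + 2)) - B.A.f (n + 2) (e.1 (n + 2))‖ < δ →
      Function.Surjective ((B.A.T hx₁ he₁' e₁).map (n + 1)) ∧
      (Function.Injective ((B.T e).map (n + 1)) →
        Function.Injective ((B.A.T hx₁ he₁' e₁).map (n + 1))) ∧
      ∀ Z k, (B.A.T hx₁ he₁' e₁).map (n + 1) Z = (B.A.transfer hx₁ he₁' he₁).q.map (n + 1) k →
        (B.b.M.hr.op e₁' (B.A.mem_U' hx₁ he₁')).map (n + 1) Z = Z := by
  obtain ⟨W, k, l, ⟨C⟩⟩ := B.exists_germChart he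
  have hZ := B.A.g_e' B.mem B.he₀ he
  have hm := B.A.mem_pre' B.mem B.he₀
  obtain ⟨δ₁, hδ₁, h₁⟩ := C.lin_near B.A.hg' B.A.hq B.A.q_lin B.A.fat_b hZ hm n (hs (n + 1))
  obtain ⟨δ₂, hδ₂, h₂⟩ := C.deriv_eq_zero B.A.hg' B.A.hq B.A.q_lin B.A.fat_b hZ hm n (hs 0)
  refine ⟨min δ₁ δ₂, lt_min hδ₁ hδ₂, fun x₁ e₁' e₁ hx₁ he₁' he₁ hd hd' => ?_⟩
  have hZ₁ := B.A.g_e' hx₁ he₁' he₁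
  have hm₁ := B.A.mem_pre' hx₁ he₁'
  have hd'' : ‖(B.A.val e₁).1 (n + 2) - (B.A.val e).1 (n + 2)‖ < min δ₁ δ₂ := by
    rw [B.A.val_val hx₁ he₁, B.A.val_val B.mem he]
    exact hd'
  obtain ⟨hsurj, hinj⟩ := h₁ e₁' (B.A.val e₁) hm₁ (hd.trans_le (min_le_left _ _))
    (hd''.trans_le (min_le_left _ _)) hZ₁
  refine ⟨hsurj, hinj, fun Z k hZk => ?_⟩
  have heO : e₁'.1 0 ∈ B.b.M.O := by rw [he₁']; exact B.b.φ_mem (B.A.hb hx₁)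
  obtain ⟨ν, hν, hνr⟩ := B.tame.exists_inward heO
  -- Applied to `R = id - r`, which vanishes at all solutions of `g y = q (y, h)`: there `g y` lies
  -- in the fibre over `r y`, so `y` is in the retract. Tameness supplies the inward vector
  -- annihilated by the derivative of `R`.
  have h3 := h₂ e₁' (B.A.val e₁) hm₁ (hd.trans_le (min_le_right _ _))
    (hd''.trans_le (min_le_right _ _)) hZ₁ B.b.M.E _ _
    ((Sc1.ofOp (ScOp.id B.b.M.E) (B.b.pre B.N)).sub FilledPair.hr_b)
    (fun y hy h hyh => by
      show y - B.b.M.r 0 y = 0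
      rw [StrongModel.r_of_mem_O (B.mem_O y hy.1 (by rw [hyh, B.A.Γ_q hy])), sub_self])
    ν (hν.of_relOpen (B.b.relOpen_pre B.A.isOpen B.A.hb) hm₁)
    (by
      show ν.1 n - B.b.M.Dr n (e₁'.1 (n + 1)) (ν.1 n) = 0
      rw [hνr, sub_self])
    ⟨_, by
      have := (B.A.transfer hx₁ he₁' he₁).T_P' (n + 1) (ν.1 (n + 1))
      have h4 : (B.b.M.hr.op e₁' (B.A.mem_U' hx₁ he₁')).map (n + 1) (ν.1 (n + 1)) = ν.1 (n + 1) :=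
        hνr (n + 1)
      rw [h4] at this
      exact this⟩ Z k hZk
  have h4 : B.b.M.E.incl n Z - B.b.M.Dr n (e₁'.1 (n + 1)) (B.b.M.E.incl n Z) = 0 := h3
  apply B.b.M.E.incl_injective n
  rw [ScOp.comm]
  exact (sub_eq_zero.1 h4).symm

end FredholmPair

end

/-! ### Openness in the level topologies of the base -/

section

variable {X : Type v} [TopologicalSpace X] {Y : X → Type w} [∀ x, AddCommGroup (Y x)]
  [∀ x, Module ℝ (Y x)] [TopologicalSpace (Bundle.TotalSpace Unit Y)]

theorem StrongBundle.isOpen_smoothTopology {S : StrongBundle.{u} X Y} {m : ℕ} {A : Set S.SmoothPt}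
    (h : ∀ x ∈ A, ∃ a ∈ S.atlas, ∃ B : Set (a.M.E.L m), IsOpen B ∧
      (x.1 ∈ a.dom ∧ ∃ y ∈ B, a.M.E.down m y = a.φ x.1) ∧
      ∀ x' : S.SmoothPt, x'.1 ∈ a.dom → (∃ y ∈ B, a.M.E.down m y = a.φ x'.1) → x' ∈ A) :
    IsOpen[S.smoothTopology m] A := by
  let _ : TopologicalSpace S.SmoothPt := S.smoothTopology m
  rw [isOpen_iff_forall_mem_open]
  intro x hx
  obtain ⟨a, ha, B, hB, hxB, hA⟩ := h x hx
  exact ⟨_, fun x' hx' => hA x' hx'.1 hx'.2, (isOpen_induced_iff (t := S.levelTopology m)).2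
    ⟨{x : S.Level m | x.1 ∈ a.dom ∧ ∃ y ∈ B, a.M.E.down m y = a.φ x.1},
      TopologicalSpace.isOpen_generateFrom_of_mem ⟨a, ha, B, hB, rfl⟩, rfl⟩, hxB⟩

/-- A smooth point of the base is represented by a smooth point in each compatible trivialization. -/
theorem StrongBundle.exists_smooth_rep {S : StrongBundle.{u} X Y} {c : StrongChart.{u} X Y}
    (hc : ∀ a ∈ S.atlas, a.Transition c) (x : S.SmoothPt) (hx : x.1 ∈ c.dom) :
    ∃ e : c.M.E.Smooth, e.1 0 = c.φ x.1 := by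
  refine exists_smooth _ fun m => ?_
  obtain ⟨a, ha, hxa, y, hy⟩ := x.2 m
  obtain ⟨A⟩ := (hc a ha).exists_trans (N := {x.1}) (by simpa using ⟨hxa, hx⟩)
  have hpre : y ∈ a.M.E.lev (a.pre {x.1}) m := by
    rw [mem_lev, hy]
    exact a.φ_mem_pre (by simpa using hxa) rfl
  refine ⟨A.t m y, ?_⟩
  rw [A.ht.cont.down hpre, hy]
  exact A.t_eq _ (a.φ_mem_U hxa) _ rfl (a.r_φ hxa).symm

theorem StrongChart.Trans.t_val {a b : StrongChart.{u} X Y} {N : Set X} (A : a.Trans b N) (ha : N ⊆ a.dom)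
    {x : X} (hx : x ∈ N) {m : ℕ} {y : a.M.E.L m} (hy : a.M.E.down m y = a.φ x) {e : b.M.E.Smooth}
    (he : e.1 0 = b.φ x) : A.t m y = e.1 m := by
  apply down_injective m
  rw [A.ht.cont.down (by rw [mem_lev, hy]; exact a.φ_mem_pre ha hx), hy, down_smooth, he]
  exact A.t_eq _ (a.φ_mem_U (ha hx)) x hx (a.r_φ (ha hx)).symm

namespace FredholmPair

variable {S : StrongBundle.{u} X Y} {c : StrongChart.{u} X Y} {σ : ∀ x, Y x} {x : S.SmoothPt}
  (B : FredholmPair S c σ x.1) {e : c.M.E.Smooth}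

/-- The level topology is generated by charts of the atlas, so the neighbourhood is taken in the
chart `a`; the transition maps from `a` to `b` and to `c` are continuous on level `m`. -/
theorem exists_nhd (he : e.1 0 = c.φ x.1) (m : ℕ) {δ : ℝ} (hδ : 0 < δ) :
    ∃ O : Set (B.a.M.E.L m), IsOpen O ∧ (x.1 ∈ B.a.dom ∧ ∃ y ∈ O, B.a.M.E.down m y = B.a.φ x.1) ∧
    ∀ x₁ ∈ B.a.dom, (∃ y ∈ O, B.a.M.E.down m y = B.a.φ x₁) → x₁ ∈ B.N ∧
    ∀ (e₁' : B.b.M.E.Smooth) (e₁ : c.M.E.Smooth), e₁'.1 0 = B.b.φ x₁ → e₁.1 0 = c.φ x₁ →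
      ‖e₁'.1 m - B.e₀.1 m‖ < δ ∧ ‖B.A.f m (e₁.1 m) - B.A.f m (e.1 m)‖ < δ := by
  obtain ⟨ea, hea⟩ := StrongBundle.exists_smooth_rep (fun a' ha' => S.compat a' ha' B.a B.ha) x
    (B.hNa B.mem)
  obtain ⟨Ω, hΩ, hNΩ⟩ := B.a.exists_isOpen_image B.A.isOpen B.hNa
  have hpre : ∀ x₁ ∈ B.N, ∀ y : B.a.M.E.L m, B.a.M.E.down m y = B.a.φ x₁ →
      y ∈ B.a.M.E.lev (B.a.pre B.N) m := fun x₁ hx₁ y hy => by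
    rw [mem_lev, hy]
    exact B.a.φ_mem_pre B.hNa hx₁
  have hea' : B.a.M.E.down m (ea.1 m) = B.a.φ x.1 := by rw [down_smooth, hea]
  obtain ⟨δ₁, hδ₁, h₁⟩ := Metric.continuousOn_iff.1 (B.ab.ht.cont.1 m) (ea.1 m)
    (hpre _ B.mem _ hea') δ hδ
  obtain ⟨δ₂, hδ₂, h₂⟩ := Metric.continuousOn_iff.1 ((B.A.hf.cont.comp B.ac.ht.cont fun y hy =>
    c.pre_subset B.N (B.ac.mapsTo B.A.hc hy)).1 m) (ea.1 m) (hpre _ B.mem _ hea') δ hδ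
  have hmem : ∀ x₁ ∈ B.a.dom, B.a.φ x₁ ∈ Ω ↔ x₁ ∈ B.N := by
    intro x₁ hx₁
    constructor
    · intro h
      have : B.a.φ x₁ ∈ B.a.φ '' B.N := by
        rw [hNΩ]; exact ⟨B.a.φ_mem hx₁, h⟩
      obtain ⟨x₂, hx₂, h₂⟩ := this
      rwa [← B.a.φ_inj (B.hNa hx₂) hx₁ h₂]
    · intro h
      have : B.a.φ x₁ ∈ B.a.φ '' B.N := mem_image_of_mem _ h
      rw [hNΩ] at this
      exact this.2
  refine ⟨Metric.ball (ea.1 m) (min δ₁ δ₂) ∩ B.a.M.E.down m ⁻¹' Ω,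
    Metric.isOpen_ball.inter (hΩ.preimage (B.a.M.E.down m).continuous),
    ⟨B.hNa B.mem, ea.1 m, ⟨Metric.mem_ball_self (lt_min hδ₁ hδ₂), ?_⟩, hea'⟩, ?_⟩
  · rw [mem_preimage, hea', hmem _ (B.hNa B.mem)]
    exact B.mem
  · rintro x₁ hx₁ ⟨y, ⟨hyb, hyΩ⟩, hy⟩
    have hx₁N : x₁ ∈ B.N := by
      rw [mem_preimage, hy] at hyΩ
      exact (hmem x₁ hx₁).1 hyΩ
    refine ⟨hx₁N, fun e₁' e₁ he₁' he₁ => ?_⟩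
    have h3 := h₁ y (hpre x₁ hx₁N y hy) (lt_of_lt_of_le hyb (min_le_left _ _))
    have h4 := h₂ y (hpre x₁ hx₁N y hy) (lt_of_lt_of_le hyb (min_le_right _ _))
    rw [B.ab.t_val B.hNa hx₁N hy he₁', B.ab.t_val B.hNa B.mem hea' B.he₀, dist_eq_norm] at h3
    have h4 : dist (B.A.f m (B.ac.t m y)) (B.A.f m (B.ac.t m (ea.1 m))) < δ := h4
    rw [B.ac.t_val B.hNa hx₁N hy he₁, B.ac.t_val B.hNa B.mem hea' he, dist_eq_norm] at h4
    exact ⟨h3, h4⟩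

/-- If the linearization of the filled section at the centre is surjective, then so it is at the smooth
points of a neighbourhood. -/
theorem exists_nhd_surjective (hc : S.IsTrivialization c) (he : e.1 0 = c.φ x.1) (n : ℕ)
    (hs : ∀ m, Function.Surjective ((B.T e).map m)) :
    ∃ a ∈ S.atlas, ∃ O : Set (a.M.E.L (n + 2)), IsOpen O ∧
      (x.1 ∈ a.dom ∧ ∃ y ∈ O, a.M.E.down (n + 2) y = a.φ x.1) ∧
    ∀ x₁ : S.SmoothPt, x₁.1 ∈ a.dom → (∃ y ∈ O, a.M.E.down (n + 2) y = a.φ x₁.1) →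
      ∃ (e₁' : B.b.M.E.Smooth) (e₁ : c.M.E.Smooth) (hx₁ : x₁.1 ∈ B.N) (he₁' : e₁'.1 0 = B.b.φ x₁.1)
        (he₁ : e₁.1 0 = c.φ x₁.1), Function.Surjective ((B.A.T hx₁ he₁' e₁).map (n + 1)) ∧
      (Function.Injective ((B.T e).map (n + 1)) →
        Function.Injective ((B.A.T hx₁ he₁' e₁).map (n + 1))) ∧
      ∀ Z k, (B.A.T hx₁ he₁' e₁).map (n + 1) Z = (B.A.transfer hx₁ he₁' he₁).q.map (n + 1) k →
        (B.b.M.hr.op e₁' (B.A.mem_U' hx₁ he₁')).map (n + 1) Z = Z := by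
  obtain ⟨δ, hδ, hnear⟩ := B.near he n hs
  obtain ⟨O, hO, hxO, h⟩ := B.exists_nhd he (n + 2) hδ
  refine ⟨B.a, B.ha, O, hO, hxO, fun x₁ hx₁ hy => ?_⟩
  obtain ⟨hN, h⟩ := h x₁.1 hx₁ hy
  obtain ⟨ea, hea⟩ := StrongBundle.exists_smooth_rep (fun a' ha' => S.compat a' ha' B.a B.ha) x₁ hx₁
  obtain ⟨e₁, he₁⟩ := StrongBundle.exists_smooth_rep (fun a ha => (hc a ha).2) x₁ (B.A.hc hN)
  have hpre : ea.1 0 ∈ B.a.pre B.N := by rw [hea]; exact B.a.φ_mem_pre B.hNa hN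
  have he₁' : (B.ab.ht.cont.app ea).1 0 = B.b.φ x₁.1 := by
    rw [B.ab.ht.cont.app_val hpre, hea]
    exact B.ab.t_eq _ (B.a.φ_mem_U hx₁) x₁.1 hN (B.a.r_φ hx₁).symm
  obtain ⟨h1, h2⟩ := h _ e₁ he₁' he₁
  exact ⟨_, e₁, hN, he₁', he₁, hnear x₁.1 _ e₁ hN he₁' he₁ h1 h2⟩

end FredholmPair

variable {S : StrongBundle.{u} X Y} {σ : ∀ x, Y x} {c : StrongChart.{u} X Y}

/-- The smooth points at which the linearization of `σ` in `c` has a given property. -/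
def linSet (S : StrongBundle.{u} X Y) (σ : ∀ x, Y x) (c : StrongChart.{u} X Y)
    (p : ScOp c.M.E c.M.E → ScOp c.M.F c.M.F → ScOp c.M.E c.M.F → Prop) : Set S.SmoothPt :=
  {x | x.1 ∈ c.dom ∧ ∃ e P Q D, e.1 0 = c.φ x.1 ∧ c.IsLinearization σ e P Q D ∧ p P Q D}

/-- At a point where the linearization has a property `p`, there is a sc-Fredholm trivialization such that
the linearization has this property. -/
theorem exists_of_mem_linSet (hσ : S.IsScFredholmSection σ) (hc : S.IsTrivialization c)
    {p : ScOp c.M.E c.M.E → ScOp c.M.F c.M.F → ScOp c.M.E c.M.F → Prop} {x : S.SmoothPt}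
    (hx : x ∈ linSet S σ c p) : ∃ (B : FredholmPair S c σ x.1) (e : c.M.E.Smooth) (he : e.1 0 = c.φ x.1),
      p (c.M.hr.op e (B.A.mem_U B.mem he)) (c.Q e (B.A.mem_U B.mem he))
      ((c.Q e (B.A.mem_U B.mem he)).comp (B.A.hf.op e (B.A.mem_U B.mem he))) := by
  obtain ⟨hxc, e, P, Q, D, he, ⟨hP, hQ, f, D', hf, hD', hD⟩, hp⟩ := hx
  obtain ⟨B, rfl⟩ := hσ.exists_fredholmPair hc x hxc hf
  obtain ⟨rfl, rfl, rfl⟩ := B.A.eq_of_isLinearization B.mem he hP hQ hD' hD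
  exact ⟨B, e, he, hp⟩

/-- Surjectivity of the section's linearization makes the filled linearization surjective at the
centre. Its properties nearby come from `FredholmPair.near`, and `hstep` translates them back into
the property `p`. -/
theorem isOpen_linSet (hσ : S.IsScFredholmSection σ) (hc : S.IsTrivialization c)
    {p : ScOp c.M.E c.M.E → ScOp c.M.F c.M.F → ScOp c.M.E c.M.F → Prop} {n : ℕ}
    (hp : ∀ P Q D, p P Q D → MapsLevelOnto P Q D (n + 1))
    (hstep : ∀ (x : S.SmoothPt) (B : FredholmPair S c σ x.1) (e : c.M.E.Smooth) (he : e.1 0 = c.φ x.1),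
      p (c.M.hr.op e (B.A.mem_U B.mem he)) (c.Q e (B.A.mem_U B.mem he))
        ((c.Q e (B.A.mem_U B.mem he)).comp (B.A.hf.op e (B.A.mem_U B.mem he))) →
      ∀ (x₁ : S.SmoothPt) (e₁' : B.b.M.E.Smooth) (e₁ : c.M.E.Smooth) (hx₁ : x₁.1 ∈ B.N)
        (he₁' : e₁'.1 0 = B.b.φ x₁.1) (he₁ : e₁.1 0 = c.φ x₁.1),
      Function.Surjective ((B.A.T hx₁ he₁' e₁).map (n + 1)) →
      (Function.Injective ((B.T e).map (n + 1)) →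
        Function.Injective ((B.A.T hx₁ he₁' e₁).map (n + 1))) →
      (∀ Z k, (B.A.T hx₁ he₁' e₁).map (n + 1) Z = (B.A.transfer hx₁ he₁' he₁).q.map (n + 1) k →
        (B.b.M.hr.op e₁' (B.A.mem_U' hx₁ he₁')).map (n + 1) Z = Z) →
      p (c.M.hr.op e₁ (B.A.mem_U hx₁ he₁)) (c.Q e₁ (B.A.mem_U hx₁ he₁))
        ((c.Q e₁ (B.A.mem_U hx₁ he₁)).comp (B.A.hf.op e₁ (B.A.mem_U hx₁ he₁)))) :
    IsOpen[S.smoothTopology (n + 2)] (linSet S σ c p) := by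
  refine StrongBundle.isOpen_smoothTopology fun x hx => ?_
  obtain ⟨B, e, he, hpe⟩ := exists_of_mem_linSet hσ hc hx
  obtain ⟨a, ha, O, hO, hxO, h⟩ := B.exists_nhd_surjective hc he n (B.surjective_center he (hp _ _ _ hpe))
  refine ⟨a, ha, O, hO, hxO, fun x₁ hx₁ hy => ?_⟩
  obtain ⟨e₁', e₁, hN, he₁', he₁, h1, h2, h3⟩ := h x₁ hx₁ hy
  exact ⟨B.A.hc hN, e₁, _, _, _, he₁, B.A.isLinearization hN he₁,
    hstep x B e he hpe x₁ e₁' e₁ hN he₁' he₁ h1 h2 h3⟩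

theorem isOpen_setOf_mapsLevelOnto (hσ : S.IsScFredholmSection σ) (hc : S.IsTrivialization c) (n : ℕ) :
    IsOpen[S.smoothTopology (n + 2)] (linSet S σ c fun P Q D => MapsLevelOnto P Q D (n + 1)) :=
  isOpen_linSet hσ hc (fun _ _ _ h => h) fun _ B _ _ _ _ _ _ hx₁ he₁' he₁ hs _ hfix =>
    (B.A.transfer hx₁ he₁' he₁).mapsLevelOnto hs hfix

theorem isOpen_setOf_isIsoOnLevelBetween (hσ : S.IsScFredholmSection σ) (hc : S.IsTrivialization c)
    (n : ℕ) :
    IsOpen[S.smoothTopology (n + 2)] (linSet S σ c fun P Q D => IsIsoOnLevelBetween P Q D (n + 1)) :=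
  isOpen_linSet hσ hc (fun _ _ _ h => h.mapsLevelOnto) fun _ B _ he hp _ _ _ hx₁ he₁' he₁ hs hi hfix =>
    (B.A.transfer hx₁ he₁' he₁).isIsoOnLevelBetween
      ⟨hi ((B.transfer he).injective_of_isIsoOnLevelBetween hp (B.fixed_center he _)), hs⟩ hfix

/-- For sc-Fredholm sections, isomorphisms on one level are isomorphisms on all levels. -/
theorem linSet_isScIsoBetween (hσ : S.IsScFredholmSection σ) (hc : S.IsTrivialization c) (i : ℕ) :
    linSet S σ c IsScIsoBetween = linSet S σ c fun P Q D => IsIsoOnLevelBetween P Q D i := by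
  ext x
  constructor
  · rintro ⟨hx, e, P, Q, D, he, hl, h⟩
    exact ⟨hx, e, P, Q, D, he, hl, h.isIsoOnLevelBetween i⟩
  · intro hx
    obtain ⟨B, e, he, hp⟩ := exists_of_mem_linSet hσ hc hx
    refine ⟨hx.1, e, _, _, _, he, B.A.isLinearization B.mem he, ?_⟩
    have hi := (B.transfer he).injective_of_isIsoOnLevelBetween hp (B.fixed_center he _)
    exact (B.transfer he).isScIsoBetween (fun m => ⟨(B.isFredholm_T he).injective_of_level hi m,
      B.surjective_center he hp.mapsLevelOnto m⟩) (B.fixed_center he)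

end

theorem corollary3p3 :
    (∀ (E F : ScSpace.{u}) (s : ScFam E F), (∀ e₀ : E.Smooth, IsScFredholmAt s e₀) →
      ∀ i : ℕ, 1 ≤ i →
        IsOpen[TopologicalSpace.induced (fun e : E.Smooth => e.1 (i + 1)) inferInstance]
          {e : E.Smooth | ∃ D : ScOp E F, HasScDeriv s univ e D ∧ range (D.map i) = univ} ∧
        IsOpen[TopologicalSpace.induced (fun e : E.Smooth => e.1 (i + 1)) inferInstance]
          {e : E.Smooth | ∃ D : ScOp E F, HasScDeriv s univ e D ∧ D.IsIsoOnLevel i} ∧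
        IsOpen[TopologicalSpace.induced (fun e : E.Smooth => e.1 (i + 1)) inferInstance]
          {e : E.Smooth | ∃ D : ScOp E F, HasScDeriv s univ e D ∧ D.IsScIso}) ∧
    (∀ (X : Type v) [TopologicalSpace X] [T2Space X] [ParacompactSpace X] (Y : X → Type w)
      [∀ x, AddCommGroup (Y x)] [∀ x, Module ℝ (Y x)]
      [TopologicalSpace (Bundle.TotalSpace Unit Y)]
      (S : StrongBundle.{u} X Y) (σ : ∀ x, Y x), S.IsScFredholmSection σ →
      ∀ c : StrongChart.{u} X Y, S.IsTrivialization c →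
      ∀ i : ℕ, 1 ≤ i →
        IsOpen[S.smoothTopology (i + 1)]
          {x : S.SmoothPt | x.1 ∈ c.dom ∧ ∃ e P Q D, e.1 0 = c.φ x.1 ∧
            c.IsLinearization σ e P Q D ∧ MapsLevelOnto P Q D i} ∧
        IsOpen[S.smoothTopology (i + 1)]
          {x : S.SmoothPt | x.1 ∈ c.dom ∧ ∃ e P Q D, e.1 0 = c.φ x.1 ∧
            c.IsLinearization σ e P Q D ∧ IsIsoOnLevelBetween P Q D i} ∧
        IsOpen[S.smoothTopology (i + 1)]
          {x : S.SmoothPt | x.1 ∈ c.dom ∧ ∃ e P Q D, e.1 0 = c.φ x.1 ∧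
            c.IsLinearization σ e P Q D ∧ IsScIsoBetween P Q D}) := by
  refine ⟨fun E F s h i hi => corollary_maps h hi, ?_⟩
  intro X _ _ _ Y _ _ _ S σ hσ c hc i hi
  obtain ⟨n, rfl⟩ : ∃ n, i = n + 1 := ⟨i - 1, by omega⟩
  have h := isOpen_setOf_isIsoOnLevelBetween hσ hc n
  refine ⟨isOpen_setOf_mapsLevelOnto hσ hc n, h, ?_⟩
  -- For a sc-Fredholm section an isomorphism on the single level `n + 1` is already a
  -- sc-isomorphism, so the third set coincides with the second.
  rw [← linSet_isScIsoBetween hσ hc (n + 1)] at h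
  exact h
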